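/- Conventions. A triangulation $\Gamma$ of a closed surface is a finite simplicial complex, given by its triangular faces, whose geometric realization is the surface. A zigzag is a cyclic sequence of edges $e_1,\dots,e_n$ ($n$ being its smallest period) such that for all $i$ the edges $e_i,e_{i+1}$ are distinct edges of one face, the faces containing $e_i,e_{i+1}$ and $e_{i+1},e_{i+2}$ are distinct, and $e_i,e_{i+2}$ are disjoint. $\Gamma$ is $z$-knotted if it has precisely two zigzags, $Z$ and its reverse $Z^{-1}\neq Z$. A $z$-orientation chooses precisely one of $Z,Z^{-1}$ for every zigzag $Z$. With respect to a $z$-orientation an edge is of type I if the chosen zigzags pass through it in different directions, and of type II otherwise; a face is of type I if it has two edges of type I and one of type II; a zigzag is homogeneous if it is a cyclic sequence $\{e_i,e_i',e_i''\}_i$ with all $e_i$ of type II and all $e_i',e_i''$ of type I. In a $z$-knotted triangulation, distinct edges $c_1,c_2$ of type II with a common vertex form a special pair if the zigzag is a cyclic sequence of type $c_1,\dots,c_2,\dots,c_1,\dots,c_2,\dots$; special pairs $c_1,c_2$ and $t_1,t_2$ without common edge are concordant if the zigzag (in one of its two directions) is of type $c_1,\dots,t_1,\dots,c_2,\dots,t_2,\dots,c_1,\dots,t_1,\dots,c_2,\dots,t_2,\dots$.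 Gluing. Let $e_1=v_1v$, $e_2=vv_2$ be edges of $\Gamma$ and $e_1'=v_1'v'$, $e_2'=v'v_2'$ edges of $\Gamma'$, and call the two sides of $e_1\cup e_2$ at $v$, and of $e_1'\cup e_2'$ at $v'$, the $+$ side and the $-$ side. Cut both triangulations open along these paths, so that $v$ splits into $v^{+},v^{-}$ and $e_i$ into $e_i^{+},e_i^{-}$ (and similarly in $\Gamma'$), a face at $v$ on the $\delta$ side becoming a face at $v^\delta$; then glue the two quadrilateral holes, identifying $e_i^\delta$ with $e_i'^\delta$ and $v_i$ with $v_i'$. Construction. Let $BP_n$, $n\ge 3$, be the $n$-gonal bipyramid; its base is an $n$-cycle. Let $T$ be a finite rooted tree whose vertices are labelled so that: the root has label $2k+1$, where $k\ge 1$ and $k$ is not less than the degree of the root; every vertex that is neither the root nor a leaf has label $2k$ with $k$ not less than its degree; every leaf (non-root vertex of degree $1$) has an even label $\ge 4$. For every vertex $u$ of $T$ and every neighbour $w$ of $u$ choose a pair of consecutive edges in the base of $BP_{\mathrm{label}(u)}$, so that the pairs chosen at $u$ for different neighbours have no common edge. Start with the bipyramid of the root and, following the tree, glue step by step the bipyramid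 of each further vertex $u$, adjacent to an already treated vertex $p$, to the triangulation already obtained, along the pair chosen in the base of the bipyramid of $p$ for $u$ and the pair chosen in the base of the bipyramid of $u$ for $p$; the order of the two edges in a pair and the naming of the sides are arbitrary in every step. Theorem. Such a choice of pairs exists, and for every such choice the construction can be carried out until all vertices of $T$ are used. Every triangulation obtained in this way, at the end and after each intermediate step, is a $z$-knotted triangulation of the sphere $\mathbb S^2$ in which all faces are of type I and the zigzag is homogeneous. Moreover, in each of these triangulations, any two consecutive edges of the base of one of the bipyramids treated so far which were not exploited for the gluings performed so far form a special pair, and any two such pairs without common edge are concordant (so that every gluing is along a special pair, and these pairs are mutually concordant). -/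

import Mathlib

/-! ## Triangulations

A triangulation is given by the set `Γ` of its faces; a face is the set of its three vertices, an
edge is a two-element subset of a face.  In a triangulation of a closed surface by a simple graph
two distinct faces meet in an edge, in a vertex or not at all, so nothing is lost. -/

/-- The edges of the complex whose faces are the members of `Γ`. -/
def edgesOf {W : Type*} (Γ : Set (Finset W)) : Set (Finset W) :=
  {e | e.card = 2 ∧ ∃ F ∈ Γ, e ⊆ F}

/-- The geometric realization (barycentric coordinates), with the topology of pointwise
convergence of coordinates. -/
def realization {W : Type*} (Γ : Set (Finset W)) : Set (W → ℝ) :=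
  {f | (∀ x, 0 ≤ f x) ∧ ∃ F ∈ Γ, (∀ x, x ∉ F → f x = 0) ∧ ∑ x ∈ F, f x = 1}

/-- `Γ` is a triangulation of the two-dimensional sphere. -/
def IsSphereTriangulation {W : Type*} (Γ : Set (Finset W)) : Prop :=
  Γ.Finite ∧ (∀ F ∈ Γ, F.card = 3) ∧
    Nonempty (realization Γ ≃ₜ Metric.sphere (0 : EuclideanSpace ℝ (Fin 3)) 1)

/-! ## Zigzags

A zigzag is periodic, so it is represented by a sequence of edges indexed by the integers; two
sequences that differ by a shift of the index represent the same cyclic sequence. -/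

/-- Consecutive edges are distinct edges of one face, consecutive faces of this kind are distinct,
and `Z i`, `Z (i + 2)` do not intersect. -/
def IsZigzag {W : Type*} (Γ : Set (Finset W)) (Z : ℤ → Finset W) : Prop :=
  ∀ i, Z i ∈ edgesOf Γ ∧ Z i ≠ Z (i + 1) ∧
    (∃ F ∈ Γ, ∃ F' ∈ Γ, F ≠ F' ∧ Z i ⊆ F ∧ Z (i + 1) ⊆ F ∧ Z (i + 1) ⊆ F' ∧ Z (i + 2) ⊆ F') ∧
    Disjoint (Z i) (Z (i + 2))

/-- The reversed sequence. -/
def reversed {W : Type*} (Z : ℤ → Finset W) : ℤ → Finset W := fun i => Z (-i)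

/-- `Z` and `Y` are the same cyclic sequence. -/
def SameCyclic {W : Type*} (Z Y : ℤ → Finset W) : Prop := ∃ k : ℤ, ∀ i, Y i = Z (i + k)

/-- There are precisely two zigzags, a zigzag and the reversed one. -/
def IsZKnotted {W : Type*} (Γ : Set (Finset W)) : Prop :=
  ∃ Z, IsZigzag Γ Z ∧ ¬ SameCyclic Z (reversed Z) ∧
    ∀ Y, IsZigzag Γ Y → SameCyclic Z Y ∨ SameCyclic (reversed Z) Y

/-- A `z`-orientation: from each zigzag and its reverse precisely one is chosen (the choice being
one of cyclic sequences, `τ` is closed under shifts). -/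
def IsZOrientation {W : Type*} (Γ : Set (Finset W)) (τ : Set (ℤ → Finset W)) : Prop :=
  (∀ Z ∈ τ, IsZigzag Γ Z) ∧ (∀ Z ∈ τ, ∀ Y, SameCyclic Z Y → Y ∈ τ) ∧
    ∀ Z, IsZigzag Γ Z → Xor (Z ∈ τ) (reversed Z ∈ τ)

/-- At the index `i` the zigzag `Z` passes through the edge `xy` from `x` to `y`. -/
def PassesAt {W : Type*} [DecidableEq W] (Z : ℤ → Finset W) (i : ℤ) (x y : W) : Prop :=
  Z i = {x, y} ∧ x ∈ Z (i - 1) ∧ y ∈ Z (i + 1)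

/-- Edges of type I: the chosen zigzags pass through the edge in different directions. -/
def IsTypeIEdge {W : Type*} [DecidableEq W] (Γ : Set (Finset W)) (τ : Set (ℤ → Finset W))
    (e : Finset W) : Prop :=
  e ∈ edgesOf Γ ∧ ∃ x y, e = {x, y} ∧
    (∃ Z ∈ τ, ∃ i, PassesAt Z i x y) ∧ (∃ Z ∈ τ, ∃ i, PassesAt Z i y x)

/-- Edges of type II: the other edges. -/
def IsTypeIIEdge {W : Type*} [DecidableEq W] (Γ : Set (Finset W)) (τ : Set (ℤ → Finset W))
    (e : Finset W) : Prop :=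
  e ∈ edgesOf Γ ∧ ¬ IsTypeIEdge Γ τ e

/-- Faces of type I: two edges are of type I and the third edge is of type II. -/
def IsTypeIFace {W : Type*} [DecidableEq W] (Γ : Set (Finset W)) (τ : Set (ℤ → Finset W))
    (F : Finset W) : Prop :=
  ∃ x y z, F = {x, y, z} ∧ IsTypeIIEdge Γ τ {x, y} ∧ IsTypeIEdge Γ τ {y, z} ∧
    IsTypeIEdge Γ τ {x, z}

/-- Homogeneous zigzags: each edge of type II is followed by precisely two edges of type I. -/
def IsHomogeneous {W : Type*} [DecidableEq W] (Γ : Set (Finset W)) (τ : Set (ℤ → Finset W))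
    (Z : ℤ → Finset W) : Prop :=
  ∃ r : ℤ, ∀ j : ℤ, IsTypeIIEdge Γ τ (Z (r + 3 * j)) ∧ IsTypeIEdge Γ τ (Z (r + 3 * j + 1)) ∧
    IsTypeIEdge Γ τ (Z (r + 3 * j + 2))

/-- `n` is the length of the cyclic sequence `Z`. -/
def IsCyclicLength {W : Type*} (Z : ℤ → Finset W) (n : ℕ) : Prop :=
  IsLeast {n : ℕ | 0 < n ∧ ∀ i, Z (i + n) = Z i} n

/-- `Z` is a cyclic sequence of type `c 0, …, c 1, …, c 2, …` (within one period). -/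
def HasCyclicPattern {W : Type*} (Z : ℤ → Finset W) {m : ℕ} (c : Fin m → Finset W) : Prop :=
  ∃ n, IsCyclicLength Z n ∧ ∃ a : Fin m → ℤ, StrictMono a ∧ (∀ s t, a t - a s < n) ∧
    ∀ s, Z (a s) = c s

/-- Special pairs: distinct edges of type II with a common vertex, such that the zigzag is a cyclic
sequence of type `c₁, …, c₂, …, c₁, …, c₂, …`. -/
def IsSpecialPair {W : Type*} [DecidableEq W] (Γ : Set (Finset W)) (τ : Set (ℤ → Finset W))
    (c : Finset W × Finset W) : Prop :=
  IsTypeIIEdge Γ τ c.1 ∧ IsTypeIIEdge Γ τ c.2 ∧ c.1 ≠ c.2 ∧ (∃ x, x ∈ c.1 ∧ x ∈ c.2) ∧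
    ∃ Z, IsZigzag Γ Z ∧ HasCyclicPattern Z ![c.1, c.2, c.1, c.2]

/-- No edge occurs in both the pairs. -/
def NoCommonEdge {W : Type*} (c t : Finset W × Finset W) : Prop :=
  c.1 ≠ t.1 ∧ c.1 ≠ t.2 ∧ c.2 ≠ t.1 ∧ c.2 ≠ t.2

/-- Concordant special pairs: the zigzag (in one of its two directions) is a cyclic sequence of type
`c₁, …, t₁, …, c₂, …, t₂, …, c₁, …, t₁, …, c₂, …, t₂, …`. -/
def AreConcordant {W : Type*} [DecidableEq W] (Γ : Set (Finset W)) (τ : Set (ℤ → Finset W))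
    (c t : Finset W × Finset W) : Prop :=
  IsSpecialPair Γ τ c ∧ IsSpecialPair Γ τ t ∧ NoCommonEdge c t ∧
    ∃ Z, IsZigzag Γ Z ∧ HasCyclicPattern Z ![c.1, t.1, c.2, t.2, c.1, t.1, c.2, t.2]

/-! ## Gluing -/

/-- A path of two edges (from `fst` through `mid` to `snd`), with a set of faces at `mid` called
the `+` side; the other faces at `mid` form the `-` side. -/
structure Slit (W : Type*) where
  mid : W
  fst : W
  snd : W
  plus : Set (Finset W)

/-- The path consists of two edges of `Γ`, and `plus` is one of the two sides of this path at `mid`: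
two distinct faces at `mid` with a common edge `{mid, x}` are on different sides if this edge belongs
to the path, and on the same side otherwise. -/
structure Slit.IsIn {W : Type*} [DecidableEq W] (s : Slit W) (Γ : Set (Finset W)) : Prop where
  fst_ne_snd : s.fst ≠ s.snd
  fst_edge : {s.mid, s.fst} ∈ edgesOf Γ
  snd_edge : {s.mid, s.snd} ∈ edgesOf Γ
  plus_subset : ∀ F ∈ s.plus, F ∈ Γ ∧ s.mid ∈ F
  sides : ∀ F ∈ Γ, ∀ F' ∈ Γ, F ≠ F' → s.mid ∈ F → s.mid ∈ F' →
    ∀ x, x ≠ s.mid → x ∈ F → x ∈ F' →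
      ((F ∈ s.plus ↔ F' ∈ s.plus) ↔ (x ≠ s.fst ∧ x ≠ s.snd))

/-- The identification of the ends of the path `s'` with the ends of the path `s`. -/
def identifyEnds {W : Type*} [DecidableEq W] (s s' : Slit W) : W → W :=
  Function.update (Function.update id s'.fst s.fst) s'.snd s.snd

/-- The gluing of `Γ` and `Γ'` along the paths `s` and `s'`; the vertex sets of `Γ` and `Γ'` are
disjoint subsets of `W`.  Each of the two triangulations is cut open along its path: every edge of
the path is doubled and the middle vertex is split into a vertex on the `+` side and a vertex on the
`-` side.  The two quadrilateral holes are then glued: ends with ends, the `+` vertices together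
and the `-` vertices together.  In the result `s.mid` serves as the `+` vertex, `s'.mid` as the
`-` vertex, and `s.fst`, `s.snd` as the common ends. -/
def glue {W : Type*} [DecidableEq W] (Γ Γ' : Set (Finset W)) (s s' : Slit W) :
    Set (Finset W) :=
  {A ∈ Γ | s.mid ∉ A ∨ A ∈ s.plus} ∪
  Finset.image (Function.update id s.mid s'.mid) '' {A ∈ Γ | s.mid ∈ A ∧ A ∉ s.plus} ∪
  Finset.image (identifyEnds s s') '' {B ∈ Γ' | s'.mid ∉ B ∨ B ∉ s'.plus} ∪
  Finset.image (Function.update (identifyEnds s s') s'.mid s.mid) ''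
    {B ∈ Γ' | s'.mid ∈ B ∧ B ∈ s'.plus}

/-! ## Bipyramids and the tree-structured construction -/

/-- Vertices of the `n`-gonal bipyramid: the base vertices (cyclically ordered) and two apexes. -/
abbrev BPVertex (n : ℕ) : Type := ZMod n ⊕ Bool

/-- The faces of the `n`-gonal bipyramid. -/
def bipyramid (n : ℕ) : Set (Finset (BPVertex n)) :=
  {F | ∃ (i : ZMod n) (a : Bool), F = {Sum.inl i, Sum.inl (i + 1), Sum.inr a}}

/-- The pair of consecutive base edges `{i - 1, i}`, `{i, i + 1}` and the pair of consecutive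
base edges `{j - 1, j}`, `{j, j + 1}` have no edge in common. -/
def BaseDisjoint {n : ℕ} (i j : ZMod n) : Prop := i ≠ j ∧ i ≠ j + 1 ∧ j ≠ i + 1

/-- The labelling rules for a tree `T` with root `r` (a leaf is a vertex of degree one which is not
the root). -/
structure IsAdmissibleLabelling {ι : Type*} [Fintype ι] (T : SimpleGraph ι) [DecidableRel T.Adj]
    (r : ι) (label : ι → ℕ) : Prop where
  root : ∃ k, 1 ≤ k ∧ T.degree r ≤ k ∧ label r = 2 * k + 1
  internal : ∀ u, u ≠ r → T.degree u ≠ 1 → ∃ k, T.degree u ≤ k ∧ label u = 2 * k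
  leaf : ∀ u, u ≠ r → T.degree u = 1 → Even (label u) ∧ 4 ≤ label u

/-- Vertices available for the construction: those of one bipyramid for each vertex of the tree. -/
abbrev TreeVertex {ι : Type*} (label : ι → ℕ) := (u : ι) × BPVertex (label u)

/-- The base vertex `i` of the bipyramid belonging to the vertex `u` of the tree. -/
def baseVertex {ι : Type*} (label : ι → ℕ) (u : ι) (i : ZMod (label u)) : TreeVertex label :=
  ⟨u, Sum.inl i⟩

/-- The bipyramid belonging to the vertex `u` of the tree. -/
def bipyramidAt {ι : Type*} [DecidableEq ι] (label : ι → ℕ) (u : ι) :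
    Set (Finset (TreeVertex label)) :=
  Finset.image (Sigma.mk u) '' bipyramid (label u)

/-- The choice of pairs: for adjacent `u`, `w` the gluing along the edge `uw` uses, in the base of
the bipyramid of `u`, the two consecutive edges with the common vertex `pair u w`.  Pairs used for
different neighbours of `u` have no common edge. -/
def IsPairChoice {ι : Type*} (T : SimpleGraph ι) (label : ι → ℕ)
    (pair : (u : ι) → ι → ZMod (label u)) : Prop :=
  ∀ u w w', T.Adj u w → T.Adj u w' → w ≠ w' → BaseDisjoint (pair u w) (pair u w')

/-- `Built T label r pair D Γ pos` says that `Γ` is obtained, starting with the bipyramid of the root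
`r`, by gluing step by step the bipyramids of the other vertices in `D`, where the bipyramid of `u`
is glued along the edge of the tree which joins `u` to an earlier vertex `p`.  In each step either
order of the two edges of a pair and either choice of the sides is allowed.
The vertex `pos u i` of `Γ` is the present position of the base vertex `i` of the bipyramid of
`u` (irrelevant if this vertex has been split or `u` is not in `D`). -/
inductive Built {ι : Type*} [DecidableEq ι] (T : SimpleGraph ι) (label : ι → ℕ) (r : ι)
    (pair : (u : ι) → ι → ZMod (label u)) :
    Set ι → Set (Finset (TreeVertex label)) → ((u : ι) → ZMod (label u) → TreeVertex label) → Prop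
  | root : Built T label r pair {r} (bipyramidAt label r) (baseVertex label)
  | step (D : Set ι) (Γ : Set (Finset (TreeVertex label)))
      (pos : (u : ι) → ZMod (label u) → TreeVertex label) (p u : ι)
      (s s' : Slit (TreeVertex label)) :
      Built T label r pair D Γ pos → p ∈ D → u ∉ D → T.Adj p u →
      s.mid = pos p (pair p u) →
      s.fst = pos p (pair p u - 1) →
      s.snd = pos p (pair p u + 1) →
      s'.mid = baseVertex label u (pair u p) →
      ((s'.fst = baseVertex label u (pair u p - 1) ∧ s'.snd = baseVertex label u (pair u p + 1)) ∨
        (s'.fst = baseVertex label u (pair u p + 1) ∧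
          s'.snd = baseVertex label u (pair u p - 1))) →
      s.IsIn Γ → s'.IsIn (bipyramidAt label u) →
      Built T label r pair (insert u D) (glue Γ (bipyramidAt label u) s s')
        (fun q i => identifyEnds s s' (pos q i))

/-- The pairs of consecutive base edges of the bipyramids of the vertices in `D` that have no edge
in common with the pairs exploited for the gluings performed so far. -/
def freePairs {ι : Type*} [DecidableEq ι] (T : SimpleGraph ι) (label : ι → ℕ)
    (pair : (u : ι) → ι → ZMod (label u)) (D : Set ι)
    (pos : (u : ι) → ZMod (label u) → TreeVertex label) :
    Set (Finset (TreeVertex label) × Finset (TreeVertex label)) :=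
  {c | ∃ u ∈ D, ∃ i : ZMod (label u),
    (∀ w ∈ D, T.Adj u w → BaseDisjoint i (pair u w)) ∧
    c = ({pos u (i - 1), pos u i}, {pos u i, pos u (i + 1)})}

/-!
In all complexes of the construction the faces can be arranged in pyramids: each face is spanned by
a *base edge* and an *apex*, and the two faces at a base edge give it the same direction.  Calling
the faces *darts*, let `S` be the rotation of the darts around their apexes and `σ` the interchange
of the two darts at a base edge (`DartComplex`).  A zigzag which passes through the base edge of `x`
in its direction goes on through `V (S x)` and the apex of `x` to the base edge of `φ x`, where
`φ = σ S²`.  So zigzags are, up to direction, the cycles of `φ`, and every third edge of a zigzag is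
a base edge.  If `φ` has only one cycle, then the complex is `z`-knotted; its zigzag passes through
base edges in one direction only and through the other edges in both, hence the base edges are
the edges of type II, all faces are of type I and the zigzag is homogeneous
(`DartComplex.isZKnotted`, `DartComplex.isTypeIFace`, `DartComplex.isHomogeneous`).

The darts of a bipyramid are the pairs of a base edge and one of two sides, and the interchange of
the sides is a symmetry of `S` and `σ`.  Gluing preserves this structure (`MirrorComplex`,
`Gluable.glued`), so that everything can be computed on the set `E` of base edges counted once for
both sides, with the permutation `next` induced by `φ`.  Since `φ` changes the side, it has one cycle
as soon as `next` has one cycle `L` of odd length, and the zigzag then runs through `L` twice.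
This makes every pair of base edges alternate in the zigzag, so unused pairs are special, and special
pairs are concordant if they are crossing chords of the cyclic list `L` (`Crosses`,
`MirrorComplex.areConcordant`).

For a bipyramid `next` is `i ↦ i + 2`.  If the base has `2k + 1` edges, this is one cycle, in which
consecutive edges of the base are about half a cycle apart; therefore pairs without common edge
cross (`crosses_evenSteps`).  If the base has `2k` edges, there are two cycles, and consecutive edges
lie in different ones.  Gluing along two pairs of edges multiplies the two permutations by two
transpositions; with an even bipyramid, this inserts its two cycles into `L`, each in front of one
edge of the pair (`IsCycleList.join`, `Gluable.exists_cycleList`).  The length of `L` remains odd,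
old chords still cross, and the unused pairs of the new bipyramid, being chords between the two
inserted cycles, cross whatever was crossed by the pair used for the gluing; they also cross each
other if they have no common edge.

No classification of surfaces is needed for the topology.  A vertex of the base which does not belong
to a used pair has a star of four faces, and gluing a bipyramid there with at least four base edges
amounts to subdividing edges repeatedly (`Gluable.nonempty_homeomorph`); the same holds for
the bipyramids, starting from the octahedron.  The subdivision of an edge does not change
the realization (`nonempty_homeomorph_subdivision`).  Finally, an induction along the tree maintains
such a description of the complex together with the positions of the unused pairs (`Presentation`).
-/

/-! ### Zigzags are determined by two consecutive edges -/

section Determinism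

variable {W : Type*} [DecidableEq W] {Γ : Set (Finset W)}

/-- Every pair of vertices is contained in at most two faces. -/
def AtMostTwoFaces (Γ : Set (Finset W)) : Prop :=
  ∀ e : Finset W, e.card = 2 → ∀ F ∈ Γ, ∀ F' ∈ Γ, ∀ F'' ∈ Γ, e ⊆ F → e ⊆ F' → e ⊆ F'' →
    F ≠ F' → F ≠ F'' → F' = F''

theorem union_eq_of_subset_of_card {e f F : Finset W} (he : e.card = 2) (hf : f.card = 2)
    (hF : F.card = 3) (hef : e ≠ f) (heF : e ⊆ F) (hfF : f ⊆ F) : e ∪ f = F := by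
  apply Finset.eq_of_subset_of_card_le (Finset.union_subset heF hfF)
  rw [hF]
  by_contra! h
  have h1 : e ∪ f = e := (Finset.eq_of_subset_of_card_le Finset.subset_union_left (by omega)).symm
  have h2 : e ∪ f = f := (Finset.eq_of_subset_of_card_le Finset.subset_union_right (by omega)).symm
  exact hef (h1.symm.trans h2)

theorem inter_nonempty_of_card {e f F : Finset W} (he : e.card = 2) (hf : f.card = 2)
    (hF : F.card = 3) (heF : e ⊆ F) (hfF : f ⊆ F) : (e ∩ f).Nonempty := by
  rw [← Finset.card_pos]
  have h1 := Finset.card_union_add_card_inter e f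
  have h2 := Finset.card_le_card (Finset.union_subset heF hfF)
  omega

/-- Two consecutive edges determine the next one: they span a face, the zigzag goes on to the other
face at the second edge, and there it leaves out the common vertex of the two edges. -/
theorem IsZigzag.next_unique (h3 : ∀ F ∈ Γ, F.card = 3) (h2 : AtMostTwoFaces Γ)
    {Z Y : ℤ → Finset W} (hZ : IsZigzag Γ Z) (hY : IsZigzag Γ Y) {i j : ℤ}
    (h0 : Z i = Y j) (h1 : Z (i + 1) = Y (j + 1)) : Z (i + 2) = Y (j + 2) := by
  obtain ⟨⟨c0, -⟩, ne, ⟨F, hF, F', hF', hFF, a1, a2, a3, a4⟩, dj⟩ := hZ i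
  obtain ⟨-, -, ⟨G, hG, G', hG', hGG, b1, b2, b3, b4⟩, dj'⟩ := hY j
  have c1 := (hZ (i + 1)).1.1
  have c2 := (hZ (i + 2)).1.1
  have d2 := (hY (j + 2)).1.1
  rw [← h0, ← h1] at *
  have hFG : F = G := by
    rw [← union_eq_of_subset_of_card c0 c1 (h3 F hF) ne a1 a2,
      ← union_eq_of_subset_of_card c0 c1 (h3 G hG) ne b1 b2]
  subst hFG
  have hFG' : F' = G' := h2 _ c1 F hF F' hF' G' hG' a2 a3 b3 hFF hGG
  subst hFG'
  obtain ⟨p, hp⟩ := inter_nonempty_of_card c0 c1 (h3 F hF) a1 a2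
  rw [Finset.mem_inter] at hp
  have hcard : (F'.erase p).card = 2 := by
    rw [Finset.card_erase_of_mem (a3 hp.2), h3 F' hF']
  have key : ∀ e : Finset W, e.card = 2 → e ⊆ F' → Disjoint (Z i) e → e = F'.erase p := by
    intro e he heF hd
    apply Finset.eq_of_subset_of_card_le
    · exact Finset.subset_erase.2 ⟨heF, Finset.disjoint_left.1 hd hp.1⟩
    · omega
  rw [key _ c2 a4 dj, key _ d2 b4 dj']

omit [DecidableEq W] in
theorem IsZigzag.reversed {Z : ℤ → Finset W} (hZ : IsZigzag Γ Z) :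
    IsZigzag Γ (reversed Z) := by
  intro i
  obtain ⟨-, -, ⟨F, hF, F', hF', hFF, a1, a2, a3, a4⟩, dj⟩ := hZ (-(i + 2))
  have ne := (hZ (-(i + 1))).2.1
  have e0 : -(i + 2) + 2 = -i := by ring
  have e1 : -(i + 2) + 1 = -(i + 1) := by ring
  have e2 : -(i + 1) + 1 = -i := by ring
  rw [e1] at a2 a3
  rw [e0] at a4 dj
  rw [e2] at ne
  exact ⟨(hZ (-i)).1, ne.symm, ⟨F', hF', F, hF, hFF.symm, a4, a3, a2, a1⟩, dj.symm⟩

omit [DecidableEq W] in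
theorem reversed_reversed (Z : ℤ → Finset W) : reversed (reversed Z) = Z := by
  funext i; simp [reversed]

theorem IsZigzag.eq_of_eq_nat (h3 : ∀ F ∈ Γ, F.card = 3) (h2 : AtMostTwoFaces Γ)
    {Z Y : ℤ → Finset W} (hZ : IsZigzag Γ Z) (hY : IsZigzag Γ Y) {i j : ℤ}
    (h0 : Z i = Y j) (h1 : Z (i + 1) = Y (j + 1)) (k : ℕ) :
    Z (i + k) = Y (j + k) ∧ Z (i + k + 1) = Y (j + k + 1) := by
  induction k with
  | zero => simpa using ⟨h0, h1⟩
  | succ k ih =>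
    refine ⟨by push_cast; simpa [add_assoc] using ih.2, ?_⟩
    have := hZ.next_unique h3 h2 hY ih.1 ih.2
    push_cast
    convert this using 2 <;> ring

/-- Two zigzags with two consecutive edges in common coincide up to a shift. -/
theorem IsZigzag.sameCyclic (h3 : ∀ F ∈ Γ, F.card = 3) (h2 : AtMostTwoFaces Γ)
    {Z Y : ℤ → Finset W} (hZ : IsZigzag Γ Z) (hY : IsZigzag Γ Y) {i j : ℤ}
    (h0 : Z i = Y j) (h1 : Z (i + 1) = Y (j + 1)) : SameCyclic Z Y := by
  refine ⟨i - j, fun n => ?_⟩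
  rcases le_total j n with h | h
  · obtain ⟨k, hk⟩ := Int.eq_ofNat_of_zero_le (sub_nonneg.2 h)
    have := (hZ.eq_of_eq_nat h3 h2 hY h0 h1 k).1
    rw [← hk] at this
    convert this.symm using 2 <;> ring
  · obtain ⟨k, hk⟩ := Int.eq_ofNat_of_zero_le (sub_nonneg.2 h)
    have := (hZ.reversed.eq_of_eq_nat h3 h2 hY.reversed (i := -(i + 1)) (j := -(j + 1))
      (by simpa [_root_.reversed] using h1) (by
        have e1 : -(-(i + 1) + 1) = i := by ring
        have e2 : -(-(j + 1) + 1) = j := by ring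
        simp only [_root_.reversed, e1, e2, h0]) k).2
    rw [← hk] at this
    simp only [_root_.reversed] at this
    convert this.symm using 2 <;> ring

end Determinism

/-! ### Complexes of darts -/

/-- A description of the complex `Γ` by darts. The faces correspond to the darts: the face of the
dart `x` consists of the base edge from `V x` to `V (S x)` and of the apex `A x`. The dart `S x` is
the next one around the same apex, and `σ x` is the dart of the other face at the base edge of `x`;
both darts give the same direction to this edge. The link of an apex is a cycle of at least three
base edges, and no vertex is both an end of a base edge and an apex. -/
structure DartComplex {W : Type*} [DecidableEq W] (Γ : Set (Finset W)) (X : Type*) where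
  S : Equiv.Perm X
  σ : Equiv.Perm X
  V : X → W
  A : X → W
  mem_faces : ∀ F, F ∈ Γ ↔ ∃ x, F = {V x, V (S x), A x}
  A_S : ∀ x, A (S x) = A x
  inj : ∀ x y, V x = V y → A x = A y → x = y
  V_ne_A : ∀ x y, V x ≠ A y
  S_ne : ∀ x, S x ≠ x
  SS_ne : ∀ x, S (S x) ≠ x
  V_σ : ∀ x, V (σ x) = V x
  V_Sσ : ∀ x, V (S (σ x)) = V (S x)
  σ_ne : ∀ x, σ x ≠ x
  edge : ∀ x y, ({V x, V (S x)} : Finset W) = {V y, V (S y)} → y = x ∨ y = σ x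

namespace DartComplex

variable {W : Type*} [DecidableEq W] {Γ : Set (Finset W)} {X : Type*} (M : DartComplex Γ X)

theorem V_S_ne (x : X) : M.V (M.S x) ≠ M.V x := fun h => M.S_ne x (M.inj _ _ h (M.A_S x))

theorem V_SS_ne (x : X) : M.V (M.S (M.S x)) ≠ M.V x := fun h =>
  M.SS_ne x (M.inj _ _ h (by rw [M.A_S, M.A_S]))

theorem A_σ_ne (x : X) : M.A (M.σ x) ≠ M.A x := fun h => M.σ_ne x (M.inj _ _ (M.V_σ x) h)

include M in
theorem card_face (F : Finset W) (hF : F ∈ Γ) : F.card = 3 := by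
  obtain ⟨x, rfl⟩ := (M.mem_faces F).1 hF
  rw [Finset.card_eq_three]
  exact ⟨_, _, _, (M.V_S_ne x).symm, M.V_ne_A _ _, M.V_ne_A _ _, rfl⟩

theorem face_mem (x : X) : ({M.V x, M.V (M.S x), M.A x} : Finset W) ∈ Γ :=
  (M.mem_faces _).2 ⟨x, rfl⟩

/-- Exactly two faces contain the base edge of `x`. -/
theorem eq_or_eq_of_base_subset {x y : X}
    (h : ({M.V x, M.V (M.S x)} : Finset W) ⊆ {M.V y, M.V (M.S y), M.A y}) : y = x ∨ y = M.σ x := by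
  apply M.edge
  have h1 := h (Finset.mem_insert_self _ _)
  have h2 := h (Finset.mem_insert_of_mem (Finset.mem_singleton_self _))
  have a1 := M.V_ne_A x y
  have a2 := M.V_ne_A (M.S x) y
  have a3 := M.V_S_ne x
  simp only [Finset.mem_insert, Finset.mem_singleton, a1, a2, or_false] at h1 h2
  rcases h1 with h1 | h1 <;> rcases h2 with h2 | h2
  · exact absurd (h2.trans h1.symm) a3
  · rw [h1, h2]
  · rw [h1, h2, Finset.pair_comm]
  · exact absurd (h2.trans h1.symm) a3

/-- Exactly two faces contain the edge from `V x` to the apex. -/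
theorem eq_or_eq_of_side_subset {x y : X}
    (h : ({M.V x, M.A x} : Finset W) ⊆ {M.V y, M.V (M.S y), M.A y}) : y = x ∨ M.S y = x := by
  have h1 := h (Finset.mem_insert_self _ _)
  have h2 := h (Finset.mem_insert_of_mem (Finset.mem_singleton_self _))
  have a1 := M.V_ne_A x y
  have a2 := (M.V_ne_A y x).symm
  have a3 := (M.V_ne_A (M.S y) x).symm
  simp only [Finset.mem_insert, Finset.mem_singleton, a1, a2, a3, or_false, false_or] at h1 h2
  rcases h1 with h1 | h1
  · exact Or.inl (M.inj _ _ h1.symm h2.symm)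
  · exact Or.inr (M.inj _ _ h1.symm (by rw [M.A_S, h2]))

/-- The edges of the face of `x`. -/
theorem eq_of_subset_face {x : X} {e : Finset W} (he : e.card = 2)
    (h : e ⊆ {M.V x, M.V (M.S x), M.A x}) :
    e = {M.V x, M.V (M.S x)} ∨ e = {M.V (M.S x), M.A x} ∨ e = {M.V x, M.A x} := by
  obtain ⟨p, q, hpq, rfl⟩ := Finset.card_eq_two.1 he
  have h1 := h (Finset.mem_insert_self _ _)
  have h2 := h (Finset.mem_insert_of_mem (Finset.mem_singleton_self _))
  simp only [Finset.mem_insert, Finset.mem_singleton] at h1 h2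
  rcases h1 with h1 | h1 | h1 <;> rcases h2 with h2 | h2 | h2 <;> subst h1 h2 <;>
    first
    | exact absurd rfl hpq
    | simp
    | simp [Finset.pair_comm]

include M in
theorem atMostTwoFaces : AtMostTwoFaces Γ := by
  intro e he F hF F' hF' F'' hF'' h h' h'' n n'
  obtain ⟨x, rfl⟩ := (M.mem_faces F).1 hF
  obtain ⟨y, rfl⟩ := (M.mem_faces F').1 hF'
  obtain ⟨z, rfl⟩ := (M.mem_faces F'').1 hF''
  have hxy : y ≠ x := by rintro rfl; exact n rfl
  have hxz : z ≠ x := by rintro rfl; exact n' rfl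
  have : y = z := by
    rcases M.eq_of_subset_face he h with rfl | rfl | rfl
    · rw [(M.eq_or_eq_of_base_subset h').resolve_left hxy,
        (M.eq_or_eq_of_base_subset h'').resolve_left hxz]
    · rw [← M.A_S x] at h' h''
      have a := (M.eq_or_eq_of_side_subset h').resolve_right (fun h => hxy (M.S.injective h))
      have b := (M.eq_or_eq_of_side_subset h'').resolve_right (fun h => hxz (M.S.injective h))
      rw [a, b]
    · have a := (M.eq_or_eq_of_side_subset h').resolve_left hxy
      have b := (M.eq_or_eq_of_side_subset h'').resolve_left hxz
      exact M.S.injective (a.trans b.symm)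
  rw [this]

/-- The dart at which a zigzag passes its next base edge, after that of `x`: the zigzag uses two
edges at the apex of `x`, meets the base edge of `S (S x)` and crosses it. -/
def φ : Equiv.Perm X := M.σ * M.S * M.S

theorem φ_apply (x : X) : M.φ x = M.σ (M.S (M.S x)) := rfl

/-- The zigzag which passes through the base edge of `x` in its direction and then enters the face
of `x`; the indices divisible by three are those of the base edges. -/
def zig (x : X) (n : ℤ) : Finset W :=
  if n % 3 = 0 then {M.V ((M.φ ^ (n / 3)) x), M.V (M.S ((M.φ ^ (n / 3)) x))}
  else if n % 3 = 1 then {M.V (M.S ((M.φ ^ (n / 3)) x)), M.A ((M.φ ^ (n / 3)) x)}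
  else {M.A ((M.φ ^ (n / 3)) x), M.V (M.S (M.S ((M.φ ^ (n / 3)) x)))}

theorem zig_add (x : X) (n k : ℤ) : M.zig x (n + 3 * k) = M.zig ((M.φ ^ k) x) n := by
  have h1 : (n + 3 * k) % 3 = n % 3 := by omega
  have h2 : (n + 3 * k) / 3 = n / 3 + k := by omega
  simp only [zig, h1, h2, zpow_add, Equiv.Perm.mul_apply]

theorem zig_zero (x : X) : M.zig x 0 = {M.V x, M.V (M.S x)} := by simp [zig]
theorem zig_one (x : X) : M.zig x 1 = {M.V (M.S x), M.A x} := by simp [zig]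
theorem zig_two (x : X) : M.zig x 2 = {M.A x, M.V (M.S (M.S x))} := by simp [zig]
theorem zig_three (x : X) :
    M.zig x 3 = {M.V (M.S (M.S x)), M.V (M.S (M.S (M.S x)))} := by
  rw [show (3 : ℤ) = 0 + 3 * 1 by norm_num, zig_add, zig_zero, zpow_one, φ_apply, M.V_σ, M.V_Sσ]
theorem zig_four (x : X) :
    M.zig x 4 = {M.V (M.S (M.S (M.S x))), M.A (M.φ x)} := by
  rw [show (4 : ℤ) = 1 + 3 * 1 by norm_num, zig_add, zig_one, zpow_one, φ_apply, M.V_Sσ]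

theorem exists_residue (i : ℤ) : ∃ j, i = 0 + 3 * j ∨ i = 1 + 3 * j ∨ i = 2 + 3 * j :=
  ⟨i / 3, by omega⟩

theorem pair_mem_edges {p q : W} {F : Finset W} (h : p ≠ q) (hF : F ∈ Γ) (hp : p ∈ F)
    (hq : q ∈ F) : ({p, q} : Finset W) ∈ edgesOf Γ :=
  ⟨Finset.card_pair h, F, hF, by simp [Finset.insert_subset_iff, hp, hq]⟩

theorem face_ne_face_S (x : X) : ({M.V x, M.V (M.S x), M.A x} : Finset W) ≠
    {M.V (M.S x), M.V (M.S (M.S x)), M.A x} := by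
  intro h
  have : M.V x ∈ ({M.V (M.S x), M.V (M.S (M.S x)), M.A x} : Finset W) := by rw [← h]; simp
  simp [(M.V_S_ne x).symm, (M.V_SS_ne x).symm, M.V_ne_A] at this

theorem face_ne_face_σ (x : X) : ({M.V x, M.V (M.S x), M.A x} : Finset W) ≠
    {M.V x, M.V (M.S x), M.A (M.σ x)} := by
  intro h
  have : M.A x ∈ ({M.V x, M.V (M.S x), M.A (M.σ x)} : Finset W) := by rw [← h]; simp
  simp [(M.V_ne_A _ _).symm, (M.A_σ_ne x).symm] at this

theorem isZigzag_zig (x : X) : IsZigzag Γ (M.zig x) := by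
  intro i
  obtain ⟨j, hi⟩ := exists_residue i
  have f1 : ∀ x, ({M.V (M.S x), M.V (M.S (M.S x)), M.A x} : Finset W) ∈ Γ := fun x => by
    have := M.face_mem (M.S x); rwa [M.A_S] at this
  have f2 : ∀ x, ({M.V (M.S x), M.V (M.S (M.S x)), M.A (M.σ (M.S x))} : Finset W) ∈ Γ :=
    fun x => by
    have := M.face_mem (M.σ (M.S x)); rwa [M.V_σ, M.V_Sσ] at this
  have n1 := M.V_S_ne
  have n2 := M.V_SS_ne
  have n3 := M.V_ne_A
  have n4 := M.A_σ_ne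
  have n5 : ∀ x, M.A (M.σ (M.S x)) ≠ M.A x := fun x => by
    have := M.A_σ_ne (M.S x); rwa [M.A_S] at this
  rcases hi with rfl | rfl | rfl
  · rw [show 0 + 3 * j + 1 = 1 + 3 * j by ring, show 0 + 3 * j + 2 = 2 + 3 * j by ring]
    simp only [zig_add]
    generalize (M.φ ^ j) x = y
    rw [zig_zero, zig_one, zig_two]
    refine ⟨pair_mem_edges (n1 y).symm (M.face_mem y) (by simp) (by simp), ?_,
      ⟨_, M.face_mem y, _, f1 y, M.face_ne_face_S y, ?_, ?_, ?_, ?_⟩, ?_⟩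
    · intro h
      have : M.V y ∈ ({M.V (M.S y), M.A y} : Finset W) := by rw [← h]; simp
      simp [(n1 y).symm, n3] at this
    all_goals simp [Finset.insert_subset_iff, n1, n2, n3, (n3 _ _).symm, (n1 _).symm]
  · rw [show 1 + 3 * j + 1 = 2 + 3 * j by ring, show 1 + 3 * j + 2 = 3 + 3 * j by ring]
    simp only [zig_add]
    generalize (M.φ ^ j) x = y
    rw [zig_one, zig_two, zig_three]
    have hg := M.face_ne_face_S (M.S y)
    rw [M.A_S] at hg
    have hh := f1 (M.S y)
    rw [M.A_S] at hh
    refine ⟨pair_mem_edges (n3 _ _) (M.face_mem y) (by simp) (by simp), ?_,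
      ⟨_, f1 y, _, hh, hg, ?_, ?_, ?_, ?_⟩, ?_⟩
    · intro h
      have : M.V (M.S y) ∈ ({M.A y, M.V (M.S (M.S y))} : Finset W) := by rw [← h]; simp
      simp [(n1 _).symm, n3] at this
    all_goals simp [Finset.insert_subset_iff, n1, n2, n3, (n3 _ _).symm, (n1 _).symm]
  · rw [show 2 + 3 * j + 1 = 3 + 3 * j by ring, show 2 + 3 * j + 2 = 4 + 3 * j by ring]
    simp only [zig_add]
    generalize (M.φ ^ j) x = y
    rw [zig_two, zig_three, zig_four, φ_apply]
    have hg := M.face_ne_face_σ (M.S (M.S y))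
    rw [M.A_S, M.A_S] at hg
    have hh := f1 (M.S y)
    rw [M.A_S] at hh
    refine ⟨pair_mem_edges (n3 _ _).symm (f1 y) (by simp) (by simp), ?_,
      ⟨_, hh, _, f2 (M.S y), hg, ?_, ?_, ?_, ?_⟩, ?_⟩
    · intro h
      have : M.A y ∈ ({M.V (M.S (M.S y)), M.V (M.S (M.S (M.S y)))} : Finset W) := by
        rw [← h]; simp
      simp [(n3 _ _).symm] at this
    all_goals simp [Finset.insert_subset_iff, n1, n3, (n3 _ _).symm, (n1 _).symm]
    have := n5 (M.S y)
    rw [M.A_S] at this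
    exact this

/-- Every zigzag is, up to a shift and up to reversing, a zigzag of a dart. -/
theorem exists_zig {Y : ℤ → Finset W} (hY : IsZigzag Γ Y) :
    ∃ x, SameCyclic (M.zig x) Y ∨ SameCyclic (reversed (M.zig x)) Y := by
  obtain ⟨⟨c0, -⟩, ne, ⟨F, hF, -, -, -, h0, h1, -, -⟩, -⟩ := hY 0
  have c1 := (hY (0 + 1)).1.1
  obtain ⟨y, rfl⟩ := (M.mem_faces F).1 hF
  have fw : ∀ x i, M.zig x i = Y 0 → M.zig x (i + 1) = Y (0 + 1) → SameCyclic (M.zig x) Y :=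
    fun x i a b => (M.isZigzag_zig x).sameCyclic M.card_face M.atMostTwoFaces hY a b
  have bw : ∀ x i, M.zig x (-i) = Y 0 → M.zig x (-(i + 1)) = Y (0 + 1) →
      SameCyclic (reversed (M.zig x)) Y :=
    fun x i a b => (M.isZigzag_zig x).reversed.sameCyclic M.card_face M.atMostTwoFaces hY a b
  have hs : ∀ y, M.A (M.S.symm y) = M.A y := fun y => by
    rw [← M.A_S (M.S.symm y), Equiv.apply_symm_apply]
  rcases M.eq_of_subset_face c0 h0 with e0 | e0 | e0 <;>
    rcases M.eq_of_subset_face c1 h1 with e1 | e1 | e1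
  · exact absurd (e0.trans e1.symm) ne
  · exact ⟨y, Or.inl (fw y 0 (by rw [e0, zig_zero]) (by rw [e1, zero_add, zig_one]))⟩
  · refine ⟨M.S.symm (M.S.symm y), Or.inr (bw _ (-3) ?_ ?_)⟩
    · rw [e0, neg_neg, zig_three]; simp
    · rw [e1, show (-(-3 + 1) : ℤ) = 2 by norm_num, zig_two, Finset.pair_comm]; simp [hs]
  · refine ⟨y, Or.inr (bw _ (-1) ?_ ?_)⟩
    · rw [e0, neg_neg, zig_one]
    · rw [e1, show (-(-1 + 1) : ℤ) = 0 by norm_num, zig_zero]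
  · exact absurd (e0.trans e1.symm) ne
  · refine ⟨M.S.symm y, Or.inr (bw _ (-2) ?_ ?_)⟩
    · rw [e0, neg_neg, zig_two, Finset.pair_comm]; simp [hs]
    · rw [e1, show (-(-2 + 1) : ℤ) = 1 by norm_num, zig_one]; simp [hs]
  · refine ⟨M.S.symm (M.S.symm y), Or.inl (fw _ 2 ?_ ?_)⟩
    · rw [e0, zig_two, Finset.pair_comm]; simp [hs]
    · rw [e1, show (2 + 1 : ℤ) = 3 by norm_num, zig_three]; simp
  · refine ⟨M.S.symm y, Or.inl (fw _ 1 ?_ ?_)⟩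
    · rw [e0, zig_one]; simp [hs]
    · rw [e1, show (1 + 1 : ℤ) = 2 by norm_num, zig_two, Finset.pair_comm]; simp [hs]
  · exact absurd (e0.trans e1.symm) ne

end DartComplex

/-! ### Complexes with one cycle of darts -/

namespace DartComplex

variable {W : Type*} [DecidableEq W] {Γ : Set (Finset W)} {X : Type*} (M : DartComplex Γ X)

theorem mod_three_of_zig_eq_base {x y : X} {n : ℤ} (h : M.zig x n = {M.V y, M.V (M.S y)}) :
    ∃ j, n = 3 * j := by
  obtain ⟨j, rfl | rfl | rfl⟩ := exists_residue n
  · exact ⟨j, by ring⟩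
  all_goals
    exfalso
    rw [zig_add] at h
    generalize (M.φ ^ j) x = z at h
    first | rw [zig_one] at h | rw [zig_two] at h
    have : M.A z ∈ ({M.V y, M.V (M.S y)} : Finset W) := by rw [← h]; simp
    simp [(M.V_ne_A _ _).symm] at this

theorem V_eq_of_base_eq {x y : X}
    (h : ({M.V x, M.V (M.S x)} : Finset W) = {M.V y, M.V (M.S y)}) :
    M.V x = M.V y ∧ M.V (M.S x) = M.V (M.S y) := by
  rcases M.edge _ _ h with rfl | rfl <;> simp [M.V_σ, M.V_Sσ]

theorem eq_of_zig_eq {x y : X} (h0 : M.zig x 0 = M.zig y 0) (h1 : M.zig x 1 = M.zig y 1) :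
    x = y := by
  rw [zig_zero, zig_zero] at h0
  have h2 := M.V_eq_of_base_eq h0
  have : M.A x ∈ M.zig y 1 := by rw [← h1, zig_one]; simp
  rw [zig_one] at this
  simp only [Finset.mem_insert, (M.V_ne_A _ _).symm, false_or, Finset.mem_singleton] at this
  exact M.inj _ _ h2.1 this

/-- All passages of a zigzag of a dart through a base edge have the same direction, those of the
reversed sequence have the opposite one. -/
theorem not_sameCyclic_reversed (x : X) : ¬ SameCyclic (M.zig x) (reversed (M.zig x)) := by
  rintro ⟨k, hk⟩
  simp only [reversed] at hk
  have h0 := hk 0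
  rw [neg_zero, zero_add, zig_zero] at h0
  obtain ⟨j, rfl⟩ := M.mod_three_of_zig_eq_base h0.symm
  have h1 := hk (-1)
  rw [neg_neg, zig_one, zig_add] at h1
  rw [← zero_add (3 * j), zig_add, zig_zero] at h0
  generalize (M.φ ^ j) x = y at h0 h1
  have h2 := M.V_eq_of_base_eq h0
  have h3 := (M.isZigzag_zig y (-1)).2.2.2
  rw [← h1, show (-1 + 2 : ℤ) = 1 by norm_num, zig_one, h2.2] at h3
  simp at h3

theorem sameCyclic_zig_pow (x : X) (k : ℤ) : SameCyclic (M.zig x) (M.zig ((M.φ ^ k) x)) :=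
  ⟨3 * k, fun i => (M.zig_add x i k).symm⟩

end DartComplex

section SameCyclic

variable {W : Type*}

theorem SameCyclic.symm {Z Y : ℤ → Finset W} (h : SameCyclic Z Y) : SameCyclic Y Z := by
  obtain ⟨k, hk⟩ := h
  exact ⟨-k, fun i => by rw [hk]; congr 1; ring⟩

theorem SameCyclic.trans {Z Y U : ℤ → Finset W} (h : SameCyclic Z Y) (h' : SameCyclic Y U) :
    SameCyclic Z U := by
  obtain ⟨k, hk⟩ := h
  obtain ⟨l, hl⟩ := h'
  exact ⟨l + k, fun i => by rw [hl, hk]; congr 1; ring⟩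

theorem SameCyclic.reversed {Z Y : ℤ → Finset W} (h : SameCyclic Z Y) :
    SameCyclic (reversed Z) (reversed Y) := by
  obtain ⟨k, hk⟩ := h
  exact ⟨-k, fun i => by simp only [_root_.reversed]; rw [hk]; congr 1; ring⟩

theorem SameCyclic.exists_passesAt_iff [DecidableEq W] {Z Y : ℤ → Finset W} (h : SameCyclic Z Y)
    (p q : W) : (∃ i, PassesAt Y i p q) ↔ ∃ i, PassesAt Z i p q := by
  obtain ⟨k, hk⟩ := h
  constructor
  · rintro ⟨i, h1, h2, h3⟩
    rw [hk] at h1 h2 h3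
    exact ⟨i + k, h1, by convert h2 using 2; ring, by convert h3 using 2; ring⟩
  · rintro ⟨i, h1, h2, h3⟩
    refine ⟨i - k, ?_, ?_, ?_⟩
    · rw [hk, ← h1]; congr 1; ring
    · rw [hk]; convert h2 using 2; ring
    · rw [hk]; convert h3 using 2; ring

theorem exists_passesAt_reversed_iff [DecidableEq W] {Z : ℤ → Finset W} (p q : W) :
    (∃ i, PassesAt (reversed Z) i p q) ↔ ∃ i, PassesAt Z i q p := by
  have key : ∀ (Z : ℤ → Finset W) (p q : W), (∃ i, PassesAt (reversed Z) i p q) →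
      ∃ i, PassesAt Z i q p := by
    rintro Z p q ⟨i, h1, h2, h3⟩
    refine ⟨-i, ?_, ?_, ?_⟩
    · rw [Finset.pair_comm, ← h1, reversed]
    · rw [reversed] at h3; convert h3 using 2; ring
    · rw [reversed] at h2; convert h2 using 2; ring
  refine ⟨key Z p q, fun h => ?_⟩
  apply key
  rwa [reversed_reversed]

end SameCyclic

namespace DartComplex

variable {W : Type*} [DecidableEq W] {Γ : Set (Finset W)} {X : Type*} (M : DartComplex Γ X)

/-- If all darts form one cycle of `φ`, then all zigzags are shifts of one zigzag or its reverse. -/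
theorem isZKnotted (x : X) (htr : ∀ y, ∃ k : ℤ, (M.φ ^ k) x = y) : IsZKnotted Γ := by
  refine ⟨M.zig x, M.isZigzag_zig x, M.not_sameCyclic_reversed x, fun Y hY => ?_⟩
  obtain ⟨y, hy⟩ := M.exists_zig hY
  obtain ⟨k, rfl⟩ := htr y
  exact hy.imp (fun h => (M.sameCyclic_zig_pow x k).trans h)
    (fun h => (M.sameCyclic_zig_pow x k).reversed.trans h)

/-- If `φ` is transitive, there are only two `z`-orientations. -/
theorem mem_orientation (x : X) (htr : ∀ y, ∃ k : ℤ, (M.φ ^ k) x = y) {τ : Set (ℤ → Finset W)}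
    (hτ : IsZOrientation Γ τ) : (∀ Z, Z ∈ τ ↔ SameCyclic (M.zig x) Z) ∨
      (∀ Z, Z ∈ τ ↔ SameCyclic (reversed (M.zig x)) Z) := by
  obtain ⟨h1, h2, h3⟩ := hτ
  have alt : ∀ Z ∈ τ, SameCyclic (M.zig x) Z ∨ SameCyclic (reversed (M.zig x)) Z := by
    intro Z hZ
    obtain ⟨y, hy⟩ := M.exists_zig (h1 Z hZ)
    obtain ⟨k, rfl⟩ := htr y
    exact hy.imp (fun h => (M.sameCyclic_zig_pow x k).trans h)
      (fun h => (M.sameCyclic_zig_pow x k).reversed.trans h)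
  rcases h3 _ (M.isZigzag_zig x) with ⟨ha, hb⟩ | ⟨ha, hb⟩
  · exact Or.inl fun Z => ⟨fun hZ => (alt Z hZ).resolve_right fun h => hb (h2 _ hZ _ h.symm),
      fun h => h2 _ ha _ h⟩
  · exact Or.inr fun Z => ⟨fun hZ => (alt Z hZ).resolve_left fun h => hb (h2 _ hZ _ h.symm),
      fun h => h2 _ ha _ h⟩

/-- Whether an edge is of type I does not depend on the choice of one of the two directions. -/
theorem isTypeIEdge_iff (x : X) (htr : ∀ y, ∃ k : ℤ, (M.φ ^ k) x = y) {τ : Set (ℤ → Finset W)}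
    (hτ : IsZOrientation Γ τ) (e : Finset W) : IsTypeIEdge Γ τ e ↔ e ∈ edgesOf Γ ∧
      ∃ p q, e = {p, q} ∧ (∃ i, PassesAt (M.zig x) i p q) ∧ ∃ i, PassesAt (M.zig x) i q p := by
  have pass : ∀ Y : ℤ → Finset W, (∀ Z, Z ∈ τ ↔ SameCyclic Y Z) → ∀ p q,
      (∃ Z ∈ τ, ∃ i, PassesAt Z i p q) ↔ ∃ i, PassesAt Y i p q := by
    intro Y hY p q
    constructor
    · rintro ⟨Z, hZ, h⟩
      exact (((hY Z).1 hZ).exists_passesAt_iff p q).1 h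
    · exact fun h => ⟨Y, (hY Y).2 ⟨0, by simp⟩, h⟩
  rcases M.mem_orientation x htr hτ with h | h
  · simp only [IsTypeIEdge, pass _ h]
  · simp only [IsTypeIEdge, pass _ h, exists_passesAt_reversed_iff]
    refine and_congr_right fun _ => ⟨?_, ?_⟩ <;>
    · rintro ⟨p, q, h1, h2, h3⟩
      exact ⟨p, q, h1, h3, h2⟩

/-- The zigzag of a dart passes through the base edge of `y` only from `V y` to `V (S y)`. -/
theorem eq_of_passesAt_base {x y : X} {p q : W} {i : ℤ}
    (hpq : ({p, q} : Finset W) = {M.V y, M.V (M.S y)}) (h : PassesAt (M.zig x) i p q) :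
    q = M.V (M.S y) := by
  obtain ⟨h1, -, h3⟩ := h
  rw [hpq] at h1
  obtain ⟨j, rfl⟩ := M.mod_three_of_zig_eq_base h1
  rw [add_comm (3 * j) 1, zig_add] at h3
  rw [← zero_add (3 * j), zig_add] at h1
  generalize (M.φ ^ j) x = z at h1 h3
  rw [zig_zero] at h1
  rw [(M.V_eq_of_base_eq h1).2.symm]
  have hq : q ∈ ({M.V y, M.V (M.S y)} : Finset W) := by rw [← hpq]; simp
  simp only [zig_one, Finset.mem_insert, Finset.mem_singleton] at h3 hq
  refine h3.resolve_right fun h => ?_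
  rcases hq with hq | hq <;> exact M.V_ne_A _ _ (hq.symm.trans h)

/-- Base edges are of type II, as they are passed through in one direction only. -/
theorem isTypeIIEdge_base (x : X) (htr : ∀ y, ∃ k : ℤ, (M.φ ^ k) x = y)
    {τ : Set (ℤ → Finset W)} (hτ : IsZOrientation Γ τ) (y : X) :
    IsTypeIIEdge Γ τ {M.V y, M.V (M.S y)} := by
  refine ⟨pair_mem_edges (M.V_S_ne y).symm (M.face_mem y) (by simp) (by simp), ?_⟩
  rw [M.isTypeIEdge_iff x htr hτ]
  rintro ⟨⟨hc, -⟩, p, q, hpq, ⟨i, hi⟩, ⟨j, hj⟩⟩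
  have h1 := M.eq_of_passesAt_base hpq.symm hi
  have h2 := M.eq_of_passesAt_base (by rw [Finset.pair_comm, ← hpq]) hj
  rw [hpq, h1, h2] at hc
  simp at hc

/-- The edges at the apexes are of type I: the zigzag comes down to `V y` on the side of the dart
`S⁻¹ (S⁻¹ y)` and goes up from `V y` on the side of the dart `S⁻¹ y`. -/
theorem isTypeIEdge_side (x : X) (htr : ∀ y, ∃ k : ℤ, (M.φ ^ k) x = y)
    {τ : Set (ℤ → Finset W)} (hτ : IsZOrientation Γ τ) (y : X) :
    IsTypeIEdge Γ τ {M.V y, M.A y} := by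
  rw [M.isTypeIEdge_iff x htr hτ]
  have hs : ∀ y, M.A (M.S.symm y) = M.A y := fun y => by
    rw [← M.A_S (M.S.symm y), Equiv.apply_symm_apply]
  refine ⟨pair_mem_edges (M.V_ne_A _ _) (M.face_mem y) (by simp) (by simp), _, _, rfl, ?_, ?_⟩
  · obtain ⟨k, hk⟩ := htr (M.S.symm y)
    refine ⟨1 + 3 * k, ?_, ?_, ?_⟩
    · rw [zig_add, hk, zig_one, hs, Equiv.apply_symm_apply]
    · rw [show 1 + 3 * k - 1 = 0 + 3 * k by ring, zig_add, hk, zig_zero, Equiv.apply_symm_apply]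
      simp
    · rw [show 1 + 3 * k + 1 = 2 + 3 * k by ring, zig_add, hk, zig_two, hs]
      simp
  · obtain ⟨k, hk⟩ := htr (M.S.symm (M.S.symm y))
    refine ⟨2 + 3 * k, ?_, ?_, ?_⟩
    · rw [zig_add, hk, zig_two, hs, hs, Equiv.apply_symm_apply, Equiv.apply_symm_apply]
    · rw [show 2 + 3 * k - 1 = 1 + 3 * k by ring, zig_add, hk, zig_one, hs, hs]
      simp
    · rw [show 2 + 3 * k + 1 = 3 + 3 * k by ring, zig_add, hk, zig_three, Equiv.apply_symm_apply,
        Equiv.apply_symm_apply]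
      simp

theorem isTypeIFace (x : X) (htr : ∀ y, ∃ k : ℤ, (M.φ ^ k) x = y)
    {τ : Set (ℤ → Finset W)} (hτ : IsZOrientation Γ τ) (F : Finset W) (hF : F ∈ Γ) :
    IsTypeIFace Γ τ F := by
  obtain ⟨y, rfl⟩ := (M.mem_faces F).1 hF
  refine ⟨_, _, _, rfl, M.isTypeIIEdge_base x htr hτ y, ?_, M.isTypeIEdge_side x htr hτ y⟩
  rw [← M.A_S y]
  exact M.isTypeIEdge_side x htr hτ (M.S y)

theorem isHomogeneous (x : X) (htr : ∀ y, ∃ k : ℤ, (M.φ ^ k) x = y)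
    {τ : Set (ℤ → Finset W)} (hτ : IsZOrientation Γ τ) (Z : ℤ → Finset W) (hZ : Z ∈ τ) :
    IsHomogeneous Γ τ Z := by
  have t0 : ∀ j, IsTypeIIEdge Γ τ (M.zig x (0 + 3 * j)) := fun j => by
    rw [zig_add, zig_zero]; exact M.isTypeIIEdge_base x htr hτ _
  have t1 : ∀ j, IsTypeIEdge Γ τ (M.zig x (1 + 3 * j)) := fun j => by
    rw [zig_add, zig_one, ← M.A_S]; exact M.isTypeIEdge_side x htr hτ _
  have t2 : ∀ j, IsTypeIEdge Γ τ (M.zig x (2 + 3 * j)) := fun j => by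
    rw [zig_add, zig_two, Finset.pair_comm, ← M.A_S, ← M.A_S]
    exact M.isTypeIEdge_side x htr hτ _
  rcases M.mem_orientation x htr hτ with h | h
  · obtain ⟨k, hk⟩ := (h Z).1 hZ
    refine ⟨-k, fun j => ⟨?_, ?_, ?_⟩⟩ <;> rw [hk]
    · convert t0 j using 2; ring
    · convert t1 j using 2; ring
    · convert t2 j using 2; ring
  · obtain ⟨k, hk⟩ := (h Z).1 hZ
    refine ⟨-k, fun j => ⟨?_, ?_, ?_⟩⟩ <;> rw [hk, reversed]
    · convert t0 (-j) using 2; ring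
    · convert t2 (-j - 1) using 2; ring
    · convert t1 (-j - 1) using 2; ring

/-- The period of the zigzag is three times the length of the cycle of darts. -/
theorem isCyclicLength_zig {x : X} {n : ℕ} (h0 : 0 < n) (hn : (M.φ ^ n) x = x)
    (hmin : ∀ k : ℕ, 0 < k → (M.φ ^ k) x = x → n ≤ k) :
    IsCyclicLength (M.zig x) (3 * n) := by
  constructor
  · refine ⟨by omega, fun i => ?_⟩
    push_cast
    rw [zig_add, zpow_natCast, hn]
  · rintro m ⟨hm, hper⟩
    have h1 := hper 0
    rw [zero_add, zig_zero] at h1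
    obtain ⟨j, hj⟩ := M.mod_three_of_zig_eq_base h1
    obtain ⟨k, rfl⟩ := Int.eq_ofNat_of_zero_le (show 0 ≤ j by omega)
    have : (M.φ ^ k) x = x := by
      apply M.eq_of_zig_eq
      · rw [← hper 0, hj, zig_add, zpow_natCast]
      · rw [← hper 1, hj, zig_add, zpow_natCast]
    have := hmin k (by omega) this
    omega

end DartComplex

theorem IsCyclicLength.reversed {W : Type*} {Z : ℤ → Finset W} {n : ℕ}
    (h : IsCyclicLength Z n) : IsCyclicLength (reversed Z) n := by
  have key : ∀ (Z : ℤ → Finset W) (m : ℕ), (∀ i, Z (i + m) = Z i) →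
      ∀ i, _root_.reversed Z (i + m) = _root_.reversed Z i := by
    intro Z m h i
    simp only [_root_.reversed]
    rw [← h (-(i + m))]
    congr 1; ring
  refine ⟨⟨h.1.1, key Z n h.1.2⟩, fun m hm => h.2 ⟨hm.1, ?_⟩⟩
  have := key _ m hm.2
  rwa [reversed_reversed] at this

/-! ### Cyclic lists and crossing chords -/

section CyclicLists

variable {E : Type*}

/-- The list `L` runs through all elements of `E`, once each, in the cyclic order given by `f`. -/
structure IsCycleList (f : E → E) (L : List E) : Prop where
  nodup : L.Nodup
  mem : ∀ e, e ∈ L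
  map_eq : L.map f = L.rotate 1

/-- The chords `c₁ c₂` and `t₁ t₂` of the cyclic list `L` cross each other: after a rotation, the
list runs through the ends of the two chords alternately. -/
def Crosses (L : List E) (c₁ c₂ t₁ t₂ : E) : Prop :=
  ∃ L', L' ~r L ∧ ([c₁, t₁, c₂, t₂].Sublist L' ∨ [c₁, t₂, c₂, t₁].Sublist L')

theorem IsCycleList.isRotated {f : E → E} {L L' : List E} (h : IsCycleList f L) (hL : L' ~r L) :
    IsCycleList f L' := by
  obtain ⟨k, rfl⟩ := hL.symm
  refine ⟨List.nodup_rotate.2 h.nodup, fun e => List.mem_rotate.2 (h.mem e), ?_⟩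
  rw [List.map_rotate, h.map_eq, List.rotate_rotate, List.rotate_rotate, add_comm]

theorem IsCycleList.apply_getElem {f : E → E} {L : List E} (h : IsCycleList f L) (i : ℕ)
    (hi : i < L.length) :
    f L[i] = L[(i + 1) % L.length]'(Nat.mod_lt _ (by omega)) := by
  have h1 : (L.map f)[i]'(by simpa using hi) = (L.rotate 1)[i]'(by simpa using hi) := by
    simp only [h.map_eq]
  simpa [List.getElem_rotate] using h1

theorem IsCycleList.pow_apply {f : Equiv.Perm E} {L : List E} (h : IsCycleList f L)
    (h0 : 0 < L.length) (k : ℕ) : (f ^ k) L[0] = L[k % L.length]'(Nat.mod_lt _ h0) := by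
  induction k with
  | zero => simp
  | succ k ih =>
    rw [pow_succ', Equiv.Perm.mul_apply, ih, h.apply_getElem]
    simp [Nat.add_mod]

/-- A rotation of a sublist extends to a rotation of the whole list. -/
theorem exists_isRotated_sublist {L₁ L₁' L₂ : List E} (h : L₁.Sublist L₂) (h' : L₁' ~r L₁) :
    ∃ L₂', L₂' ~r L₂ ∧ L₁'.Sublist L₂' := by
  obtain ⟨k, hk⟩ := h'.symm
  rw [← hk, ← List.rotate_mod, List.rotate_eq_drop_append_take_mod]
  generalize k % L₁.length % L₁.length = m
  rw [← List.take_append_drop m L₁] at h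
  obtain ⟨A, B, rfl, hA, hB⟩ := List.append_sublist_iff.1 h
  exact ⟨B ++ A, List.isRotated_append, hB.append hA⟩

theorem Crosses.of_sublist_isRotated {L l : List E} {c₁ c₂ t₁ t₂ : E} (h : l.Sublist L)
    (hl : l ~r [c₁, t₁, c₂, t₂]) : Crosses L c₁ c₂ t₁ t₂ := by
  obtain ⟨L', h1, h2⟩ := exists_isRotated_sublist h hl.symm
  exact ⟨L', h1, Or.inl h2⟩

theorem Crosses.swap_right {L : List E} {c₁ c₂ t₁ t₂ : E} (h : Crosses L c₁ c₂ t₁ t₂) :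
    Crosses L c₁ c₂ t₂ t₁ := by
  obtain ⟨L', h1, h2⟩ := h
  exact ⟨L', h1, h2.symm⟩

theorem Crosses.isRotated {L L' : List E} {c₁ c₂ t₁ t₂ : E} (h : Crosses L' c₁ c₂ t₁ t₂)
    (hL : L' ~r L) : Crosses L c₁ c₂ t₁ t₂ := by
  obtain ⟨L'', h1, h2⟩ := h
  exact ⟨L'', h1.trans hL, h2⟩

theorem Crosses.symm {L : List E} {c₁ c₂ t₁ t₂ : E} (h : Crosses L c₁ c₂ t₁ t₂) :
    Crosses L t₁ t₂ c₁ c₂ := by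
  obtain ⟨L', h1, h2 | h2⟩ := h
  · exact (Crosses.of_sublist_isRotated h2 ⟨1, rfl⟩).swap_right.isRotated h1
  · exact (Crosses.of_sublist_isRotated h2 ⟨3, rfl⟩).isRotated h1

theorem Crosses.swap_left {L : List E} {c₁ c₂ t₁ t₂ : E} (h : Crosses L c₁ c₂ t₁ t₂) :
    Crosses L c₂ c₁ t₁ t₂ :=
  h.symm.swap_right.symm

theorem Crosses.map_sublist {E' : Type*} {L : List E} {L' : List E'} {c₁ c₂ t₁ t₂ : E}
    (h : Crosses L c₁ c₂ t₁ t₂) (f : E → E') (hf : (L.map f).Sublist L') :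
    Crosses L' (f c₁) (f c₂) (f t₁) (f t₂) := by
  obtain ⟨K, h1, h2⟩ := h
  obtain ⟨K', h3, h4⟩ := exists_isRotated_sublist hf (h1.map f)
  exact ⟨K', h3, h2.imp (fun h => (h.map f).trans h4) (fun h => (h.map f).trans h4)⟩

theorem exists_rotation_cons {L : List E} {c d : E} (hc : c ∈ L) (hd : d ∈ L) (hcd : c ≠ d) :
    ∃ X Y, (c :: (X ++ d :: Y)) ~r L := by
  obtain ⟨A, B, rfl⟩ := List.append_of_mem hc
  have : d ∈ B ++ A := by
    simp only [List.mem_append, List.mem_cons] at hd ⊢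
    rcases hd with h | h | h
    · exact Or.inr h
    · exact absurd h.symm hcd
    · exact Or.inl h
  obtain ⟨X, Y, hXY⟩ := List.append_of_mem this
  refine ⟨X, Y, ?_⟩
  rw [← hXY, ← List.cons_append]
  exact List.isRotated_append

theorem eq_of_cons_isRotated_cons {c : E} {A B : List E} (hn : (c :: A).Nodup)
    (h : (c :: A) ~r (c :: B)) : A = B := by
  obtain ⟨k, hk⟩ := h
  rw [← List.rotate_mod] at hk
  have h0 : ((c :: A).rotate (k % (c :: A).length))[0]'(by simp) = c := by
    simp only [hk, List.getElem_cons_zero]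
  rw [List.getElem_rotate] at h0
  have h1 : (0 + k % (c :: A).length) % (c :: A).length = 0 := by
    exact (hn.getElem_inj_iff (hi := Nat.mod_lt _ (by simp)) (hj := by simp)).1
      (by rw [h0]; rfl)
  rw [zero_add, Nat.mod_mod] at h1
  rw [h1, List.rotate_zero] at hk
  simpa using hk

theorem exists_split_of_sublist {K : List E} {s c t : E} (h : [s, c, t].Sublist K) :
    ∃ K₁ K₂, K = K₁ ++ c :: K₂ ∧ s ∈ K₁ ∧ t ∈ K₂ := by
  obtain ⟨r₁, r₂, rfl, hs, h2⟩ := List.cons_sublist_iff.1 h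
  obtain ⟨r₃, r₄, rfl, hc, h4⟩ := List.cons_sublist_iff.1 h2
  obtain ⟨u, v, rfl⟩ := List.append_of_mem hc
  exact ⟨r₁ ++ u, v ++ r₄, by simp, by simp [hs], by simp [List.singleton_sublist.1 h4]⟩

theorem eq_of_append_cons_eq {c : E} {A B X Y : List E} (hn : (A ++ c :: B).Nodup)
    (h : A ++ c :: B = X ++ c :: Y) : A = X ∧ B = Y := by
  rcases List.append_eq_append_iff.1 h with ⟨u, h1, h2⟩ | ⟨u, h1, h2⟩
  · cases u with
    | nil => simp_all
    | cons a u =>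
      exfalso
      simp only [List.cons_append, List.cons.injEq] at h2
      rw [h2.2] at hn
      simp [List.nodup_append] at hn
  · cases u with
    | nil => simp_all
    | cons a u =>
      exfalso
      simp only [List.cons_append, List.cons.injEq] at h2
      rw [h1, ← h2.1] at hn
      simp [List.nodup_append] at hn

/-- The ends of a chord which crosses `c d` are separated by `c` and `d`. -/
theorem Crosses.mem_arcs {c d s t : E} {X Y : List E} (hn : (c :: (X ++ d :: Y)).Nodup)
    (h : Crosses (c :: (X ++ d :: Y)) c d s t) : (s ∈ X ∧ t ∈ Y) ∨ (t ∈ X ∧ s ∈ Y) := by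
  have key : ∀ s t L', L' ~r (c :: (X ++ d :: Y)) → [c, s, d, t].Sublist L' →
      s ∈ X ∧ t ∈ Y := by
    intro s t L' hL h
    obtain ⟨r₁, r₂, rfl, hc, h2⟩ := List.cons_sublist_iff.1 h
    obtain ⟨u, v, rfl⟩ := List.append_of_mem hc
    have hrot : (c :: (v ++ r₂ ++ u)) ~r (u ++ c :: v ++ r₂) := by
      have : (c :: (v ++ r₂) ++ u) ~r (u ++ c :: (v ++ r₂)) := List.isRotated_append
      simpa using this
    have hrot' := hrot.trans hL
    have heq := eq_of_cons_isRotated_cons (hrot'.symm.nodup_iff.1 hn) hrot'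
    obtain ⟨K₁, K₂, hK, hs, ht⟩ := exists_split_of_sublist (K := v ++ r₂ ++ u) (h2.trans (by
      rw [List.append_assoc]
      exact (List.sublist_append_left _ _).trans (List.sublist_append_right _ _)))
    rw [hK] at heq
    have hn' : (K₁ ++ d :: K₂).Nodup := by rw [heq]; exact hn.of_cons
    obtain ⟨rfl, rfl⟩ := eq_of_append_cons_eq hn' heq
    exact ⟨hs, ht⟩
  obtain ⟨L', hL, h | h⟩ := h
  · exact Or.inl (key s t L' hL h)
  · exact Or.inr (key t s L' hL h)

/-- The list `f 0, …, f (N - 1)` is mapped to its rotation by a map which increases the index. -/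
theorem map_range_rotate {f : ℕ → E} {g : E → E} {N : ℕ} (hN : 0 < N) (h0 : f N = f 0)
    (hg : ∀ t, g (f t) = f (t + 1)) :
    ((List.range N).map f).map g = ((List.range N).map f).rotate 1 := by
  obtain ⟨n, rfl⟩ : ∃ n, N = n + 1 := ⟨N - 1, by omega⟩
  rw [List.map_map]
  have e1 : g ∘ f = f ∘ Nat.succ := funext hg
  rw [e1, List.range_succ, List.map_append, ← List.range_succ, List.range_succ_eq_map]
  simp [h0]

/-- The product with the transpositions `(c j)` and `(d k)` joins the cycle `c X d Y` with the two
cycles `j P` and `k Q`: the cycle `j P` is inserted before `c`, the cycle `k Q` before `d`. -/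
theorem IsCycleList.join {E' : Type*} [DecidableEq E] [DecidableEq E'] {f : E → E} {f' : E' → E'}
    {c d : E} {j k : E'} {X Y : List E} {P Q : List E'}
    (h : IsCycleList f (c :: (X ++ d :: Y)))
    (hP : (j :: P).map f' = P ++ [j]) (hQ : (k :: Q).map f' = Q ++ [k])
    (hn : ((j :: P) ++ (k :: Q)).Nodup) (hmem : ∀ x, x ∈ (j :: P) ++ (k :: Q)) :
    IsCycleList (fun x => Equiv.swap (Sum.inl c) (Sum.inr j)
        (Equiv.swap (Sum.inl d) (Sum.inr k) (Sum.map f f' x)))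
      ((j :: P).map Sum.inr ++ (c :: X).map Sum.inl ++ (k :: Q).map Sum.inr ++
        (d :: Y).map Sum.inl) := by
  have hn' := h.nodup
  refine ⟨?_, ?_, ?_⟩
  · simp only [List.nodup_cons, List.nodup_append, List.map_cons, List.mem_map, List.mem_cons,
      List.mem_append, List.cons_append] at hn hn' ⊢
    simp only [List.nodup_map_iff Sum.inl_injective, List.nodup_map_iff Sum.inr_injective,
      Sum.forall]
    simp
    grind
  · have hm := h.mem
    simp only [List.mem_cons, List.mem_append, List.cons_append] at hmem hm
    rintro (x | x)
    · have := hm x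
      simp only [List.map_cons, List.cons_append, List.mem_cons, List.mem_append, List.mem_map]
      simp
      tauto
    · have := hmem x
      simp only [List.map_cons, List.cons_append, List.mem_cons, List.mem_append, List.mem_map]
      simp
      tauto
  · have hm : (c :: X).map f ++ (d :: Y).map f = (X ++ [d]) ++ (Y ++ [c]) := by
      have := h.map_eq
      simpa using this
    obtain ⟨hX, hY⟩ := List.append_inj hm (by simp)
    set sw : E ⊕ E' → E ⊕ E' := fun x => Equiv.swap (Sum.inl c) (Sum.inr j)
        (Equiv.swap (Sum.inl d) (Sum.inr k) x) with hsw
    have hfun : (fun x => Equiv.swap (Sum.inl c) (Sum.inr j)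
        (Equiv.swap (Sum.inl d) (Sum.inr k) (Sum.map f f' x))) = sw ∘ Sum.map f f' := rfl
    have l1 : ∀ l : List E, (l.map Sum.inl).map (Sum.map f f') = (l.map f).map Sum.inl := by
      intro l; simp
    have l2 : ∀ l : List E', (l.map Sum.inr).map (Sum.map f f') = (l.map f').map Sum.inr := by
      intro l; simp
    have s1 : ∀ l : List E, c ∉ l → d ∉ l → (l.map Sum.inl).map sw = l.map Sum.inl := by
      intro l hc hd
      rw [List.map_map]
      apply List.map_congr_left
      intro x hx
      have a : x ≠ c := by rintro rfl; exact hc hx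
      have b : x ≠ d := by rintro rfl; exact hd hx
      simp [hsw, Equiv.swap_apply_def, a, b]
    have s2 : ∀ l : List E', j ∉ l → k ∉ l → (l.map Sum.inr).map sw = l.map Sum.inr := by
      intro l hc hd
      rw [List.map_map]
      apply List.map_congr_left
      intro x hx
      have a : x ≠ j := by rintro rfl; exact hc hx
      have b : x ≠ k := by rintro rfl; exact hd hx
      simp [hsw, Equiv.swap_apply_def, a, b]
    simp only [List.nodup_cons, List.nodup_append, List.mem_cons, List.mem_append,
      List.cons_append, not_or] at hn hn'
    have hcd : c ≠ d := by grind
    have hjk : j ≠ k := by grind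
    have w1 : sw (Sum.inl c) = Sum.inr j := by simp [hsw, Equiv.swap_apply_def, hcd]
    have w2 : sw (Sum.inr j) = Sum.inl c := by simp [hsw, Equiv.swap_apply_def, hjk]
    have w3 : sw (Sum.inl d) = Sum.inr k := by simp [hsw, Equiv.swap_apply_def, hjk.symm]
    have w4 : sw (Sum.inr k) = Sum.inl d := by simp [hsw, Equiv.swap_apply_def, hcd.symm]
    rw [hfun, ← List.map_map]
    simp only [List.map_append, l1, l2, hX, hY, hP, hQ]
    rw [s1 X (by grind) (by grind), s1 Y (by grind) (by grind), s2 P (by grind) (by grind),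
      s2 Q (by grind) (by grind)]
    simp [w1, w2, w3, w4]

end CyclicLists

/-! ### Complexes with a reflection -/

/-- A description by darts of a complex in which the darts are the pairs of an element `e : E` and a
side `a : Bool`, and `S` and `σ` act on the darts by `(e, a) ↦ (S e, a)` and `(e, a) ↦ (σ e, !a)`.
So interchanging the sides commutes with both, although the labels `V` and `A` need not be
symmetric. For a bipyramid `E` is the set of base edges, the two sides are those of the two apexes
and `σ` is the identity. -/
structure MirrorComplex {W : Type*} [DecidableEq W] (Γ : Set (Finset W)) (E : Type*) where
  S : Equiv.Perm E
  σ : Equiv.Perm E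
  V : E → Bool → W
  A : E → Bool → W
  mem_faces : ∀ F, F ∈ Γ ↔ ∃ e a, F = {V e a, V (S e) a, A e a}
  A_S : ∀ e a, A (S e) a = A e a
  side_eq : ∀ e e' a a', A e a = A e' a' → a = a'
  inj : ∀ e e' a, V e a = V e' a → A e a = A e' a → e = e'
  V_ne_A : ∀ e a e' a', V e a ≠ A e' a'
  S_ne : ∀ e, S e ≠ e
  SS_ne : ∀ e, S (S e) ≠ e
  V_σ : ∀ e a, V (σ e) (!a) = V e a
  V_Sσ : ∀ e a, V (S (σ e)) (!a) = V (S e) a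
  edge_eq : ∀ e a e' a', ({V e a, V (S e) a} : Finset W) = {V e' a', V (S e') a'} →
    (e' = e ∧ a' = a) ∨ (e' = σ e ∧ a' = !a)

theorem Fin.sub_lt_of_strictMono {m : ℕ} {a : Fin (m + 1) → ℤ} (h : StrictMono a) {n : ℤ}
    (hn : a (Fin.last m) - a 0 < n) (s t : Fin (m + 1)) : a t - a s < n := by
  have h1 := h.monotone (Fin.le_last t)
  have h2 := h.monotone (Fin.zero_le s)
  omega

namespace MirrorComplex

variable {W : Type*} [DecidableEq W] {Γ : Set (Finset W)} {E : Type*} (M : MirrorComplex Γ E)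

/-- The underlying description by darts. -/
def toDartComplex : DartComplex Γ (E × Bool) where
  S := M.S.prodCongr (Equiv.refl _)
  σ := M.σ.prodCongr Equiv.boolNot
  V x := M.V x.1 x.2
  A x := M.A x.1 x.2
  mem_faces F := by simp [M.mem_faces]
  A_S x := M.A_S _ _
  inj := by
    rintro ⟨e, a⟩ ⟨e', a'⟩ h1 h2
    obtain rfl := M.side_eq _ _ _ _ h2
    exact Prod.ext (M.inj _ _ _ h1 h2) rfl
  V_ne_A x y := M.V_ne_A _ _ _ _
  S_ne x h := M.S_ne x.1 (congrArg Prod.fst h)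
  SS_ne x h := M.SS_ne x.1 (congrArg Prod.fst h)
  V_σ x := M.V_σ _ _
  V_Sσ x := M.V_Sσ _ _
  σ_ne x h := by simpa using congrArg Prod.snd h
  edge := by
    rintro ⟨e, a⟩ ⟨e', a'⟩ h
    rcases M.edge_eq _ _ _ _ h with ⟨rfl, rfl⟩ | ⟨rfl, rfl⟩
    · exact Or.inl rfl
    · exact Or.inr rfl

/-- The map `φ` on darts with the sides forgotten: `φ (e, a) = (next e, !a)`. -/
def next : Equiv.Perm E := M.σ * M.S * M.S

theorem next_apply (e : E) : M.next e = M.σ (M.S (M.S e)) := rfl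

/-- The base edge `e`, considered as a base edge of the face on the side `a`. -/
def base (e : E) (a : Bool) : Finset W := {M.V e a, M.V (M.S e) a}

theorem φ_pow_apply (k : ℕ) (e : E) (a : Bool) :
    (M.toDartComplex.φ ^ k) (e, a) = ((M.next ^ k) e, (not^[k]) a) := by
  induction k with
  | zero => rfl
  | succ k ih =>
    rw [pow_succ', Equiv.Perm.mul_apply, ih, pow_succ', Equiv.Perm.mul_apply,
      Function.iterate_succ_apply']
    rfl

theorem not_iterate (k : ℕ) (a : Bool) : (not^[k]) a = if Even k then a else !a := by
  induction k with
  | zero => simp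
  | succ k ih =>
    rw [Function.iterate_succ_apply', ih]
    by_cases h : Even k <;> simp [h, Nat.even_add_one]

variable {L : List E}

/-- The orbit of a dart runs through the cycle `L`, and the side changes in every step. -/
theorem φ_pow_head (hL : IsCycleList M.next L) (h0 : 0 < L.length) (k : ℕ) (a : Bool) :
    (M.toDartComplex.φ ^ k) (L[0], a) =
      (L[k % L.length]'(Nat.mod_lt _ h0), if Even k then a else !a) := by
  rw [φ_pow_apply, not_iterate, hL.pow_apply h0]

theorem zig_head (hL : IsCycleList M.next L) (h0 : 0 < L.length) (k : ℕ) (a : Bool) :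
    M.toDartComplex.zig (L[0], a) (3 * k) =
      M.base (L[k % L.length]'(Nat.mod_lt _ h0)) (if Even k then a else !a) := by
  rw [← zero_add (3 * (k : ℤ)), DartComplex.zig_add, zpow_natCast, M.φ_pow_head hL h0,
    DartComplex.zig_zero]
  rfl

/-- As the side changes in each step, an odd number of base edges makes `φ` transitive. -/
theorem transitive (hL : IsCycleList M.next L) (hodd : Odd L.length) (y : E × Bool) :
    ∃ k : ℤ, (M.toDartComplex.φ ^ k) (L[0]'hodd.pos, true) = y := by
  obtain ⟨e, a⟩ := y
  obtain ⟨i, hi, rfl⟩ := List.getElem_of_mem (hL.mem e)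
  by_cases h : a = if Even i then true else !true
  · refine ⟨(i : ℕ), ?_⟩
    rw [zpow_natCast, M.φ_pow_head hL hodd.pos, h]
    simp [Nat.mod_eq_of_lt hi]
  · refine ⟨((i + L.length : ℕ) : ℤ), ?_⟩
    rw [zpow_natCast, M.φ_pow_head hL hodd.pos]
    have : Even (i + L.length) ↔ ¬ Even i := by
      rw [Nat.even_add]; simp [Nat.not_even_iff_odd.2 hodd]
    by_cases h' : Even i <;> simp_all [Nat.mod_eq_of_lt hi]

/-- As `L` has odd length, the zigzag runs through `L` twice, with opposite sides. -/
theorem isCyclicLength_zig (hL : IsCycleList M.next L) (hodd : Odd L.length) :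
    IsCyclicLength (M.toDartComplex.zig (L[0]'hodd.pos, true)) (3 * (2 * L.length)) := by
  have h0 := hodd.pos
  apply DartComplex.isCyclicLength_zig
  · omega
  · rw [M.φ_pow_head hL h0]; simp
  · intro k hk h
    rw [M.φ_pow_head hL h0] at h
    have h1 := (hL.nodup.getElem_inj_iff (hi := Nat.mod_lt k h0) (hj := h0)).1
      (congrArg Prod.fst h)
    have h2 : Even k := by by_contra h2; simp [h2] at h
    obtain ⟨c, rfl⟩ := h2.two_dvd
    have h3 : L.length ∣ c :=
      (Nat.Coprime.dvd_mul_left (Nat.coprime_two_right.2 hodd)).1 (Nat.dvd_of_mod_eq_zero h1)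
    have := Nat.le_of_dvd (by omega) h3
    omega

/-- Base edges which occur in the cyclic list in some order occur in this order twice in the
zigzag. -/
theorem exists_positions {L' l : List E} (hL : IsCycleList M.next L) (hodd : Odd L.length)
    (hL' : L' ~r L) (hl : l.Sublist L') (hb : ∀ f ∈ l, M.base f true = M.base f false) :
    ∃ Z, IsZigzag Γ Z ∧ IsCyclicLength Z (6 * L.length) ∧ ∃ p : Fin l.length → ℕ,
      StrictMono p ∧ (∀ i, p i < L.length) ∧ (∀ i, Z (3 * p i) = M.base (l.get i) true) ∧
      ∀ i, Z (3 * (p i + L.length)) = M.base (l.get i) true := by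
  have hLen : L'.length = L.length := hL'.perm.length_eq
  have hL2 := hL.isRotated hL'
  have hodd' : Odd L'.length := hLen ▸ hodd
  have hbb : ∀ f ∈ l, ∀ a, M.base f a = M.base f true := fun f hf a => by
    cases a
    · exact (hb f hf).symm
    · rfl
  obtain ⟨g, hg⟩ := List.sublist_iff_exists_fin_orderEmbedding_get_eq.1 hl
  refine ⟨M.toDartComplex.zig (L'[0]'hodd'.pos, true), DartComplex.isZigzag_zig _ _, ?_,
    fun i => g i, fun i j h => g.strictMono h, fun i => hLen ▸ (g i).2, fun i => ?_, fun i => ?_⟩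
  · have := M.isCyclicLength_zig hL2 hodd'
    rwa [show 3 * (2 * L'.length) = 6 * L.length by rw [hLen]; ring] at this
  · rw [M.zig_head hL2 hodd'.pos]
    simp only [Nat.mod_eq_of_lt (g i).2]
    rw [hg i]
    exact hbb _ (by rw [← List.get_eq_getElem, ← hg i]; exact List.get_mem _ _) _
  · rw [← hLen, ← Nat.cast_add, M.zig_head hL2 hodd'.pos]
    simp only [Nat.add_mod_right, Nat.mod_eq_of_lt (g i).2]
    rw [hg i]
    exact hbb _ (by rw [← List.get_eq_getElem, ← hg i]; exact List.get_mem _ _) _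

/-- Base edges `S⁻¹ m` and `m` with the same ends on both sides, such that no other dart starts
at their common vertex; the star of this vertex consists of four faces. -/
structure IsFree (m : E) : Prop where
  fst : ∀ a, M.V (M.S.symm m) a = M.V (M.S.symm m) true
  mid : ∀ a, M.V m a = M.V m true
  snd : ∀ a, M.V (M.S m) a = M.V (M.S m) true
  eq_of_V : ∀ e a, M.V e a = M.V m true → e = m

variable {M}

theorem IsFree.base_eq {m : E} (h : M.IsFree m) (a : Bool) : M.base m a = M.base m true := by
  rw [base, base, h.mid, h.snd]

theorem IsFree.base_symm_eq {m : E} (h : M.IsFree m) (a : Bool) :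
    M.base (M.S.symm m) a = M.base (M.S.symm m) true := by
  rw [base, base, Equiv.apply_symm_apply, h.mid, h.fst]

theorem S_symm_ne (m : E) : M.S.symm m ≠ m := fun h =>
  M.S_ne m (by conv_lhs => rw [← h, Equiv.apply_symm_apply])

/-- Every base edge which looks the same from both sides occurs twice in the zigzag, at distance
half a period, so any two such edges occur alternately. -/
theorem exists_isSpecialPair_pattern {c d : E} (hL : IsCycleList M.next L) (hodd : Odd L.length)
    (hcd : c ≠ d) (hc : M.base c true = M.base c false) (hd : M.base d true = M.base d false) :
    ∃ Z, IsZigzag Γ Z ∧ HasCyclicPattern Z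
      ![M.base c true, M.base d true, M.base c true, M.base d true] := by
  obtain ⟨X, Y, hXY⟩ := exists_rotation_cons (hL.mem c) (hL.mem d) hcd
  obtain ⟨Z, hZ, hlen, p, hp, hlt, h1, h2⟩ := M.exists_positions (l := [c, d]) hL hodd hXY
    (by simp) (by simp [hc, hd])
  refine ⟨Z, hZ, _, hlen, ![3 * p 0, 3 * p 1, 3 * (p 0 + L.length), 3 * (p 1 + L.length)], ?_⟩
  have q1 : p 0 < p 1 := hp (show (0 : Fin 2) < 1 by decide)
  have q2 := hlt 1
  have hs : StrictMono ![(3 * p 0 : ℤ), 3 * p 1, 3 * (p 0 + L.length), 3 * (p 1 + L.length)] := by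
    rw [Fin.strictMono_iff_lt_succ]
    intro i
    fin_cases i <;> simp <;> omega
  refine ⟨hs, Fin.sub_lt_of_strictMono hs ?_, ?_⟩
  · simp [Fin.last]
    omega
  · intro s
    fin_cases s
    · exact h1 0
    · exact h1 1
    · exact h2 0
    · exact h2 1

theorem exists_pattern_of_sublist {L' : List E} {c t d s : E} (hL : IsCycleList M.next L)
    (hodd : Odd L.length)
    (hL' : L' ~r L) (hsub : [c, t, d, s].Sublist L')
    (hb : ∀ f ∈ [c, t, d, s], M.base f true = M.base f false) :
    ∃ Z, IsZigzag Γ Z ∧ HasCyclicPattern Z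
      ![M.base c true, M.base t true, M.base d true, M.base s true,
        M.base c true, M.base t true, M.base d true, M.base s true] := by
  obtain ⟨Z, hZ, hlen, p, hp, hlt, h1, h2⟩ := M.exists_positions hL hodd hL' hsub hb
  refine ⟨Z, hZ, _, hlen, ![3 * p 0, 3 * p 1, 3 * p 2, 3 * p 3, 3 * (p 0 + L.length),
    3 * (p 1 + L.length), 3 * (p 2 + L.length), 3 * (p 3 + L.length)], ?_⟩
  have q1 : p 0 < p 1 := hp (show (0 : Fin 4) < 1 by decide)
  have q2 : p 1 < p 2 := hp (show (1 : Fin 4) < 2 by decide)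
  have q3 : p 2 < p 3 := hp (show (2 : Fin 4) < 3 by decide)
  have q4 := hlt 3
  have hs : StrictMono ![(3 * p 0 : ℤ), 3 * p 1, 3 * p 2, 3 * p 3, 3 * (p 0 + L.length),
    3 * (p 1 + L.length), 3 * (p 2 + L.length), 3 * (p 3 + L.length)] := by
    rw [Fin.strictMono_iff_lt_succ]
    intro i
    fin_cases i <;> simp <;> omega
  refine ⟨hs, Fin.sub_lt_of_strictMono hs ?_, ?_⟩
  · simp [Fin.last]
    omega
  · intro s
    fin_cases s
    · exact h1 0
    · exact h1 1
    · exact h1 2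
    · exact h1 3
    · exact h2 0
    · exact h2 1
    · exact h2 2
    · exact h2 3

/-- The pattern of concordant pairs in the opposite direction of the zigzag. -/
theorem exists_reversed_pattern_of_sublist {L' : List E} {c t d s : E}
    (hL : IsCycleList M.next L) (hodd : Odd L.length)
    (hL' : L' ~r L) (hsub : [s, d, t, c].Sublist L')
    (hb : ∀ f ∈ [s, d, t, c], M.base f true = M.base f false) :
    ∃ Z, IsZigzag Γ Z ∧ HasCyclicPattern Z
      ![M.base c true, M.base t true, M.base d true, M.base s true,
        M.base c true, M.base t true, M.base d true, M.base s true] := by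
  obtain ⟨Z, hZ, hlen, p, hp, hlt, h1, h2⟩ := M.exists_positions hL hodd hL' hsub hb
  refine ⟨reversed Z, hZ.reversed, _, hlen.reversed, ![-(3 * (p 3 + L.length)),
    -(3 * (p 2 + L.length)), -(3 * (p 1 + L.length)), -(3 * (p 0 + L.length)),
    -(3 * p 3), -(3 * p 2), -(3 * p 1), -(3 * p 0)], ?_⟩
  have q1 : p 0 < p 1 := hp (show (0 : Fin 4) < 1 by decide)
  have q2 : p 1 < p 2 := hp (show (1 : Fin 4) < 2 by decide)
  have q3 : p 2 < p 3 := hp (show (2 : Fin 4) < 3 by decide)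
  have q4 := hlt 3
  have hs : StrictMono ![(-(3 * (p 3 + L.length)) : ℤ),
    -(3 * (p 2 + L.length)), -(3 * (p 1 + L.length)), -(3 * (p 0 + L.length)),
    -(3 * p 3), -(3 * p 2), -(3 * p 1), -(3 * p 0)] := by
    rw [Fin.strictMono_iff_lt_succ]
    intro i
    fin_cases i <;> simp <;> omega
  refine ⟨hs, Fin.sub_lt_of_strictMono hs ?_, ?_⟩
  · simp [Fin.last]
    omega
  · intro s
    simp only [reversed]
    fin_cases s <;> simp only [Fin.zero_eta, Fin.mk_one, Fin.reduceFinMk, Matrix.cons_val,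
      neg_neg]
    · exact h2 3
    · exact h2 2
    · exact h2 1
    · exact h2 0
    · exact h1 3
    · exact h1 2
    · exact h1 1
    · exact h1 0

/-- Crossing chords of the cycle of base edges give the pattern of concordant pairs. -/
theorem exists_concordant_pattern {c t d s : E} (hL : IsCycleList M.next L) (hodd : Odd L.length)
    (h : Crosses L c d t s) (hb : ∀ f ∈ [c, t, d, s], M.base f true = M.base f false) :
    ∃ Z, IsZigzag Γ Z ∧ HasCyclicPattern Z
      ![M.base c true, M.base t true, M.base d true, M.base s true,
        M.base c true, M.base t true, M.base d true, M.base s true] := by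
  obtain ⟨L', hL', h | h⟩ := h
  · exact exists_pattern_of_sublist hL hodd hL' h hb
  · obtain ⟨L'', h1, h2⟩ := exists_isRotated_sublist h
      (show [s, d, t, c] ~r [c, s, d, t] from ⟨3, rfl⟩)
    refine exists_reversed_pattern_of_sublist hL hodd (h1.trans hL') h2 fun f hf => hb f ?_
    simp only [List.mem_cons, List.not_mem_nil, or_false] at hf ⊢
    tauto

/-- The edges `S⁻¹ m` and `m`, in one of the two orders. -/
def IsPairAt (M : MirrorComplex Γ E) (m : E) (c : Finset W × Finset W) : Prop :=
  c = (M.base (M.S.symm m) true, M.base m true) ∨ c = (M.base m true, M.base (M.S.symm m) true)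

theorem isSpecialPair (hL : IsCycleList M.next L) (hodd : Odd L.length)
    {τ : Set (ℤ → Finset W)} (hτ : IsZOrientation Γ τ) {m : E} (hm : M.IsFree m)
    {c : Finset W × Finset W} (hc : M.IsPairAt m c) : IsSpecialPair Γ τ c := by
  have hII : ∀ e, IsTypeIIEdge Γ τ (M.base e true) := fun e =>
    M.toDartComplex.isTypeIIEdge_base _ (M.transitive hL hodd) hτ (e, true)
  have hne : M.base (M.S.symm m) true ≠ M.base m true := by
    intro h
    rcases M.edge_eq _ _ _ _ h with ⟨h1, -⟩ | ⟨-, h1⟩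
    · exact S_symm_ne m h1.symm
    · simp at h1
  have v1 : M.V m true ∈ M.base (M.S.symm m) true := by simp [base]
  have v2 : M.V m true ∈ M.base m true := by simp [base]
  rcases hc with rfl | rfl
  · exact ⟨hII _, hII _, hne, ⟨_, v1, v2⟩, exists_isSpecialPair_pattern hL hodd (S_symm_ne m)
      (hm.base_symm_eq _).symm (hm.base_eq _).symm⟩
  · exact ⟨hII _, hII _, hne.symm, ⟨_, v2, v1⟩, exists_isSpecialPair_pattern hL hodd
      (S_symm_ne m).symm (hm.base_eq _).symm (hm.base_symm_eq _).symm⟩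

theorem areConcordant (hL : IsCycleList M.next L) (hodd : Odd L.length)
    {τ : Set (ℤ → Finset W)} (hτ : IsZOrientation Γ τ) {m k : E} (hm : M.IsFree m)
    (hk : M.IsFree k) {c t : Finset W × Finset W} (hc : M.IsPairAt m c) (ht : M.IsPairAt k t)
    (hct : NoCommonEdge c t) (hcross : Crosses L (M.S.symm m) m (M.S.symm k) k) :
    AreConcordant Γ τ c t := by
  refine ⟨isSpecialPair hL hodd hτ hm hc, isSpecialPair hL hodd hτ hk ht, hct, ?_⟩
  have b1 := (hm.base_eq false).symm
  have b2 := (hm.base_symm_eq false).symm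
  have b3 := (hk.base_eq false).symm
  have b4 := (hk.base_symm_eq false).symm
  rcases hc with rfl | rfl <;> rcases ht with rfl | rfl
  · exact exists_concordant_pattern hL hodd hcross (by simp [*])
  · exact exists_concordant_pattern hL hodd hcross.swap_right (by simp [*])
  · exact exists_concordant_pattern hL hodd hcross.swap_left (by simp [*])
  · exact exists_concordant_pattern hL hodd hcross.swap_left.swap_right (by simp [*])

end MirrorComplex

/-! ### Gluing -/

section Gluing

variable {W : Type*} [DecidableEq W] {Γ Γ' : Set (Finset W)} {E E' : Type*}

/-- The setting of a gluing of two complexes with reflection: the paths `s` and `s'` consist of the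
edges `S⁻¹ m`, `m` and `S⁻¹ m'`, `m'`, where `m` and `m'` are free; the `+` side of the former is
the side `δ`, the `+` side of the latter is the other side. (With this convention the vertex `s.mid`
of the glued complex, which is on the side `δ` in `Γ`, is on the other side in `Γ'`, as required by
the form of `σ` in a complex with reflection.) By `not_adj` the gluing does not produce a double
edge. -/
structure Gluable (M : MirrorComplex Γ E) (M' : MirrorComplex Γ' E') (m : E) (m' : E')
    (s s' : Slit W) (δ : Bool) : Prop where
  free : M.IsFree m
  free' : M'.IsFree m'
  fst : s.fst = M.V (M.S.symm m) true
  mid : s.mid = M.V m true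
  snd : s.snd = M.V (M.S m) true
  fst' : s'.fst = M'.V (M'.S.symm m') true
  mid' : s'.mid = M'.V m' true
  snd' : s'.snd = M'.V (M'.S m') true
  plus : ∀ e a, ({M.V e a, M.V (M.S e) a, M.A e a} : Finset W) ∈ s.plus ↔
    (M.S e = m ∨ e = m) ∧ a = δ
  plus' : ∀ e a, ({M'.V e a, M'.V (M'.S e) a, M'.A e a} : Finset W) ∈ s'.plus ↔
    (M'.S e = m' ∨ e = m') ∧ a = !δ
  disjoint : ∀ F ∈ Γ, ∀ F' ∈ Γ', Disjoint F F'
  not_adj : ∀ e a, ({M'.V e a, M'.V (M'.S e) a} : Finset W) ≠ {s'.fst, s'.snd}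

/-- The positions of the vertices of `Γ` on the side `a` in the glued complex. -/
def leftMap (s s' : Slit W) (δ a : Bool) : W → W :=
  if a = δ then id else Function.update id s.mid s'.mid

/-- The positions of the vertices of `Γ'` on the side `a` in the glued complex. -/
def rightMap (s s' : Slit W) (δ a : Bool) : W → W :=
  if a = δ then identifyEnds s s' else Function.update (identifyEnds s s') s'.mid s.mid

theorem leftMap_of_ne {s s' : Slit W} {δ a : Bool} {x : W} (h : x ≠ s.mid) :
    leftMap s s' δ a x = x := by
  unfold leftMap; split_ifs <;> simp [h]

theorem leftMap_mid {s s' : Slit W} {δ a : Bool} :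
    leftMap s s' δ a s.mid = if a = δ then s.mid else s'.mid := by
  unfold leftMap; split_ifs <;> simp

theorem identifyEnds_of_ne {s s' : Slit W} {x : W} (h1 : x ≠ s'.fst) (h2 : x ≠ s'.snd) :
    identifyEnds s s' x = x := by
  simp [identifyEnds, h1, h2]

theorem rightMap_of_ne {s s' : Slit W} {δ a : Bool} {x : W} (h : x ≠ s'.mid) :
    rightMap s s' δ a x = identifyEnds s s' x := by
  unfold rightMap; split_ifs <;> simp [h]

theorem image_triple {f : W → W} (x y z : W) :
    Finset.image f {x, y, z} = {f x, f y, f z} := by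
  simp [Finset.image_insert]

theorem image_pair {f : W → W} (x y : W) : Finset.image f {x, y} = {f x, f y} := by
  simp [Finset.image_insert]

namespace MirrorComplex

theorem IsFree.σ_eq {M : MirrorComplex Γ E} {m : E} (h : M.IsFree m) : M.σ m = m := by
  have := M.edge_eq m true m false (by
    have := (h.base_eq false).symm
    simpa [base] using this)
  rcases this with ⟨-, h1⟩ | ⟨h1, -⟩
  · simp at h1
  · exact h1.symm

theorem IsFree.σ_symm_eq {M : MirrorComplex Γ E} {m : E} (h : M.IsFree m) :
    M.σ (M.S.symm m) = M.S.symm m := by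
  have := M.edge_eq (M.S.symm m) true (M.S.symm m) false (by
    have := (h.base_symm_eq false).symm
    simpa only [base] using this)
  rcases this with ⟨-, h1⟩ | ⟨h1, -⟩
  · simp at h1
  · exact h1.symm

theorem face_mem (M : MirrorComplex Γ E) (e : E) (a : Bool) :
    ({M.V e a, M.V (M.S e) a, M.A e a} : Finset W) ∈ Γ := (M.mem_faces _).2 ⟨e, a, rfl⟩

theorem IsFree.mid_mem_iff {M : MirrorComplex Γ E} {m : E} (h : M.IsFree m) (e : E) (a : Bool) :
    M.V m true ∈ ({M.V e a, M.V (M.S e) a, M.A e a} : Finset W) ↔ M.S e = m ∨ e = m := by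
  simp only [Finset.mem_insert, Finset.mem_singleton, M.V_ne_A, or_false]
  constructor
  · rintro (h1 | h1)
    · exact Or.inr (h.eq_of_V _ _ h1.symm)
    · exact Or.inl (h.eq_of_V _ _ h1.symm)
  · rintro (rfl | rfl)
    · exact Or.inr (h.mid a).symm
    · exact Or.inl (h.mid a).symm

end MirrorComplex

namespace Gluable

variable {M : MirrorComplex Γ E} {M' : MirrorComplex Γ' E'} {m : E} {m' : E'} {s s' : Slit W}
  {δ : Bool} (h : Gluable M M' m m' s s' δ)

include h

theorem V_ne_V' (e : E) (a : Bool) (e' : E') (a' : Bool) : M.V e a ≠ M'.V e' a' := fun h0 =>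
  Finset.disjoint_left.1 (h.disjoint _ (M.face_mem e a) _ (M'.face_mem e' a'))
    (Finset.mem_insert_self _ _) (by simp [h0])

theorem V_ne_A' (e : E) (a : Bool) (e' : E') (a' : Bool) : M.V e a ≠ M'.A e' a' := fun h0 =>
  Finset.disjoint_left.1 (h.disjoint _ (M.face_mem e a) _ (M'.face_mem e' a'))
    (Finset.mem_insert_self _ _) (by simp [h0])

theorem V'_ne_A (e : E) (a : Bool) (e' : E') (a' : Bool) : M'.V e' a' ≠ M.A e a := fun h0 =>
  Finset.disjoint_right.1 (h.disjoint _ (M.face_mem e a) _ (M'.face_mem e' a'))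
    (Finset.mem_insert_self _ _) (by simp [h0])

theorem A_ne_A' (e : E) (a : Bool) (e' : E') (a' : Bool) : M.A e a ≠ M'.A e' a' := fun h0 =>
  Finset.disjoint_left.1 (h.disjoint _ (M.face_mem e a) _ (M'.face_mem e' a'))
    (show M.A e a ∈ _ by simp) (by simp [h0])

theorem V_eq_mid_iff (e : E) (a : Bool) : M.V e a = s.mid ↔ e = m := by
  rw [h.mid]
  exact ⟨h.free.eq_of_V e a, fun h1 => h1 ▸ h.free.mid a⟩

theorem V'_eq_mid_iff (e : E') (a : Bool) : M'.V e a = s'.mid ↔ e = m' := by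
  rw [h.mid']
  exact ⟨h.free'.eq_of_V e a, fun h1 => h1 ▸ h.free'.mid a⟩

theorem fst_ne_snd' : s'.fst ≠ s'.snd := by
  rw [h.fst', h.snd']
  intro h1
  have := M'.toDartComplex.V_SS_ne (M'.S.symm m', true)
  simp [MirrorComplex.toDartComplex] at this
  exact this h1.symm

theorem fst_ne_snd : s.fst ≠ s.snd := by
  rw [h.fst, h.snd]
  intro h1
  have := M.toDartComplex.V_SS_ne (M.S.symm m, true)
  simp [MirrorComplex.toDartComplex] at this
  exact this h1.symm

theorem fst_ne_mid : s.fst ≠ s.mid := by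
  rw [h.fst, ne_eq, h.V_eq_mid_iff]
  exact MirrorComplex.S_symm_ne m

theorem snd_ne_mid : s.snd ≠ s.mid := by
  rw [h.snd, ne_eq, h.V_eq_mid_iff]
  exact M.S_ne m

theorem fst_ne_mid' : s'.fst ≠ s'.mid := by
  rw [h.fst', ne_eq, h.V'_eq_mid_iff]
  exact MirrorComplex.S_symm_ne m'

theorem snd_ne_mid' : s'.snd ≠ s'.mid := by
  rw [h.snd', ne_eq, h.V'_eq_mid_iff]
  exact M'.S_ne m'

theorem V_ne_mid' (e : E) (a : Bool) : M.V e a ≠ s'.mid := by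
  rw [h.mid']; exact h.V_ne_V' _ _ _ _

theorem V'_ne_fst (e : E') (a : Bool) : M'.V e a ≠ s.fst := by
  rw [h.fst]; exact (h.V_ne_V' _ _ _ _).symm

theorem V'_ne_mid (e : E') (a : Bool) : M'.V e a ≠ s.mid := by
  rw [h.mid]; exact (h.V_ne_V' _ _ _ _).symm

theorem V'_ne_snd (e : E') (a : Bool) : M'.V e a ≠ s.snd := by
  rw [h.snd]; exact (h.V_ne_V' _ _ _ _).symm

theorem rightMap_fst (a : Bool) : rightMap s s' δ a s'.fst = s.fst := by
  rw [rightMap_of_ne h.fst_ne_mid', identifyEnds, Function.update_of_ne h.fst_ne_snd',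
    Function.update_self]

theorem rightMap_snd (a : Bool) : rightMap s s' δ a s'.snd = s.snd := by
  rw [rightMap_of_ne h.snd_ne_mid', identifyEnds, Function.update_self]

theorem rightMap_mid (a : Bool) : rightMap s s' δ a s'.mid = if a = δ then s'.mid else s.mid := by
  unfold rightMap
  split_ifs
  · exact identifyEnds_of_ne h.fst_ne_mid'.symm h.snd_ne_mid'.symm
  · simp

theorem rightMap_cases (e : E') (a : Bool) :
    (M'.V e a = s'.fst ∧ rightMap s s' δ a (M'.V e a) = s.fst) ∨
    (M'.V e a = s'.snd ∧ rightMap s s' δ a (M'.V e a) = s.snd) ∨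
    (e = m' ∧ rightMap s s' δ a (M'.V e a) = if a = δ then s'.mid else s.mid) ∨
    (e ≠ m' ∧ rightMap s s' δ a (M'.V e a) = M'.V e a) := by
  by_cases h1 : M'.V e a = s'.fst
  · exact Or.inl ⟨h1, by rw [h1, h.rightMap_fst]⟩
  by_cases h2 : M'.V e a = s'.snd
  · exact Or.inr (Or.inl ⟨h2, by rw [h2, h.rightMap_snd]⟩)
  by_cases h3 : e = m'
  · refine Or.inr (Or.inr (Or.inl ⟨h3, ?_⟩))
    rw [(h.V'_eq_mid_iff e a).2 h3, h.rightMap_mid]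
  · refine Or.inr (Or.inr (Or.inr ⟨h3, ?_⟩))
    rw [rightMap_of_ne (by rwa [ne_eq, h.V'_eq_mid_iff]), identifyEnds_of_ne h1 h2]

theorem leftMap_cases (e : E) (a : Bool) :
    (e = m ∧ leftMap s s' δ a (M.V e a) = if a = δ then s.mid else s'.mid) ∨
    (e ≠ m ∧ leftMap s s' δ a (M.V e a) = M.V e a) := by
  by_cases h3 : e = m
  · refine Or.inl ⟨h3, ?_⟩
    rw [(h.V_eq_mid_iff e a).2 h3, leftMap_mid]
  · exact Or.inr ⟨h3, leftMap_of_ne (by rwa [ne_eq, h.V_eq_mid_iff])⟩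

/-- The left map is inverted by identifying the two copies of the middle vertex. -/
theorem collapse_leftMap (e : E) (a : Bool) :
    Function.update id s'.mid s.mid (leftMap s s' δ a (M.V e a)) = M.V e a := by
  have h0 : s.mid ≠ s'.mid := by rw [h.mid]; exact h.V_ne_mid' _ _
  rcases h.leftMap_cases e a with ⟨h1, h2⟩ | ⟨h1, h2⟩ <;> rw [h2]
  · rw [(h.V_eq_mid_iff e a).2 h1]
    split_ifs <;> simp [h0]
  · rw [Function.update_of_ne (h.V_ne_mid' e a), id]

/-- The right map is inverted by identifying the two copies of the middle vertex and renaming the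
ends of the path. -/
theorem collapse_rightMap (e : E') (a : Bool) :
    Function.update (Function.update (Function.update id s.mid s'.mid) s.fst s'.fst) s.snd s'.snd
      (rightMap s s' δ a (M'.V e a)) = M'.V e a := by
  have n1 := h.fst_ne_snd
  have n2 := h.fst_ne_mid
  have n3 := h.snd_ne_mid
  have n4 : s'.mid ≠ s.mid := by rw [h.mid']; exact h.V'_ne_mid _ _
  have n5 : s'.mid ≠ s.fst := by rw [h.mid']; exact h.V'_ne_fst _ _
  have n6 : s'.mid ≠ s.snd := by rw [h.mid']; exact h.V'_ne_snd _ _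
  have n7 := h.V'_ne_fst e a
  have n8 := h.V'_ne_snd e a
  have n9 := h.V'_ne_mid e a
  rcases h.rightMap_cases e a with ⟨h1, h2⟩ | ⟨h1, h2⟩ | ⟨h1, h2⟩ | ⟨h1, h2⟩ <;> rw [h2]
  · simp [n1, h1]
  · simp [h1]
  · rw [(h.V'_eq_mid_iff e a).2 h1]
    split_ifs <;> simp [n2.symm, n3.symm, n4, n5, n6]
  · simp [n7, n8, n9]

theorem leftMap_A (e : E) (a : Bool) : leftMap s s' δ a (M.A e a) = M.A e a :=
  leftMap_of_ne (by rw [h.mid]; exact (M.V_ne_A _ _ _ _).symm)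

theorem rightMap_A (e : E') (a : Bool) : rightMap s s' δ a (M'.A e a) = M'.A e a := by
  rw [rightMap_of_ne, identifyEnds_of_ne]
  · rw [h.fst']; exact (M'.V_ne_A _ _ _ _).symm
  · rw [h.snd']; exact (M'.V_ne_A _ _ _ _).symm
  · rw [h.mid']; exact (M'.V_ne_A _ _ _ _).symm

/-- The faces of the glued complex in terms of the darts of its two parts. -/
theorem mem_glue_iff (F : Finset W) : F ∈ glue Γ Γ' s s' ↔
    (∃ e a, F = {leftMap s s' δ a (M.V e a), leftMap s s' δ a (M.V (M.S e) a), M.A e a}) ∨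
    ∃ e a, F = {rightMap s s' δ a (M'.V e a), rightMap s s' δ a (M'.V (M'.S e) a), M'.A e a} := by
  have hl : ∀ e a, ({leftMap s s' δ a (M.V e a), leftMap s s' δ a (M.V (M.S e) a), M.A e a} :
      Finset W) = Finset.image (leftMap s s' δ a) {M.V e a, M.V (M.S e) a, M.A e a} := by
    intro e a; rw [image_triple, h.leftMap_A]
  have hr : ∀ e a, ({rightMap s s' δ a (M'.V e a), rightMap s s' δ a (M'.V (M'.S e) a),
      M'.A e a} : Finset W) =
      Finset.image (rightMap s s' δ a) {M'.V e a, M'.V (M'.S e) a, M'.A e a} := by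
    intro e a; rw [image_triple, h.rightMap_A]
  have hm : ∀ e a, s.mid ∈ ({M.V e a, M.V (M.S e) a, M.A e a} : Finset W) ↔
      M.S e = m ∨ e = m := fun e a => by rw [h.mid]; exact h.free.mid_mem_iff e a
  have hm' : ∀ e a, s'.mid ∈ ({M'.V e a, M'.V (M'.S e) a, M'.A e a} : Finset W) ↔
      M'.S e = m' ∨ e = m' := fun e a => by rw [h.mid']; exact h.free'.mid_mem_iff e a
  have cl : ∀ A : Finset W, s.mid ∉ A → ∀ a, Finset.image (leftMap s s' δ a) A = A := by
    intro A hA a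
    conv_rhs => rw [← Finset.image_id (s := A)]
    exact Finset.image_congr fun x hx => leftMap_of_ne (by rintro rfl; exact hA hx)
  have cr : ∀ A : Finset W, s'.mid ∉ A → ∀ a,
      Finset.image (rightMap s s' δ a) A = Finset.image (identifyEnds s s') A := by
    intro A hA a
    exact Finset.image_congr fun x hx => rightMap_of_ne (by rintro rfl; exact hA hx)
  constructor
  · rintro (((⟨hF, h1⟩ | ⟨A, ⟨hA, h1, h2⟩, rfl⟩) | ⟨B, ⟨hB, h1⟩, rfl⟩) | ⟨B, ⟨hB, h1, h2⟩, rfl⟩)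
    · obtain ⟨e, a, rfl⟩ := (M.mem_faces F).1 hF
      refine Or.inl ⟨e, a, ?_⟩
      rw [hl]
      rcases h1 with h1 | h1
      · rw [cl _ h1]
      · obtain rfl := ((h.plus e a).1 h1).2
        simp [leftMap]
    · obtain ⟨e, a, rfl⟩ := (M.mem_faces A).1 hA
      refine Or.inl ⟨e, a, ?_⟩
      have : a ≠ δ := fun ha => h2 ((h.plus e a).2 ⟨(hm e a).1 h1, ha⟩)
      rw [hl, leftMap, if_neg this]
    · obtain ⟨e, a, rfl⟩ := (M'.mem_faces B).1 hB
      refine Or.inr ⟨e, a, ?_⟩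
      rw [hr]
      by_cases h2 : s'.mid ∈ ({M'.V e a, M'.V (M'.S e) a, M'.A e a} : Finset W)
      · have : a = δ := by
          by_contra ha
          exact (h1.resolve_left (not_not.2 h2))
            ((h.plus' e a).2 ⟨(hm' e a).1 h2, Bool.eq_not_of_ne ha⟩)
        rw [rightMap, if_pos this]
      · rw [cr _ h2]
    · obtain ⟨e, a, rfl⟩ := (M'.mem_faces B).1 hB
      refine Or.inr ⟨e, a, ?_⟩
      have : a ≠ δ := by
        rw [((h.plus' e a).1 h2).2]; simp
      rw [hr, rightMap, if_neg this]
  · rintro (⟨e, a, rfl⟩ | ⟨e, a, rfl⟩)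
    · rw [hl]
      by_cases h1 : s.mid ∈ ({M.V e a, M.V (M.S e) a, M.A e a} : Finset W)
      · by_cases ha : a = δ
        · rw [leftMap, if_pos ha, Finset.image_id]
          exact Or.inl (Or.inl (Or.inl ⟨M.face_mem e a,
            Or.inr ((h.plus e a).2 ⟨(hm e a).1 h1, ha⟩)⟩))
        · rw [leftMap, if_neg ha]
          exact Or.inl (Or.inl (Or.inr ⟨_, ⟨M.face_mem e a, h1,
            fun h2 => ha ((h.plus e a).1 h2).2⟩, rfl⟩))
      · rw [cl _ h1]
        exact Or.inl (Or.inl (Or.inl ⟨M.face_mem e a, Or.inl h1⟩))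
    · rw [hr]
      by_cases h1 : s'.mid ∈ ({M'.V e a, M'.V (M'.S e) a, M'.A e a} : Finset W)
      · by_cases ha : a = δ
        · rw [rightMap, if_pos ha]
          refine Or.inl (Or.inr ⟨_, ⟨M'.face_mem e a, Or.inr fun h2 => ?_⟩, rfl⟩)
          have := ((h.plus' e a).1 h2).2
          rw [ha] at this
          simp at this
        · rw [rightMap, if_neg ha]
          exact Or.inr ⟨_, ⟨M'.face_mem e a, h1,
            (h.plus' e a).2 ⟨(hm' e a).1 h1, Bool.eq_not_of_ne ha⟩⟩, rfl⟩
      · rw [cr _ h1]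
        exact Or.inl (Or.inr ⟨_, ⟨M'.face_mem e a, Or.inl h1⟩, rfl⟩)

end Gluable

end Gluing

/-! ### The darts of a glued complex -/

section Gluing

variable {W : Type*} [DecidableEq W] {Γ Γ' : Set (Finset W)} {E E' : Type*}

theorem ite_not_side {W : Type*} (δ a : Bool) (x y : W) :
    (if (!a) = δ then x else y) = if a = δ then y else x := by
  cases a <;> cases δ <;> rfl

namespace Gluable

variable {M : MirrorComplex Γ E} {M' : MirrorComplex Γ' E'} {m : E} {m' : E'} {s s' : Slit W}
  {δ : Bool} (h : Gluable M M' m m' s s' δ)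

include h

theorem σ_ne (e : E) (h1 : e ≠ M.S.symm m) : M.σ e ≠ M.S.symm m := fun h2 =>
  h1 (M.σ.injective (h2.trans h.free.σ_symm_eq.symm))

theorem σ_ne_mid (e : E) (h1 : e ≠ m) : M.σ e ≠ m := fun h2 =>
  h1 (M.σ.injective (h2.trans h.free.σ_eq.symm))

theorem σ_ne' (e : E') (h1 : e ≠ M'.S.symm m') : M'.σ e ≠ M'.S.symm m' := fun h2 =>
  h1 (M'.σ.injective (h2.trans h.free'.σ_symm_eq.symm))

theorem σ_ne_mid' (e : E') (h1 : e ≠ m') : M'.σ e ≠ m' := fun h2 =>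
  h1 (M'.σ.injective (h2.trans h.free'.σ_eq.symm))

theorem leftMap_fst (a b : Bool) : leftMap s s' δ a (M.V (M.S.symm m) b) = s.fst := by
  rw [h.free.fst, ← h.fst, leftMap_of_ne h.fst_ne_mid]

theorem leftMap_snd (a b : Bool) : leftMap s s' δ a (M.V (M.S m) b) = s.snd := by
  rw [h.free.snd, ← h.snd, leftMap_of_ne h.snd_ne_mid]

theorem leftMap_V_mid (a b : Bool) :
    leftMap s s' δ a (M.V m b) = if a = δ then s.mid else s'.mid := by
  rw [h.free.mid, ← h.mid, leftMap_mid]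

theorem rightMap_V_fst (a b : Bool) : rightMap s s' δ a (M'.V (M'.S.symm m') b) = s.fst := by
  rw [h.free'.fst, ← h.fst', h.rightMap_fst]

theorem rightMap_V_snd (a b : Bool) : rightMap s s' δ a (M'.V (M'.S m') b) = s.snd := by
  rw [h.free'.snd, ← h.snd', h.rightMap_snd]

theorem rightMap_V_mid (a b : Bool) :
    rightMap s s' δ a (M'.V m' b) = if a = δ then s'.mid else s.mid := by
  rw [h.free'.mid, ← h.mid', h.rightMap_mid]

theorem mid_ne_mid' : s.mid ≠ s'.mid := by
  rw [h.mid]; exact h.V_ne_mid' _ _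

/-- The two copies of an edge of the path are distinct. -/
theorem copies_ne {x : W} (hx : x ≠ s.mid) (a : Bool) :
    ({x, if a = δ then s.mid else s'.mid} : Finset W) ≠
      {x, if (!a) = δ then s.mid else s'.mid} := by
  intro h1
  have h0 := h.mid_ne_mid'
  cases a <;> cases δ <;> simp at h1
  all_goals
    rw [Finset.ext_iff] at h1
    have h2 := h1 s.mid
    simp [h0, hx.symm] at h2

/-- In the first part, the two sides of a base edge stay together unless the edge belongs to the
path. -/
theorem left_edge_eq (e : E) (a : Bool) (e' : E) (a' : Bool)
    (heq : ({leftMap s s' δ a (M.V e a), leftMap s s' δ a (M.V (M.S e) a)} : Finset W) =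
      {leftMap s s' δ a' (M.V e' a'), leftMap s s' δ a' (M.V (M.S e') a')}) :
    (e' = e ∧ a' = a) ∨ (e' = M.σ e ∧ a' = (!a) ∧ e ≠ M.S.symm m ∧ e ≠ m) := by
  have h1 := congrArg (Finset.image (Function.update id s'.mid s.mid)) heq
  rw [image_pair, image_pair] at h1
  simp only [h.collapse_leftMap] at h1
  rcases M.edge_eq _ _ _ _ h1 with h2 | ⟨rfl, rfl⟩
  · exact Or.inl h2
  refine Or.inr ⟨rfl, rfl, ?_, ?_⟩
  · rintro rfl
    rw [h.free.σ_symm_eq, Equiv.apply_symm_apply, h.leftMap_fst, h.leftMap_fst, h.leftMap_V_mid,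
      h.leftMap_V_mid] at heq
    exact h.copies_ne h.fst_ne_mid a heq
  · rintro rfl
    rw [h.free.σ_eq, h.leftMap_snd, h.leftMap_snd, h.leftMap_V_mid, h.leftMap_V_mid,
      Finset.pair_comm, Finset.pair_comm _ s.snd] at heq
    exact h.copies_ne h.snd_ne_mid a heq

/-- In the second part, the two sides of a base edge stay together unless the edge belongs to the
path. -/
theorem right_edge_eq (e : E') (a : Bool) (e' : E') (a' : Bool)
    (heq : ({rightMap s s' δ a (M'.V e a), rightMap s s' δ a (M'.V (M'.S e) a)} : Finset W) =
      {rightMap s s' δ a' (M'.V e' a'), rightMap s s' δ a' (M'.V (M'.S e') a')}) :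
    (e' = e ∧ a' = a) ∨ (e' = M'.σ e ∧ a' = (!a) ∧ e ≠ M'.S.symm m' ∧ e ≠ m') := by
  have h1 := congrArg (Finset.image (Function.update (Function.update
    (Function.update id s.mid s'.mid) s.fst s'.fst) s.snd s'.snd)) heq
  rw [image_pair, image_pair] at h1
  simp only [h.collapse_rightMap] at h1
  have hs := fun a => (ite_not_side δ a s.mid s'.mid).symm
  rcases M'.edge_eq _ _ _ _ h1 with h2 | ⟨rfl, rfl⟩
  · exact Or.inl h2
  refine Or.inr ⟨rfl, rfl, ?_, ?_⟩
  · rintro rfl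
    rw [h.free'.σ_symm_eq, Equiv.apply_symm_apply, h.rightMap_V_fst, h.rightMap_V_fst,
      h.rightMap_V_mid, h.rightMap_V_mid, hs, hs] at heq
    exact h.copies_ne h.fst_ne_mid _ heq
  · rintro rfl
    rw [h.free'.σ_eq, h.rightMap_V_snd, h.rightMap_V_snd, h.rightMap_V_mid, h.rightMap_V_mid,
      Finset.pair_comm, Finset.pair_comm _ s.snd, hs, hs] at heq
    exact h.copies_ne h.snd_ne_mid _ heq

theorem left_V_cases (e : E) (a : Bool) :
    (∃ f b, leftMap s s' δ a (M.V e a) = M.V f b) ∨ leftMap s s' δ a (M.V e a) = s'.mid := by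
  rcases h.leftMap_cases e a with ⟨h1, h2⟩ | ⟨h1, h2⟩ <;> rw [h2]
  · split_ifs
    · exact Or.inl ⟨m, true, h.mid⟩
    · exact Or.inr rfl
  · exact Or.inl ⟨_, _, rfl⟩

/-- The only common base edges of the two parts are the copies of the edges of the path. -/
theorem mixed_edge_eq (e : E) (a : Bool) (e' : E') (a' : Bool)
    (heq : ({leftMap s s' δ a (M.V e a), leftMap s s' δ a (M.V (M.S e) a)} : Finset W) =
      {rightMap s s' δ a' (M'.V e' a'), rightMap s s' δ a' (M'.V (M'.S e') a')}) :
    ((e = M.S.symm m ∧ e' = M'.S.symm m') ∨ (e = m ∧ e' = m')) ∧ a' = !a := by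
  have key : ∀ f' : E', rightMap s s' δ a' (M'.V f' a') ∈
      ({leftMap s s' δ a (M.V e a), leftMap s s' δ a (M.V (M.S e) a)} : Finset W) →
      M'.V f' a' = s'.fst ∨ M'.V f' a' = s'.snd ∨ f' = m' := by
    intro f' hf
    rcases h.rightMap_cases f' a' with ⟨h1, -⟩ | ⟨h1, -⟩ | ⟨h1, -⟩ | ⟨h1, h2⟩
    · exact Or.inl h1
    · exact Or.inr (Or.inl h1)
    · exact Or.inr (Or.inr h1)
    · exfalso
      rw [h2] at hf
      have : ∀ e, M'.V f' a' ≠ leftMap s s' δ a (M.V e a) := by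
        intro e h3
        rcases h.left_V_cases e a with ⟨e1, b, h4⟩ | h4
        · exact h.V_ne_V' e1 b f' a' (h4.symm.trans h3.symm)
        · exact h1 ((h.V'_eq_mid_iff f' a').1 (h3.trans h4))
      simp [this] at hf
  have k1 := key e' (by rw [heq]; simp)
  have k2 := key (M'.S e') (by rw [heq]; simp)
  have hs := fun a => (ite_not_side δ a s.mid s'.mid).symm
  have n1 := M'.toDartComplex.V_S_ne (e', a')
  simp only [MirrorComplex.toDartComplex, Equiv.prodCongr_apply, Prod.map_apply,
    Equiv.refl_apply] at n1
  have hmid : e' = M'.S.symm m' ∨ e' = m' := by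
    rw [Equiv.eq_symm_apply]
    rcases k1 with k1 | k1 | k1
    · rcases k2 with k2 | k2 | k2
      · exact absurd (k2.trans k1.symm) n1
      · exact absurd (by rw [k1, k2]) (h.not_adj e' a')
      · exact Or.inl k2
    · rcases k2 with k2 | k2 | k2
      · exact absurd (by rw [k1, k2, Finset.pair_comm]) (h.not_adj e' a')
      · exact absurd (k2.trans k1.symm) n1
      · exact Or.inl k2
    · exact Or.inr k1
  rcases hmid with rfl | rfl
  · rw [Equiv.apply_symm_apply, h.rightMap_V_fst, h.rightMap_V_mid, hs] at heq
    have := h.left_edge_eq e a (M.S.symm m) (!a') (by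
      rw [heq, Equiv.apply_symm_apply, h.leftMap_fst, h.leftMap_V_mid])
    rcases this with ⟨h1, h2⟩ | ⟨h1, -, h2, -⟩
    · exact ⟨Or.inl ⟨h1.symm, rfl⟩, by rw [← h2, Bool.not_not]⟩
    · exact absurd h1.symm (h.σ_ne e h2)
  · rw [h.rightMap_V_snd, h.rightMap_V_mid, hs] at heq
    have := h.left_edge_eq e a m (!a') (by rw [heq, h.leftMap_snd, h.leftMap_V_mid])
    rcases this with ⟨h1, h2⟩ | ⟨h1, -, -, h2⟩
    · exact ⟨Or.inr ⟨h1.symm, rfl⟩, by rw [← h2, Bool.not_not]⟩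
    · exact absurd h1.symm (h.σ_ne_mid e h2)

theorem left_ne_A (e : E) (a : Bool) :
    (∀ e' a', leftMap s s' δ a (M.V e a) ≠ M.A e' a') ∧
    ∀ e' a', leftMap s s' δ a (M.V e a) ≠ M'.A e' a' := by
  rcases h.left_V_cases e a with ⟨e1, b, h4⟩ | h4 <;> rw [h4]
  · exact ⟨M.V_ne_A _ _, h.V_ne_A' _ _⟩
  · rw [h.mid']
    exact ⟨fun _ _ => h.V'_ne_A _ _ _ _, M'.V_ne_A _ _⟩

theorem right_V_cases (e : E') (a : Bool) :
    (∃ f b, rightMap s s' δ a (M'.V e a) = M'.V f b) ∨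
    ∃ f b, rightMap s s' δ a (M'.V e a) = M.V f b := by
  rcases h.rightMap_cases e a with ⟨-, h2⟩ | ⟨-, h2⟩ | ⟨-, h2⟩ | ⟨h1, h2⟩ <;> rw [h2]
  · exact Or.inr ⟨_, _, h.fst⟩
  · exact Or.inr ⟨_, _, h.snd⟩
  · split_ifs
    · exact Or.inl ⟨_, _, h.mid'⟩
    · exact Or.inr ⟨_, _, h.mid⟩
  · exact Or.inl ⟨_, _, rfl⟩

theorem right_ne_A (e : E') (a : Bool) :
    (∀ e' a', rightMap s s' δ a (M'.V e a) ≠ M.A e' a') ∧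
    ∀ e' a', rightMap s s' δ a (M'.V e a) ≠ M'.A e' a' := by
  rcases h.right_V_cases e a with ⟨e1, b, h4⟩ | ⟨e1, b, h4⟩ <;> rw [h4]
  · exact ⟨fun _ _ => h.V'_ne_A _ _ _ _, M'.V_ne_A _ _⟩
  · exact ⟨M.V_ne_A _ _, h.V_ne_A' _ _⟩

end Gluable

/-- The involution of the base edges after the gluing: each edge of the first path is interchanged
with the corresponding edge of the second path. -/
def gluedσ [DecidableEq E] [DecidableEq E'] (M : MirrorComplex Γ E) (M' : MirrorComplex Γ' E')
    (m : E) (m' : E') : Equiv.Perm (E ⊕ E') :=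
  Equiv.swap (Sum.inl (M.S.symm m)) (Sum.inr (M'.S.symm m')) *
    Equiv.swap (Sum.inl m) (Sum.inr m') * Equiv.sumCongr M.σ M'.σ

namespace Gluable

variable {M : MirrorComplex Γ E} {M' : MirrorComplex Γ' E'} {m : E} {m' : E'} {s s' : Slit W}
  {δ : Bool} (h : Gluable M M' m m' s s' δ) [DecidableEq E] [DecidableEq E']

include h

theorem gluedσ_inl_fst : gluedσ M M' m m' (Sum.inl (M.S.symm m)) = Sum.inr (M'.S.symm m') := by
  have := MirrorComplex.S_symm_ne (M := M) m
  simp [gluedσ, h.free.σ_symm_eq, Equiv.swap_apply_def, this]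

theorem gluedσ_inl_mid : gluedσ M M' m m' (Sum.inl m) = Sum.inr m' := by
  have := MirrorComplex.S_symm_ne (M := M') m'
  simp [gluedσ, h.free.σ_eq, Equiv.swap_apply_def, this.symm]

theorem gluedσ_inl (e : E) (h1 : e ≠ M.S.symm m) (h2 : e ≠ m) :
    gluedσ M M' m m' (Sum.inl e) = Sum.inl (M.σ e) := by
  simp [gluedσ, Equiv.swap_apply_def, h.σ_ne e h1, h.σ_ne_mid e h2]

theorem gluedσ_inr_fst : gluedσ M M' m m' (Sum.inr (M'.S.symm m')) = Sum.inl (M.S.symm m) := by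
  have := MirrorComplex.S_symm_ne (M := M') m'
  simp [gluedσ, h.free'.σ_symm_eq, Equiv.swap_apply_def, this]

theorem gluedσ_inr_mid : gluedσ M M' m m' (Sum.inr m') = Sum.inl m := by
  have := MirrorComplex.S_symm_ne (M := M) m
  simp [gluedσ, h.free'.σ_eq, Equiv.swap_apply_def, this.symm]

theorem gluedσ_inr (e : E') (h1 : e ≠ M'.S.symm m') (h2 : e ≠ m') :
    gluedσ M M' m m' (Sum.inr e) = Sum.inr (M'.σ e) := by
  simp [gluedσ, Equiv.swap_apply_def, h.σ_ne' e h1, h.σ_ne_mid' e h2]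

theorem glued_V_σ (e : E ⊕ E') (a : Bool) :
    Sum.elim (fun e => leftMap s s' δ (!a) (M.V e (!a)))
      (fun e => rightMap s s' δ (!a) (M'.V e (!a)))
      (gluedσ M M' m m' e) =
    Sum.elim (fun e => leftMap s s' δ a (M.V e a)) (fun e => rightMap s s' δ a (M'.V e a)) e := by
  rcases e with e | e
  · by_cases h1 : e = M.S.symm m
    · subst h1
      rw [h.gluedσ_inl_fst, Sum.elim_inr, Sum.elim_inl, h.leftMap_fst, h.rightMap_V_fst]
    by_cases h2 : e = m
    · subst h2
      rw [h.gluedσ_inl_mid, Sum.elim_inr, Sum.elim_inl, h.leftMap_V_mid, h.rightMap_V_mid,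
        ite_not_side]
    rw [h.gluedσ_inl e h1 h2, Sum.elim_inl, Sum.elim_inl, M.V_σ]
    have : M.V e a ≠ s.mid := by rwa [ne_eq, h.V_eq_mid_iff]
    rw [leftMap_of_ne this, leftMap_of_ne this]
  · by_cases h1 : e = M'.S.symm m'
    · subst h1
      rw [h.gluedσ_inr_fst, Sum.elim_inr, Sum.elim_inl, h.leftMap_fst, h.rightMap_V_fst]
    by_cases h2 : e = m'
    · subst h2
      rw [h.gluedσ_inr_mid, Sum.elim_inr, Sum.elim_inl, h.leftMap_V_mid, h.rightMap_V_mid,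
        ite_not_side]
    rw [h.gluedσ_inr e h1 h2, Sum.elim_inr, Sum.elim_inr, M'.V_σ]
    have : M'.V e a ≠ s'.mid := by rwa [ne_eq, h.V'_eq_mid_iff]
    rw [rightMap_of_ne this, rightMap_of_ne this]

theorem glued_V_Sσ (e : E ⊕ E') (a : Bool) :
    Sum.elim (fun e => leftMap s s' δ (!a) (M.V e (!a)))
      (fun e => rightMap s s' δ (!a) (M'.V e (!a)))
      (Equiv.sumCongr M.S M'.S (gluedσ M M' m m' e)) =
    Sum.elim (fun e => leftMap s s' δ a (M.V e a)) (fun e => rightMap s s' δ a (M'.V e a))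
      (Equiv.sumCongr M.S M'.S e) := by
  rcases e with e | e
  · by_cases h1 : e = M.S.symm m
    · subst h1
      rw [h.gluedσ_inl_fst]
      simp only [Equiv.sumCongr_apply, Sum.map_inl, Sum.map_inr, Equiv.apply_symm_apply,
        Sum.elim_inl, Sum.elim_inr, h.leftMap_V_mid, h.rightMap_V_mid, ite_not_side]
    by_cases h2 : e = m
    · subst h2
      rw [h.gluedσ_inl_mid]
      simp [h.leftMap_snd, h.rightMap_V_snd]
    rw [h.gluedσ_inl e h1 h2]
    have : M.V (M.S e) a ≠ s.mid := by
      rwa [ne_eq, h.V_eq_mid_iff, ← Equiv.eq_symm_apply]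
    simp [M.V_Sσ, leftMap_of_ne this]
  · by_cases h1 : e = M'.S.symm m'
    · subst h1
      rw [h.gluedσ_inr_fst]
      simp only [Equiv.sumCongr_apply, Sum.map_inl, Sum.map_inr, Equiv.apply_symm_apply,
        Sum.elim_inl, Sum.elim_inr, h.leftMap_V_mid, h.rightMap_V_mid, ite_not_side]
    by_cases h2 : e = m'
    · subst h2
      rw [h.gluedσ_inr_mid]
      simp [h.leftMap_snd, h.rightMap_V_snd]
    rw [h.gluedσ_inr e h1 h2]
    have : M'.V (M'.S e) a ≠ s'.mid := by
      rwa [ne_eq, h.V'_eq_mid_iff, ← Equiv.eq_symm_apply]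
    simp [M'.V_Sσ, rightMap_of_ne this]

/-- The description by darts of the glued complex. -/
def glued : MirrorComplex (glue Γ Γ' s s') (E ⊕ E') where
  S := Equiv.sumCongr M.S M'.S
  σ := gluedσ M M' m m'
  V e a := Sum.elim (fun e => leftMap s s' δ a (M.V e a)) (fun e => rightMap s s' δ a (M'.V e a)) e
  A e a := Sum.elim (fun e => M.A e a) (fun e => M'.A e a) e
  mem_faces F := by
    rw [h.mem_glue_iff]
    simp
  A_S := by rintro (e | e) a <;> simp [M.A_S, M'.A_S]
  side_eq := by
    rintro (e | e) (e' | e') a a' h1 <;> simp only [Sum.elim_inl, Sum.elim_inr] at h1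
    · exact M.side_eq _ _ _ _ h1
    · exact absurd h1 (h.A_ne_A' _ _ _ _)
    · exact absurd h1.symm (h.A_ne_A' _ _ _ _)
    · exact M'.side_eq _ _ _ _ h1
  inj := by
    rintro (e | e) (e' | e') a h1 h2 <;> simp only [Sum.elim_inl, Sum.elim_inr] at h1 h2
    · have := congrArg (Function.update id s'.mid s.mid) h1
      simp only [h.collapse_leftMap] at this
      rw [M.inj _ _ _ this h2]
    · exact absurd h2 (h.A_ne_A' _ _ _ _)
    · exact absurd h2.symm (h.A_ne_A' _ _ _ _)
    · have := congrArg (Function.update (Function.update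
        (Function.update id s.mid s'.mid) s.fst s'.fst) s.snd s'.snd) h1
      simp only [h.collapse_rightMap] at this
      rw [M'.inj _ _ _ this h2]
  V_ne_A := by
    rintro (e | e) a (e' | e') a'
    · exact (h.left_ne_A e a).1 e' a'
    · exact (h.left_ne_A e a).2 e' a'
    · exact (h.right_ne_A e a).1 e' a'
    · exact (h.right_ne_A e a).2 e' a'
  S_ne := by rintro (e | e) <;> simp [M.S_ne, M'.S_ne]
  SS_ne := by rintro (e | e) <;> simp [M.SS_ne, M'.SS_ne]
  V_σ := h.glued_V_σ
  V_Sσ := h.glued_V_Sσ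
  edge_eq := by
    rintro (e | e) a (e' | e') a' h1 <;>
      simp only [Sum.elim_inl, Sum.elim_inr, Equiv.sumCongr_apply, Sum.map_inl, Sum.map_inr] at h1
    · rcases h.left_edge_eq e a e' a' h1 with ⟨rfl, rfl⟩ | ⟨rfl, rfl, h2, h3⟩
      · exact Or.inl ⟨rfl, rfl⟩
      · exact Or.inr ⟨(h.gluedσ_inl e h2 h3).symm, rfl⟩
    · rcases h.mixed_edge_eq e a e' a' h1 with ⟨⟨rfl, rfl⟩ | ⟨rfl, rfl⟩, rfl⟩
      · exact Or.inr ⟨h.gluedσ_inl_fst.symm, rfl⟩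
      · exact Or.inr ⟨h.gluedσ_inl_mid.symm, rfl⟩
    · rcases h.mixed_edge_eq e' a' e a h1.symm with ⟨⟨rfl, rfl⟩ | ⟨rfl, rfl⟩, rfl⟩
      · exact Or.inr ⟨h.gluedσ_inr_fst.symm, (Bool.not_not _).symm⟩
      · exact Or.inr ⟨h.gluedσ_inr_mid.symm, (Bool.not_not _).symm⟩
    · rcases h.right_edge_eq e a e' a' h1 with ⟨rfl, rfl⟩ | ⟨rfl, rfl, h2, h3⟩
      · exact Or.inl ⟨rfl, rfl⟩
      · exact Or.inr ⟨(h.gluedσ_inr e h2 h3).symm, rfl⟩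

/-- Gluing multiplies `next` by two transpositions. -/
theorem glued_next (x : E ⊕ E') : h.glued.next x =
    Equiv.swap (Sum.inl (M.S.symm m)) (Sum.inr (M'.S.symm m'))
      (Equiv.swap (Sum.inl m) (Sum.inr m') (Sum.map M.next M'.next x)) := by
  rcases x with x | x <;> rfl

theorem glued_V_inl (e : E) (a : Bool) (he : e ≠ m) : h.glued.V (Sum.inl e) a = M.V e a :=
  leftMap_of_ne (by rwa [ne_eq, h.V_eq_mid_iff])

theorem glued_V_inr (e : E') (a : Bool) (he : e ≠ m') :
    h.glued.V (Sum.inr e) a = identifyEnds s s' (M'.V e a) :=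
  rightMap_of_ne (by rwa [ne_eq, h.V'_eq_mid_iff])

theorem glued_isFree_inl {k : E} (hk : M.IsFree k) (h1 : k ≠ m) (h2 : M.S k ≠ m)
    (h3 : M.S m ≠ k) : h.glued.IsFree (Sum.inl k) := by
  have e1 : h.glued.S.symm (Sum.inl k) = Sum.inl (M.S.symm k) := rfl
  have e2 : h.glued.S (Sum.inl k) = Sum.inl (M.S k) := rfl
  have n1 : M.S.symm k ≠ m := fun h4 => h3 (by rw [← h4, Equiv.apply_symm_apply])
  constructor
  · intro a
    rw [e1, h.glued_V_inl _ _ n1, h.glued_V_inl _ _ n1, hk.fst]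
  · intro a
    rw [h.glued_V_inl _ _ h1, h.glued_V_inl _ _ h1, hk.mid]
  · intro a
    rw [e2, h.glued_V_inl _ _ h2, h.glued_V_inl _ _ h2, hk.snd]
  · rintro (e | e) a h4
    · rw [h.glued_V_inl _ _ h1] at h4
      rcases h.leftMap_cases e a with ⟨h5, h6⟩ | ⟨h5, h6⟩
      · exfalso
        have h7 : (if a = δ then s.mid else s'.mid) = M.V k true := h6.symm.trans h4
        split_ifs at h7
        · exact h1 ((h.V_eq_mid_iff k true).1 h7.symm)
        · exact h.V_ne_mid' _ _ h7.symm
      · rw [hk.eq_of_V e a (h6.symm.trans h4)]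
    · exfalso
      rw [h.glued_V_inl _ _ h1] at h4
      rcases h.rightMap_cases e a with ⟨-, h6⟩ | ⟨-, h6⟩ | ⟨-, h6⟩ | ⟨h5, h6⟩ <;>
        have h7 := h6.symm.trans h4
      · rw [h.fst] at h7
        exact h2 (by rw [← hk.eq_of_V _ _ h7, Equiv.apply_symm_apply])
      · rw [h.snd] at h7
        exact h3 (hk.eq_of_V _ _ h7)
      · split_ifs at h7
        · exact h.V_ne_mid' _ _ h7.symm
        · exact h1 ((h.V_eq_mid_iff k true).1 h7.symm)
      · exact h.V_ne_V' _ _ _ _ h7.symm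

theorem glued_isFree_inr {k : E'} (hk : M'.IsFree k) (h1 : k ≠ m') (h2 : M'.S k ≠ m')
    (h3 : M'.S m' ≠ k) : h.glued.IsFree (Sum.inr k) := by
  have e1 : h.glued.S.symm (Sum.inr k) = Sum.inr (M'.S.symm k) := rfl
  have e2 : h.glued.S (Sum.inr k) = Sum.inr (M'.S k) := rfl
  have n1 : M'.S.symm k ≠ m' := fun h4 => h3 (by rw [← h4, Equiv.apply_symm_apply])
  constructor
  · intro a
    rw [e1, h.glued_V_inr _ _ n1, h.glued_V_inr _ _ n1, hk.fst]
  · intro a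
    rw [h.glued_V_inr _ _ h1, h.glued_V_inr _ _ h1, hk.mid]
  · intro a
    rw [e2, h.glued_V_inr _ _ h2, h.glued_V_inr _ _ h2, hk.snd]
  · have f1 : M'.V k true ≠ s'.fst := by
      rw [h.fst']
      intro h4
      exact h2 (by rw [← hk.eq_of_V _ _ h4.symm, Equiv.apply_symm_apply])
    have f2 : M'.V k true ≠ s'.snd := by
      rw [h.snd']
      intro h4
      exact h3 (hk.eq_of_V _ _ h4.symm)
    have f3 : h.glued.V (Sum.inr k) true = M'.V k true := by
      rw [h.glued_V_inr _ _ h1, identifyEnds_of_ne f1 f2]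
    rintro (e | e) a h4 <;> rw [f3] at h4
    · exfalso
      rcases h.left_V_cases e a with ⟨e1, b, h5⟩ | h5
      · exact h.V_ne_V' _ _ _ _ (h5.symm.trans h4)
      · exact h1 ((h.V'_eq_mid_iff k true).1 (h4.symm.trans h5))
    · rcases h.rightMap_cases e a with ⟨-, h6⟩ | ⟨-, h6⟩ | ⟨-, h6⟩ | ⟨h5, h6⟩ <;>
        have h7 := h6.symm.trans h4
      · exact absurd h7.symm (h.V'_ne_fst _ _)
      · exact absurd h7.symm (h.V'_ne_snd _ _)
      · exfalso
        split_ifs at h7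
        · exact h1 ((h.V'_eq_mid_iff k true).1 h7.symm)
        · exact h.V'_ne_mid _ _ h7.symm
      · rw [hk.eq_of_V _ _ h7]

end Gluable

end Gluing

/-! ### Bipyramids -/

section Bipyramids

theorem sublist_range_of_pairwise {l : List ℕ} {n : ℕ} (h : l.Pairwise (· < ·))
    (hn : ∀ x ∈ l, x < n) : l.Sublist (List.range n) := by
  apply List.sublist_of_subperm_of_pairwise (r := (· < ·)) _ h List.pairwise_lt_range
  exact List.Nodup.subperm (h.imp fun h => h.ne) fun x hx => List.mem_range.2 (hn x hx)

theorem IsCycleList.isRotated_of {E : Type*} {f : Equiv.Perm E} {L L' : List E}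
    (h : IsCycleList f L) (h' : IsCycleList f L') (h0 : 0 < L.length) : L' ~r L := by
  obtain ⟨A, B, hAB⟩ := List.append_of_mem (h'.mem L[0])
  have hrot : (L[0] :: B ++ A) ~r L' := by rw [hAB]; exact List.isRotated_append
  have h2 := h'.isRotated hrot
  refine hrot.symm.trans ?_
  have : L[0] :: B ++ A = L := by
    apply List.ext_getElem
    · exact ((List.perm_ext_iff_of_nodup h2.nodup h.nodup).2
        fun e => ⟨fun _ => h.mem e, fun _ => h2.mem e⟩).length_eq
    · intro k hk hk'
      have e1 := h.pow_apply h0 k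
      have e2 := h2.pow_apply (by simp) k
      simp only [Nat.mod_eq_of_lt hk'] at e1
      simp only [Nat.mod_eq_of_lt hk] at e2
      rw [← e1, ← e2]
      simp
  rw [this]

/-- The base edges `j, j + 2, j + 4, …` of a bipyramid (`k` of them). -/
def evenSteps {n : ℕ} (j : ZMod n) (k : ℕ) : List (ZMod n) :=
  (List.range k).map fun t : ℕ => j + 2 * (t : ZMod n)

theorem evenSteps_map {n : ℕ} (j : ZMod n) {k : ℕ} (hk : 0 < k) (h : 2 * (k : ZMod n) = 0) :
    (evenSteps j k).map (fun i => i + 1 + 1) = (evenSteps j k).rotate 1 := by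
  apply map_range_rotate hk
  · simp [h]
  · intro t; push_cast; ring

theorem evenSteps_eq_cons {n : ℕ} (j : ZMod n) {k : ℕ} (hk : 0 < k) :
    evenSteps j k = j :: (evenSteps j k).tail := by
  obtain ⟨k, rfl⟩ : ∃ l, k = l + 1 := ⟨k - 1, by omega⟩
  simp [evenSteps, List.range_succ_eq_map]

section Odd

variable {k : ℕ}

theorem two_mul_succ_eq_one : 2 * ((k : ZMod (2 * k + 1)) + 1) = 1 := by
  have : ((2 * k + 1 : ℕ) : ZMod (2 * k + 1)) = 0 := ZMod.natCast_self _
  push_cast at this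
  linear_combination this

theorem natCast_inj_of_lt {n a b : ℕ} (ha : a < n) (hb : b < n) (h : (a : ZMod n) = b) :
    a = b := by
  have := (ZMod.natCast_eq_natCast_iff' a b n).1 h
  rwa [Nat.mod_eq_of_lt ha, Nat.mod_eq_of_lt hb] at this

theorem isCycleList_evenSteps (j : ZMod (2 * k + 1)) :
    IsCycleList (fun i : ZMod (2 * k + 1) => i + 1 + 1) (evenSteps j (2 * k + 1)) := by
  have h2 := two_mul_succ_eq_one (k := k)
  refine ⟨?_, ?_, evenSteps_map j (by omega) (by rw [ZMod.natCast_self, mul_zero])⟩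
  · rw [evenSteps, List.nodup_map_iff_inj_on List.nodup_range]
    intro a ha b hb h
    apply natCast_inj_of_lt (List.mem_range.1 ha) (List.mem_range.1 hb)
    linear_combination ((k : ZMod (2 * k + 1)) + 1) * h - ((a : ZMod (2 * k + 1)) - b) * h2
  · intro i
    rw [evenSteps, List.mem_map]
    refine ⟨((i - j) * (k + 1)).val, List.mem_range.2 (ZMod.val_lt _), ?_⟩
    rw [ZMod.natCast_zmod_val]
    linear_combination (i - j) * h2

/-- In the cycle of an odd bipyramid any two pairs of consecutive edges without a common edge
cross each other: two consecutive edges are `k + 1` steps apart. -/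
theorem crosses_evenSteps (i i' : ZMod (2 * k + 1)) (h1 : i ≠ i') (h2 : i ≠ i' - 1)
    (h3 : i - 1 ≠ i') : Crosses (evenSteps (i - 1) (2 * k + 1)) (i - 1) i (i' - 1) i' := by
  have h := two_mul_succ_eq_one (k := k)
  obtain ⟨s, hs, hi⟩ := List.mem_map.1 ((isCycleList_evenSteps (i - 1)).mem (i' - 1))
  rw [List.mem_range] at hs
  set f : ℕ → ZMod (2 * k + 1) := fun t => i - 1 + 2 * (t : ZMod (2 * k + 1)) with hf
  have f0 : f 0 = i - 1 := by simp [hf]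
  have f1 : f (k + 1) = i := by simp only [hf]; push_cast; linear_combination h
  have f2 : f s = i' - 1 := hi
  have f3 : f (s + k + 1) = i' := by
    simp only [hf] at f2 ⊢; push_cast; linear_combination f2 + h
  have hper : ∀ t, f (t + (2 * k + 1)) = f t := by
    intro t
    have : ((2 * k + 1 : ℕ) : ZMod (2 * k + 1)) = 0 := ZMod.natCast_self _
    simp only [hf]
    rw [Nat.cast_add t, this, add_zero]
  have s0 : s ≠ 0 := by
    rintro rfl
    exact h1 (by linear_combination f2 - f0)
  have s1 : s ≠ k + 1 := by
    rintro rfl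
    exact h2 (f1.symm.trans f2)
  have s2 : s ≠ k := by
    intro hs2
    have := hper 0
    rw [show 0 + (2 * k + 1) = s + k + 1 by omega, f3, f0] at this
    exact h3 this.symm
  rcases lt_or_ge s k with hlt | hge
  · have hsub : [0, s, k + 1, s + k + 1].Sublist (List.range (2 * k + 1)) :=
      sublist_range_of_pairwise (by simp; omega) (by simp; omega)
    have := hsub.map f
    simp only [List.map_cons, List.map_nil, f0, f1, f2, f3] at this
    exact ⟨_, List.IsRotated.refl _, Or.inl this⟩
  · have f4 : f (s - k) = i' := by
      rw [← f3, ← hper, show s - k + (2 * k + 1) = s + k + 1 by omega]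
    have hsub : [0, s - k, k + 1, s].Sublist (List.range (2 * k + 1)) :=
      sublist_range_of_pairwise (by simp; omega) (by simp; omega)
    have := hsub.map f
    simp only [List.map_cons, List.map_nil, f0, f1, f2, f4] at this
    exact ⟨_, List.IsRotated.refl _, Or.inr this⟩

end Odd

section Even

variable {k : ℕ}

theorem exists_half (i j : ZMod (2 * k)) (hk : 0 < k) :
    ∃ t < k, i = j + 2 * (t : ZMod (2 * k)) ∨ i = j + 1 + 2 * (t : ZMod (2 * k)) := by
  have : NeZero (2 * k) := ⟨by omega⟩
  have hv := ZMod.val_lt (i - j)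
  have hc := ZMod.natCast_zmod_val (i - j)
  generalize (i - j).val = v at hv hc
  refine ⟨v / 2, by omega, ?_⟩
  rcases Nat.even_or_odd' v with ⟨c, rfl | rfl⟩
  · left
    rw [show 2 * c / 2 = c by omega]
    push_cast at hc
    linear_combination -hc
  · right
    rw [show (2 * c + 1) / 2 = c by omega]
    push_cast at hc
    linear_combination -hc

theorem evenSteps_nodup (j : ZMod (2 * k)) : (evenSteps j k ++ evenSteps (j + 1) k).Nodup := by
  have key : ∀ j : ZMod (2 * k), (evenSteps j k).Nodup := by
    intro j
    rw [evenSteps, List.nodup_map_iff_inj_on List.nodup_range]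
    intro a ha b hb h
    rw [List.mem_range] at ha hb
    have : ((2 * a : ℕ) : ZMod (2 * k)) = ((2 * b : ℕ) : ZMod (2 * k)) := by
      push_cast; linear_combination h
    have := natCast_inj_of_lt (by omega) (by omega) this
    omega
  rw [List.nodup_append]
  refine ⟨key _, key _, ?_⟩
  rintro x hx y hy rfl
  obtain ⟨a, ha, h1⟩ := List.mem_map.1 hx
  obtain ⟨b, hb, h2⟩ := List.mem_map.1 hy
  rw [List.mem_range] at ha hb
  have : ((2 * a : ℕ) : ZMod (2 * k)) = ((2 * b + 1 : ℕ) : ZMod (2 * k)) := by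
    push_cast; linear_combination h1 - h2
  have := natCast_inj_of_lt (by omega) (by omega) this
  omega

theorem mem_evenSteps (j i : ZMod (2 * k)) (hk : 0 < k) :
    i ∈ evenSteps j k ++ evenSteps (j + 1) k := by
  obtain ⟨t, ht, h | h⟩ := exists_half i j hk
  · exact List.mem_append_left _ (List.mem_map.2 ⟨t, List.mem_range.2 ht, h.symm⟩)
  · exact List.mem_append_right _ (List.mem_map.2 ⟨t, List.mem_range.2 ht, h.symm⟩)

theorem evenSteps_map_tail (j : ZMod (2 * k)) (hk : 0 < k) :
    (j :: (evenSteps j k).tail).map (fun i => i + 1 + 1) = (evenSteps j k).tail ++ [j] := by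
  rw [← evenSteps_eq_cons j hk, evenSteps_map j hk]
  · conv_lhs => rw [evenSteps_eq_cons j hk]
    simp
  · have : ((2 * k : ℕ) : ZMod (2 * k)) = 0 := ZMod.natCast_self _
    push_cast at this
    exact this

/-- The positions `α` and `β` of the edges of a pair in the two cycles of an even bipyramid, counted
from the edges `j - 1` and `j`. -/
def HasPositions (j i : ZMod (2 * k)) (α β : ℕ) : Prop :=
  α < k ∧ β < k ∧
    ((β = α ∧ i - 1 = j - 1 + 2 * (α : ZMod (2 * k)) ∧ i = j - 1 + 1 + 2 * (β : ZMod (2 * k))) ∨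
    (β + 1 = α ∧ i = j - 1 + 2 * (α : ZMod (2 * k)) ∧
      i - 1 = j - 1 + 1 + 2 * (β : ZMod (2 * k))))

theorem exists_hasPositions (j i : ZMod (2 * k)) (hk : 0 < k) (h1 : i ≠ j - 1) :
    ∃ α β, HasPositions j i α β := by
  obtain ⟨t, ht, h | h⟩ := exists_half i (j - 1) hk
  · have h0 : t ≠ 0 := by rintro rfl; exact h1 (by simpa using h)
    refine ⟨t, t - 1, ht, by omega, Or.inr ⟨by omega, h, ?_⟩⟩
    rw [Nat.cast_sub (by omega), h]
    push_cast
    ring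
  · exact ⟨t, t, ht, ht, Or.inl ⟨rfl, by linear_combination h, h⟩⟩

/-- Two pairs without a common edge occur in the same order in both cycles. -/
theorem HasPositions.lt_or_lt {j i i' : ZMod (2 * k)} {α β α' β' : ℕ}
    (h : HasPositions j i α β) (h' : HasPositions j i' α' β')
    (h1 : i ≠ i') (h2 : i ≠ i' - 1) (h3 : i - 1 ≠ i') :
    (α < α' ∧ β < β') ∨ (α' < α ∧ β' < β) := by
  obtain ⟨-, -, ⟨e0, e1, e2⟩ | ⟨e0, e1, e2⟩⟩ := h <;>
    obtain ⟨-, -, ⟨f0, f1, f2⟩ | ⟨f0, f1, f2⟩⟩ := h'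
  · have : α ≠ α' := by rintro rfl; subst e0 f0; exact h1 (e2.trans f2.symm)
    omega
  · have : α ≠ α' := by rintro rfl; exact h3 (e1.trans f1.symm)
    have : β ≠ β' := by rintro rfl; exact h2 (e2.trans f2.symm)
    omega
  · have : α ≠ α' := by rintro rfl; exact h2 (e1.trans f1.symm)
    have : β ≠ β' := by rintro rfl; exact h3 (e2.trans f2.symm)
    omega
  · have : α ≠ α' := by
      rintro rfl; exact h1 (e1.trans f1.symm)
    omega

end Even

/-- The description by darts of the bipyramid with the base vertices `B i` and the apexes `b a`. -/
def bipyramidComplex {W : Type*} [DecidableEq W] {n : ℕ} (hn : 3 ≤ n) {B : ZMod n → W}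
    {b : Bool → W} (hB : Function.Injective B) (hb : Function.Injective b)
    (hBb : ∀ i a, B i ≠ b a) {Γ : Set (Finset W)}
    (hΓ : ∀ F, F ∈ Γ ↔ ∃ i a, F = {B i, B (i + 1), b a}) : MirrorComplex Γ (ZMod n) where
  S := Equiv.addRight 1
  σ := Equiv.refl _
  V i _ := B i
  A _ a := b a
  mem_faces F := by simp [hΓ]
  A_S _ _ := rfl
  side_eq _ _ _ _ h := hb h
  inj _ _ _ h _ := hB h
  V_ne_A _ _ _ _ := hBb _ _
  S_ne i h := by
    have : Fact (1 < n) := ⟨by omega⟩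
    simp at h
  SS_ne i h := by
    have h2 : ((2 : ℕ) : ZMod n) = ((0 : ℕ) : ZMod n) := by
      simp only [Equiv.coe_addRight] at h
      push_cast
      linear_combination h
    have := natCast_inj_of_lt (by omega) (by omega) h2
    omega
  V_σ _ _ := rfl
  V_Sσ _ _ := rfl
  edge_eq i a i' a' h := by
    have hii : i' = i := by
      have h1 : B i ∈ ({B i', B (i' + 1)} : Finset W) := by
        have : B i ∈ ({B i, B (i + 1)} : Finset W) := by simp
        rwa [show ({B i, B (i + 1)} : Finset W) = {B i', B (i' + 1)} from h] at this
      have h2 : B (i + 1) ∈ ({B i', B (i' + 1)} : Finset W) := by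
        have : B (i + 1) ∈ ({B i, B (i + 1)} : Finset W) := by simp
        rwa [show ({B i, B (i + 1)} : Finset W) = {B i', B (i' + 1)} from h] at this
      simp only [Finset.mem_insert, Finset.mem_singleton, hB.eq_iff] at h1 h2
      rcases h1 with h1 | h1
      · exact h1.symm
      rcases h2 with h2 | h2
      · exfalso
        have h2 : ((2 : ℕ) : ZMod n) = ((0 : ℕ) : ZMod n) := by
          push_cast
          linear_combination h2 - h1
        have := natCast_inj_of_lt (by omega) (by omega) h2
        omega
      · exact (add_right_cancel h2).symm
    subst hii
    by_cases ha : a' = a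
    · exact Or.inl ⟨rfl, ha⟩
    · exact Or.inr ⟨rfl, Bool.eq_not_of_ne ha⟩

theorem bipyramidComplex_isFree {W : Type*} [DecidableEq W] {n : ℕ} (hn : 3 ≤ n) {B : ZMod n → W}
    {b : Bool → W} (hB : Function.Injective B) (hb : Function.Injective b)
    (hBb : ∀ i a, B i ≠ b a) {Γ : Set (Finset W)}
    (hΓ : ∀ F, F ∈ Γ ↔ ∃ i a, F = {B i, B (i + 1), b a}) (i : ZMod n) :
    (bipyramidComplex hn hB hb hBb hΓ).IsFree i :=
  ⟨fun _ => rfl, fun _ => rfl, fun _ => rfl, fun _ _ h => hB h⟩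

/-- The cycle of base edges after gluing a bipyramid with an even base: the two cycles of the
bipyramid are inserted at the two edges of the path. -/
theorem Gluable.exists_cycleList {W : Type*} [DecidableEq W] {Γ Γ' : Set (Finset W)} {E : Type*}
    [DecidableEq E] {k : ℕ} (hk : 0 < k) {M : MirrorComplex Γ E}
    {M' : MirrorComplex Γ' (ZMod (2 * k))} (hS : ∀ i, M'.S i = i + 1) (hσ : ∀ i, M'.σ i = i)
    {m : E} {j : ZMod (2 * k)} {s s' : Slit W}
    {δ : Bool} (h : Gluable M M' m j s s' δ) {L : List E} (hL : IsCycleList M.next L)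
    (hodd : Odd L.length) :
    ∃ N, IsCycleList h.glued.next N ∧ Odd N.length ∧
      (∀ c d t u, Crosses L c d t u →
        Crosses N (Sum.inl c) (Sum.inl d) (Sum.inl t) (Sum.inl u)) ∧
      (∀ t u, Crosses L (M.S.symm m) m t u → ∀ i, i ≠ j → i ≠ j - 1 → i - 1 ≠ j →
        Crosses N (Sum.inl t) (Sum.inl u) (Sum.inr (i - 1)) (Sum.inr i)) ∧
      ∀ i i', i ≠ j → i ≠ j - 1 → i - 1 ≠ j → i' ≠ j → i' ≠ j - 1 → i' - 1 ≠ j →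
        i ≠ i' → i ≠ i' - 1 → i - 1 ≠ i' →
        Crosses N (Sum.inr (i - 1)) (Sum.inr i) (Sum.inr (i' - 1)) (Sum.inr i') := by
  have hsymm : M'.S.symm j = j - 1 := by rw [Equiv.symm_apply_eq, hS]; ring
  have hnext : (M'.next : ZMod (2 * k) → ZMod (2 * k)) = fun i => i + 1 + 1 := by
    funext i
    rw [MirrorComplex.next_apply, hS, hS, hσ]
  obtain ⟨X, Y, hXY⟩ := exists_rotation_cons (hL.mem (M.S.symm m)) (hL.mem m)
    (MirrorComplex.S_symm_ne m)
  have hL' := hL.isRotated hXY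
  have c1 := evenSteps_eq_cons (j - 1) hk
  have c2 := evenSteps_eq_cons (j - 1 + 1) hk
  have hj : j - 1 + 1 = j := by ring
  -- The cycle `j - 1, j + 1, …` is inserted before `S⁻¹ m`, the cycle `j, j + 2, …` before `m`.
  have hN := hL'.join (f' := M'.next) (j := j - 1) (k := j - 1 + 1)
    (P := (evenSteps (j - 1) k).tail) (Q := (evenSteps (j - 1 + 1) k).tail)
    (by rw [hnext]; exact evenSteps_map_tail _ hk) (by rw [hnext]; exact evenSteps_map_tail _ hk)
    (by rw [← c1, ← c2]; exact evenSteps_nodup _)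
    (by rw [← c1, ← c2]; exact fun i => mem_evenSteps _ i hk)
  rw [← c1, ← c2] at hN
  set N := (evenSteps (j - 1) k).map Sum.inr ++ (M.S.symm m :: X).map Sum.inl ++
    (evenSteps (j - 1 + 1) k).map Sum.inr ++ (m :: Y).map Sum.inl with hNdef
  have hsub : ((M.S.symm m :: (X ++ m :: Y)).map (Sum.inl (β := ZMod (2 * k)))).Sublist N := by
    have : (M.S.symm m :: (X ++ m :: Y)).map (Sum.inl (β := ZMod (2 * k))) =
        [] ++ (M.S.symm m :: X).map Sum.inl ++ [] ++ (m :: Y).map Sum.inl := by simp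
    rw [this]
    exact (((List.nil_sublist _).append (List.Sublist.refl _)).append
      (List.nil_sublist _)).append (List.Sublist.refl _)
  have step : ∀ α, α < k → ∀ i : ZMod (2 * k), (evenSteps i k)[α]? =
      some (i + 2 * (α : ZMod (2 * k))) := by
    intro α hα i
    simp [evenSteps, hα]
  have single : ∀ α, α < k → ∀ i : ZMod (2 * k),
      [i + 2 * (α : ZMod (2 * k))].Sublist (evenSteps i k) := by
    intro α hα i
    rw [List.singleton_sublist]
    exact List.mem_of_getElem? (step α hα i)
  have double : ∀ α β, α < β → β < k → ∀ i : ZMod (2 * k),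
      [i + 2 * (α : ZMod (2 * k)), i + 2 * (β : ZMod (2 * k))].Sublist (evenSteps i k) := by
    intro α β hαβ hβ i
    have : [α, β].Sublist (List.range k) :=
      sublist_range_of_pairwise (by simp [hαβ]) (by simp; omega)
    exact this.map fun t : ℕ => i + 2 * (t : ZMod (2 * k))
  refine ⟨N, ?_, ?_, ?_, ?_, ?_⟩
  · convert hN using 1
    funext x
    rw [h.glued_next, hsymm, hj]
  · have hlen : (M.S.symm m :: (X ++ m :: Y)).length = L.length := hXY.perm.length_eq
    have : N.length = L.length + 2 * k := by
      rw [← hlen, hNdef]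
      simp [evenSteps]
      ring
    rw [this]
    exact hodd.add_even (even_two_mul k)
  · intro c d t u hc
    obtain ⟨K, h1, h2⟩ := hc
    exact Crosses.map_sublist ⟨K, h1.trans hXY.symm, h2⟩ Sum.inl hsub
  · intro t u hc i h1 h2 h3
    obtain ⟨α, β, hα, hβ, hpos⟩ := exists_hasPositions j i hk h2
    have harcs : (t ∈ X ∧ u ∈ Y) ∨ (u ∈ X ∧ t ∈ Y) :=
      Crosses.mem_arcs hL'.nodup (hc.isRotated hXY.symm)
    -- One edge of the new pair is in the first inserted cycle, the other one in the second.
    have main : ∀ t u, t ∈ X → u ∈ Y → Crosses N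
        (Sum.inr (j - 1 + 2 * (α : ZMod (2 * k)))) (Sum.inr (j - 1 + 1 + 2 * (β : ZMod (2 * k))))
        (Sum.inl t) (Sum.inl u) := by
      intro t u ht hu
      have a1 : [t].Sublist (M.S.symm m :: X) :=
        List.singleton_sublist.2 (List.mem_cons_of_mem _ ht)
      have a2 : [u].Sublist (m :: Y) := List.singleton_sublist.2 (List.mem_cons_of_mem _ hu)
      exact ⟨N, List.IsRotated.refl _, Or.inl (((((single α hα _).map Sum.inr).append
        (a1.map Sum.inl)).append ((single β hβ _).map Sum.inr)).append (a2.map Sum.inl))⟩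
    have main' : Crosses N
        (Sum.inr (j - 1 + 2 * (α : ZMod (2 * k)))) (Sum.inr (j - 1 + 1 + 2 * (β : ZMod (2 * k))))
        (Sum.inl t) (Sum.inl u) := by
      rcases harcs with ⟨ht, hu⟩ | ⟨hu, ht⟩
      · exact main t u ht hu
      · exact (main u t hu ht).swap_right
    rcases hpos with ⟨-, e1, e2⟩ | ⟨-, e1, e2⟩
    · rw [e1, e2]; exact main'.symm
    · rw [e2, e1]; exact main'.swap_left.symm
  · intro i i' h1 h2 h3 h1' h2' h3' g1 g2 g3
    obtain ⟨α, β, hp⟩ := exists_hasPositions j i hk h2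
    obtain ⟨α', β', hp'⟩ := exists_hasPositions j i' hk h2'
    have hlt := hp.lt_or_lt hp' g1 g2 g3
    obtain ⟨hα, hβ, hpos⟩ := hp
    obtain ⟨hα', hβ', hpos'⟩ := hp'
    have main : ∀ α β α' β', α < α' → β < β' → α' < k → β' < k → Crosses N
        (Sum.inr (j - 1 + 2 * (α : ZMod (2 * k)))) (Sum.inr (j - 1 + 1 + 2 * (β : ZMod (2 * k))))
        (Sum.inr (j - 1 + 2 * (α' : ZMod (2 * k))))
        (Sum.inr (j - 1 + 1 + 2 * (β' : ZMod (2 * k)))) := by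
      intro α β α' β' u1 u2 u3 u4
      exact ⟨N, List.IsRotated.refl _, Or.inl (((((double α α' u1 u3 _).map Sum.inr).append
        (List.nil_sublist _)).append ((double β β' u2 u4 _).map Sum.inr)).append
        (List.nil_sublist _))⟩
    have main' : Crosses N
        (Sum.inr (j - 1 + 2 * (α : ZMod (2 * k)))) (Sum.inr (j - 1 + 1 + 2 * (β : ZMod (2 * k))))
        (Sum.inr (j - 1 + 2 * (α' : ZMod (2 * k))))
        (Sum.inr (j - 1 + 1 + 2 * (β' : ZMod (2 * k)))) := by
      rcases hlt with ⟨u1, u2⟩ | ⟨u1, u2⟩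
      · exact main _ _ _ _ u1 u2 hα' hβ'
      · exact (main _ _ _ _ u1 u2 hα hβ).symm
    rcases hpos with ⟨-, e1, e2⟩ | ⟨-, e1, e2⟩ <;> rcases hpos' with ⟨-, f1, f2⟩ | ⟨-, f1, f2⟩
    · rw [e1, e2, f1, f2]; exact main'
    · rw [e1, e2, f2, f1]; exact main'.swap_right
    · rw [e2, e1, f1, f2]; exact main'.swap_left
    · rw [e2, e1, f2, f1]; exact main'.swap_left.swap_right

end Bipyramids

/-! ### Subdivision of an edge -/

section Topology

variable {W : Type*} [DecidableEq W]

/-- Subdividing the edge `p q` by a new vertex `w` does not change the realization: a point with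
coordinate `c` at `w` is the point with `c / 2` added to the coordinates at `p` and `q`; conversely
the coordinate at `w` is twice the smaller one of the coordinates at `p` and `q`. -/
theorem nonempty_homeomorph_subdivision {R : Set (Finset W)} {p q w c d : W}
    (hpq : p ≠ q) (hwp : w ≠ p) (hwq : w ≠ q) (hwc : w ≠ c) (hwd : w ≠ d)
    (hpc : p ≠ c) (hpd : p ≠ d) (hqc : q ≠ c) (hqd : q ≠ d)
    (hR : ∀ F ∈ R, ¬ (p ∈ F ∧ q ∈ F)) (hw : ∀ F ∈ R, w ∉ F) :
    Nonempty (realization (R ∪ {{p, q, c}, {p, q, d}}) ≃ₜ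
      realization (R ∪ {{p, w, c}, {w, q, c}, {p, w, d}, {w, q, d}})) := by
  let up : (W → ℝ) → W → ℝ := fun f x =>
    if x = w then 2 * min (f p) (f q) else if x = p ∨ x = q then f x - min (f p) (f q) else f x
  let dn : (W → ℝ) → W → ℝ := fun f x =>
    if x = w then 0 else if x = p ∨ x = q then f x + f w / 2 else f x
  have cto : Continuous up := by
    refine continuous_pi fun x => ?_
    by_cases h1 : x = w
    · simp only [up, h1, if_true]; fun_prop
    by_cases h2 : x = p ∨ x = q
    · simp only [up, h1, h2, if_true, if_false]; fun_prop
    · simp only [up, h1, h2, if_false]; fun_prop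
  have cfro : Continuous dn := by
    refine continuous_pi fun x => ?_
    by_cases h1 : x = w
    · simp only [dn, h1, if_true]; fun_prop
    by_cases h2 : x = p ∨ x = q
    · simp only [dn, h1, h2, if_true, if_false]; fun_prop
    · simp only [dn, h1, h2, if_false]; fun_prop
  have sum3 : ∀ (x y z : W) (f : W → ℝ), x ≠ y → x ≠ z → y ≠ z →
      ∑ v ∈ ({x, y, z} : Finset W), f v = f x + f y + f z := by
    intro x y z f h1 h2 h3
    rw [Finset.sum_insert (by simp [h1, h2]), Finset.sum_pair h3, add_assoc]
  -- A point of a face not containing both `p` and `q` is not moved.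
  have hRmin : ∀ f : W → ℝ, (∀ x, 0 ≤ f x) → ∀ F ∈ R, (∀ x, x ∉ F → f x = 0) →
      min (f p) (f q) = 0 := by
    intro f h0 F hF hz
    rcases not_and_or.1 (hR F hF) with h | h
    · rw [hz p h]; exact min_eq_left (h0 q)
    · rw [hz q h]; exact min_eq_right (h0 p)
  have hRup : ∀ f : W → ℝ, min (f p) (f q) = 0 → f w = 0 → up f = f := by
    intro f hm hf
    funext x
    simp only [up, hm]
    split_ifs with h1
    · rw [h1, hf]; simp
    · simp
    · rfl
  have hRdn : ∀ f : W → ℝ, f w = 0 → dn f = f := by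
    intro f hf
    funext x
    simp only [dn, hf]
    split_ifs with h1
    · rw [h1, hf]
    · simp
    · rfl
  have mto : ∀ f ∈ realization (R ∪ {{p, q, c}, {p, q, d}}),
      up f ∈ realization (R ∪ {{p, w, c}, {w, q, c}, {p, w, d}, {w, q, d}}) ∧ f w = 0 := by
    rintro f ⟨h0, F, hF, hz, hs⟩
    rcases hF with hF | hF
    · have hfw := hz w (hw F hF)
      rw [hRup f (hRmin f h0 F hF hz) hfw]
      exact ⟨⟨h0, F, Or.inl hF, hz, hs⟩, hfw⟩
    · obtain ⟨e, he, rfl⟩ : ∃ e, (e = c ∨ e = d) ∧ F = {p, q, e} := by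
        rcases hF with rfl | rfl
        · exact ⟨c, Or.inl rfl, rfl⟩
        · exact ⟨d, Or.inr rfl, rfl⟩
      have hwe : w ≠ e := by rcases he with rfl | rfl <;> assumption
      have hpe : p ≠ e := by rcases he with rfl | rfl <;> assumption
      have hqe : q ≠ e := by rcases he with rfl | rfl <;> assumption
      have hfw : f w = 0 := hz w (by simp [hwp, hwq, hwe])
      rw [sum3 _ _ _ _ hpq hpe hqe] at hs
      have hnn : ∀ x, 0 ≤ up f x := by
        intro x
        simp only [up]
        split_ifs with h1 h2
        · have := le_min (h0 p) (h0 q); linarith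
        · rcases h2 with rfl | rfl
          · linarith [min_le_left (f x) (f q)]
          · linarith [min_le_right (f p) (f x)]
        · exact h0 x
      have tw : up f w = 2 * min (f p) (f q) := by simp [up]
      have tp : up f p = f p - min (f p) (f q) := by simp [up, hwp.symm]
      have tq : up f q = f q - min (f p) (f q) := by simp [up, hwq.symm]
      have te : up f e = f e := by simp [up, hwe.symm, hpe.symm, hqe.symm]
      refine ⟨⟨hnn, ?_⟩, hfw⟩
      rcases le_total (f p) (f q) with h | h
      · rw [min_eq_left h] at *
        refine ⟨{w, q, e}, ?_, fun x hx => ?_, ?_⟩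
        · rcases he with rfl | rfl <;> simp
        · simp only [Finset.mem_insert, Finset.mem_singleton, not_or] at hx
          by_cases hxp : x = p
          · rw [hxp, tp, sub_self]
          · simp only [up, hx, hxp, if_false, or_self]
            exact hz x (by simp [hx, hxp])
        · rw [sum3 _ _ _ _ hwq hwe hqe, tw, tq, te]; linarith
      · rw [min_eq_right h] at *
        refine ⟨{p, w, e}, ?_, fun x hx => ?_, ?_⟩
        · rcases he with rfl | rfl <;> simp
        · simp only [Finset.mem_insert, Finset.mem_singleton, not_or] at hx
          by_cases hxq : x = q
          · rw [hxq, tq, sub_self]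
          · simp only [up, hx, hxq, if_false, or_self]
            exact hz x (by simp [hx, hxq])
        · rw [sum3 _ _ _ _ hwp.symm hpe hwe, tw, tp, te]; linarith
  have mfro : ∀ f ∈ realization (R ∪ {{p, w, c}, {w, q, c}, {p, w, d}, {w, q, d}}),
      dn f ∈ realization (R ∪ {{p, q, c}, {p, q, d}}) ∧ min (f p) (f q) = 0 := by
    rintro f ⟨h0, F, hF, hz, hs⟩
    rcases hF with hF | hF
    · have hfw := hz w (hw F hF)
      rw [hRdn f hfw]
      exact ⟨⟨h0, F, Or.inl hF, hz, hs⟩, hRmin f h0 F hF hz⟩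
    · obtain ⟨e, he, hFe⟩ : ∃ e, (e = c ∨ e = d) ∧ (F = {p, w, e} ∨ F = {w, q, e}) := by
        rcases hF with rfl | rfl | rfl | rfl
        · exact ⟨c, Or.inl rfl, Or.inl rfl⟩
        · exact ⟨c, Or.inl rfl, Or.inr rfl⟩
        · exact ⟨d, Or.inr rfl, Or.inl rfl⟩
        · exact ⟨d, Or.inr rfl, Or.inr rfl⟩
      have hwe : w ≠ e := by rcases he with rfl | rfl <;> assumption
      have hpe : p ≠ e := by rcases he with rfl | rfl <;> assumption
      have hqe : q ≠ e := by rcases he with rfl | rfl <;> assumption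
      have hnn : ∀ x, 0 ≤ dn f x := by
        intro x
        simp only [dn]
        split_ifs with h1 h2
        · exact le_rfl
        · linarith [h0 x, h0 w]
        · exact h0 x
      have tp : dn f p = f p + f w / 2 := by simp [dn, hwp.symm]
      have tq : dn f q = f q + f w / 2 := by simp [dn, hwq.symm]
      have te : dn f e = f e := by simp [dn, hwe.symm, hpe.symm, hqe.symm]
      have hFz : ∀ x, x ≠ p → x ≠ q → x ≠ w → x ≠ e → f x = 0 := by
        intro x h1 h2 h3 h4
        apply hz
        rcases hFe with rfl | rfl <;> simp [h1, h2, h3, h4]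
      refine ⟨⟨hnn, {p, q, e}, ?_, fun x hx => ?_, ?_⟩, ?_⟩
      · rcases he with rfl | rfl <;> simp
      · simp only [Finset.mem_insert, Finset.mem_singleton, not_or] at hx
        by_cases hxw : x = w
        · simp [dn, hxw]
        · simp only [dn, hx, hxw, if_false, or_self]
          exact hFz x hx.1 hx.2.1 hxw hx.2.2
      · rw [sum3 _ _ _ _ hpq hpe hqe, tp, tq, te]
        rcases hFe with rfl | rfl
        · rw [sum3 _ _ _ _ hwp.symm hpe hwe] at hs
          have := hz q (by simp [hpq.symm, hwq.symm, hqe])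
          linarith
        · rw [sum3 _ _ _ _ hwq hwe hqe] at hs
          have := hz p (by simp [hpq, hwp.symm, hpe])
          linarith
      · rcases hFe with rfl | rfl
        · rw [hz q (by simp [hpq.symm, hwq.symm, hqe])]; exact min_eq_right (h0 p)
        · rw [hz p (by simp [hpq, hwp.symm, hpe])]; exact min_eq_left (h0 q)
  refine ⟨⟨⟨fun f => ⟨up f, (mto f f.2).1⟩, fun f => ⟨dn f, (mfro f f.2).1⟩, ?_, ?_⟩, ?_, ?_⟩⟩
  · rintro ⟨f, hf⟩
    have hfw := (mto f hf).2
    apply Subtype.ext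
    funext x
    simp only [up, dn]
    split_ifs with h1 h2 <;> simp_all
  · rintro ⟨f, hf⟩
    have hm := (mfro f hf).2
    have hmm : min (dn f p) (dn f q) = f w / 2 := by
      simp only [dn, hwp.symm, hwq.symm, if_false, true_or, or_true, if_true]
      rw [min_add_add_right, hm, zero_add]
    apply Subtype.ext
    funext x
    simp only [up, hmm]
    split_ifs with h1 h2
    · rw [h1]; ring
    · simp only [dn, h1, h2, if_true, if_false]; ring
    · simp only [dn, h1, h2, if_false]
  · exact (cto.comp continuous_subtype_val).subtype_mk _
  · exact (cfro.comp continuous_subtype_val).subtype_mk _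

end Topology

/-! ### Repeated subdivisions and the octahedron -/

section Topology

variable {W : Type*} [DecidableEq W]

/-- The faces `{w i, w (i + 1), c}` and `{w i, w (i + 1), d}` for `i < m`. -/
def fanFaces (w : ℕ → W) (c d : W) (m : ℕ) : Set (Finset W) :=
  {F | ∃ i < m, F = {w i, w (i + 1), c} ∨ F = {w i, w (i + 1), d}}

/-- Subdividing the edge from `w 0` to `y` into the path `w 0, …, w m, y` does not change the
realization. -/
theorem nonempty_homeomorph_fan {R : Set (Finset W)} {w : ℕ → W} {y c d : W} {N : ℕ}
    (hw : ∀ i ≤ N, ∀ j ≤ N, w i = w j → i = j) (hwy : ∀ i ≤ N, w i ≠ y)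
    (hwc : ∀ i ≤ N, w i ≠ c) (hwd : ∀ i ≤ N, w i ≠ d) (hyc : y ≠ c) (hyd : y ≠ d)
    (hR : ∀ F ∈ R, ¬ (w 0 ∈ F ∧ y ∈ F)) (hRw : ∀ F ∈ R, ∀ i < N, w (i + 1) ∉ F)
    (m : ℕ) (hm : m ≤ N) :
    Nonempty (realization (R ∪ {{w 0, y, c}, {w 0, y, d}}) ≃ₜ
      realization (R ∪ fanFaces w c d m ∪ {{w m, y, c}, {w m, y, d}})) := by
  induction m with
  | zero =>
    have : fanFaces w c d 0 = ∅ := by ext F; simp [fanFaces]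
    rw [this, Set.union_empty]
    exact ⟨Homeomorph.refl _⟩
  | succ m ih =>
    obtain ⟨f⟩ := ih (by omega)
    obtain ⟨g⟩ := nonempty_homeomorph_subdivision (R := R ∪ fanFaces w c d m) (p := w m) (q := y)
      (w := w (m + 1)) (c := c) (d := d) (hwy m (by omega))
      (fun h => by have := hw _ hm _ (by omega) h; omega) (hwy _ hm) (hwc _ hm) (hwd _ hm)
      (hwc m (by omega)) (hwd m (by omega)) hyc hyd
      (by
        rintro F (hF | ⟨i, hi, hF⟩) ⟨h1, h2⟩
        · rcases Nat.eq_zero_or_pos m with rfl | hpos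
          · exact hR F hF ⟨h1, h2⟩
          · obtain ⟨k, rfl⟩ : ∃ k, m = k + 1 := ⟨m - 1, by omega⟩
            exact hRw F hF k (by omega) h1
        · rcases hF with rfl | rfl <;>
            simp [(hwy i (by omega)).symm, (hwy (i + 1) (by omega)).symm, hyc, hyd] at h2)
      (by
        rintro F (hF | ⟨i, hi, hF⟩) h1
        · exact hRw F hF m (by omega) h1
        · have n1 : w (m + 1) ≠ w i := fun h => by have := hw _ hm _ (by omega) h; omega
          have n2 : w (m + 1) ≠ w (i + 1) := fun h => by have := hw _ hm _ (by omega) h; omega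
          rcases hF with rfl | rfl <;> simp [n1, n2, hwc _ hm, hwd _ hm] at h1)
    refine ⟨(f.trans g).trans (Homeomorph.setCongr ?_)⟩
    congr 1
    ext F
    simp only [Set.mem_union, fanFaces, Set.mem_ofPred_eq, Set.mem_insert_iff,
      Set.mem_singleton_iff, Nat.lt_succ_iff_lt_or_eq, or_and_right, exists_or,
      exists_eq_left]
    generalize (∃ i < m, F = {w i, w (i + 1), c} ∨ F = {w i, w (i + 1), d}) = P
    tauto

omit [DecidableEq W] in
/-- The realization does not depend on the set from which the vertices are taken. -/
theorem nonempty_homeomorph_image {W' : Type*} [DecidableEq W'] (Γ : Set (Finset W)) {f : W → W'}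
    (hf : Function.Injective f) :
    Nonempty (realization Γ ≃ₜ realization (Finset.image f '' Γ)) := by
  have hext : ∀ (g : W → ℝ) x, Function.extend f g 0 (f x) = g x := fun g x =>
    hf.extend_apply g 0 x
  have h1 : ∀ g ∈ realization Γ, Function.extend f g 0 ∈ realization (Finset.image f '' Γ) := by
    rintro g ⟨h0, F, hF, hz, hs⟩
    refine ⟨fun x => ?_, _, ⟨F, hF, rfl⟩, fun x hx => ?_, ?_⟩
    · by_cases hx : ∃ y, f y = x
      · obtain ⟨y, rfl⟩ := hx
        rw [hext]; exact h0 y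
      · rw [Function.extend_apply' _ _ _ hx]; rfl
    · by_cases hx' : ∃ y, f y = x
      · obtain ⟨y, rfl⟩ := hx'
        rw [hext]
        exact hz y fun hy => hx (Finset.mem_image_of_mem f hy)
      · rw [Function.extend_apply' _ _ _ hx']; rfl
    · rw [Finset.sum_image fun x _ y _ h => hf h]
      simpa only [hext] using hs
  have h2 : ∀ g ∈ realization (Finset.image f '' Γ),
      g ∘ f ∈ realization Γ ∧ ∀ x, (¬ ∃ y, f y = x) → g x = 0 := by
    rintro g ⟨h0, _, ⟨F, hF, rfl⟩, hz, hs⟩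
    refine ⟨⟨fun x => h0 _, F, hF, fun x hx => hz _ fun hx' => ?_, ?_⟩, fun x hx => hz _ ?_⟩
    · obtain ⟨y, hy, hyx⟩ := Finset.mem_image.1 hx'
      exact hx (hf hyx ▸ hy)
    · rw [Finset.sum_image fun x _ y _ h => hf h] at hs
      exact hs
    · intro hx'
      obtain ⟨y, hy, hyx⟩ := Finset.mem_image.1 hx'
      exact hx ⟨y, hyx⟩
  refine ⟨⟨⟨fun g => ⟨_, h1 g g.2⟩, fun g => ⟨_, (h2 g g.2).1⟩, ?_, ?_⟩, ?_, ?_⟩⟩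
  · rintro ⟨g, hg⟩
    exact Subtype.ext (funext fun x => hext g x)
  · rintro ⟨g, hg⟩
    apply Subtype.ext
    funext x
    by_cases hx : ∃ y, f y = x
    · obtain ⟨y, rfl⟩ := hx
      exact hext _ y
    · exact (Function.extend_apply' _ _ _ hx).trans ((h2 g hg).2 x hx).symm
  · refine Continuous.subtype_mk (continuous_pi fun x => ?_) _
    by_cases hx : ∃ y, f y = x
    · obtain ⟨y, rfl⟩ := hx
      simp only [hext]
      exact (continuous_apply y).comp continuous_subtype_val
    · simp only [Function.extend_apply' _ _ _ hx]
      exact continuous_const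
  · refine Continuous.subtype_mk (continuous_pi fun x => ?_) _
    exact (continuous_apply (f x)).comp continuous_subtype_val

/-- In a point of the octahedron one of two opposite vertices has the coordinate zero. -/
theorem octahedron_coordinates {x x' y y' z z' : W} (hn : [x, x', y, y', z, z'].Nodup) (f : W → ℝ)
    (hf : f ∈ realization {F | ∃ a b c, (a = x ∨ a = x') ∧ (b = y ∨ b = y') ∧
      (c = z ∨ c = z') ∧ F = {a, b, c}}) :
    (∀ t, 0 ≤ f t) ∧ (f x = 0 ∨ f x' = 0) ∧ (f y = 0 ∨ f y' = 0) ∧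
      (f z = 0 ∨ f z' = 0) ∧ f x + f x' + (f y + f y') + (f z + f z') = 1 ∧
      ∀ t, t ≠ x → t ≠ x' → t ≠ y → t ≠ y' → t ≠ z → t ≠ z' → f t = 0 := by
  simp only [List.nodup_cons, List.mem_cons, not_or, List.not_mem_nil, not_false_eq_true,
    and_true, List.nodup_nil] at hn
  obtain ⟨⟨n1, n2, n3, n4, n5⟩, ⟨n6, n7, n8, n9⟩, ⟨n10, n11, n12⟩, ⟨n13, n14⟩, n15⟩ := hn
  have hab : ∀ a b, (a = x ∨ a = x') → (b = y ∨ b = y') → a ≠ b := by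
    rintro _ _ (rfl | rfl) (rfl | rfl) <;> assumption
  have hac : ∀ a b, (a = x ∨ a = x') → (b = z ∨ b = z') → a ≠ b := by
    rintro _ _ (rfl | rfl) (rfl | rfl) <;> assumption
  have hbc : ∀ a b, (a = y ∨ a = y') → (b = z ∨ b = z') → a ≠ b := by
    rintro _ _ (rfl | rfl) (rfl | rfl) <;> assumption
  obtain ⟨h0, F, ⟨a, b, c, ha, hb, hc, rfl⟩, hz, hs⟩ := hf
  rw [Finset.sum_insert (by simp [hab a b ha hb, hac a c ha hc]),
    Finset.sum_pair (hbc b c hb hc)] at hs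
  have hzero : ∀ t, t ≠ a → t ≠ b → t ≠ c → f t = 0 := fun t h1 h2 h3 => hz t (by simp [h1, h2, h3])
  have kx : f x + f x' = f a ∧ (f x = 0 ∨ f x' = 0) := by
    rcases ha with rfl | rfl
    · have := hzero x' (Ne.symm n1) (hab x' b (Or.inr rfl) hb) (hac x' c (Or.inr rfl) hc)
      simp [this]
    · have := hzero x n1 (hab x b (Or.inl rfl) hb) (hac x c (Or.inl rfl) hc)
      simp [this]
  have ky : f y + f y' = f b ∧ (f y = 0 ∨ f y' = 0) := by
    rcases hb with rfl | rfl
    · have := hzero y' (hab a y' ha (Or.inr rfl)).symm (Ne.symm n10) (hbc y' c (Or.inr rfl) hc)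
      simp [this]
    · have := hzero y (hab a y ha (Or.inl rfl)).symm n10 (hbc y c (Or.inl rfl) hc)
      simp [this]
  have kz : f z + f z' = f c ∧ (f z = 0 ∨ f z' = 0) := by
    rcases hc with rfl | rfl
    · have := hzero z' (hac a z' ha (Or.inr rfl)).symm (hbc b z' hb (Or.inr rfl)).symm (Ne.symm n15)
      simp [this]
    · have := hzero z (hac a z ha (Or.inl rfl)).symm (hbc b z hb (Or.inl rfl)).symm n15
      simp [this]
  refine ⟨h0, kx.2, ky.2, kz.2, by rw [kx.1, ky.1, kz.1]; linarith, ?_⟩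
  intro t t1 t2 t3 t4 t5 t6
  apply hzero
  · rcases ha with rfl | rfl <;> assumption
  · rcases hb with rfl | rfl <;> assumption
  · rcases hc with rfl | rfl <;> assumption

/-- The boundary of the octahedron with the diagonals `x x'`, `y y'`, `z z'` is the unit sphere of
the norm `|a| + |b| + |c|` on three-space, hence a sphere. -/
theorem nonempty_homeomorph_octahedron {x x' y y' z z' : W}
    (hn : [x, x', y, y', z, z'].Nodup) :
    Nonempty (realization {F | ∃ a b c, (a = x ∨ a = x') ∧ (b = y ∨ b = y') ∧
      (c = z ∨ c = z') ∧ F = {a, b, c}} ≃ₜ Metric.sphere (0 : EuclideanSpace ℝ (Fin 3)) 1) := by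
  have hn' := hn
  simp only [List.nodup_cons, List.mem_cons, not_or, List.not_mem_nil, not_false_eq_true,
    and_true, List.nodup_nil] at hn
  obtain ⟨⟨n1, n2, n3, n4, n5⟩, ⟨n6, n7, n8, n9⟩, ⟨n10, n11, n12⟩, ⟨n13, n14⟩, n15⟩ := hn
  set Γ : Set (Finset W) := {F | ∃ a b c, (a = x ∨ a = x') ∧ (b = y ∨ b = y') ∧
      (c = z ∨ c = z') ∧ F = {a, b, c}}
  -- `N` is the norm `|a| + |b| + |c|`, and `r` is the inverse of `g` on its unit sphere, composed
  -- with the radial projection.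
  let g : (W → ℝ) → EuclideanSpace ℝ (Fin 3) := fun f => !₂[f x - f x', f y - f y', f z - f z']
  let N : EuclideanSpace ℝ (Fin 3) → ℝ := fun v => |v 0| + |v 1| + |v 2|
  let r : EuclideanSpace ℝ (Fin 3) → W → ℝ := fun v t =>
    if t = x then max (v 0 / N v) 0 else if t = x' then max (-(v 0 / N v)) 0 else
    if t = y then max (v 1 / N v) 0 else if t = y' then max (-(v 1 / N v)) 0 else
    if t = z then max (v 2 / N v) 0 else if t = z' then max (-(v 2 / N v)) 0 else 0
  have rx : ∀ v, r v x = max (v 0 / N v) 0 := fun v => by simp [r]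
  have rx' : ∀ v, r v x' = max (-(v 0 / N v)) 0 := fun v => by simp [r, Ne.symm n1]
  have ry : ∀ v, r v y = max (v 1 / N v) 0 := fun v => by simp [r, Ne.symm n2, Ne.symm n6]
  have ry' : ∀ v, r v y' = max (-(v 1 / N v)) 0 := fun v => by
    simp [r, Ne.symm n3, Ne.symm n7, Ne.symm n10]
  have rz : ∀ v, r v z = max (v 2 / N v) 0 := fun v => by
    simp [r, Ne.symm n4, Ne.symm n8, Ne.symm n11, Ne.symm n13]
  have rz' : ∀ v, r v z' = max (-(v 2 / N v)) 0 := fun v => by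
    simp [r, Ne.symm n5, Ne.symm n9, Ne.symm n12, Ne.symm n14, Ne.symm n15]
  have hf := octahedron_coordinates hn'
  have habs : ∀ a b : ℝ, 0 ≤ a → 0 ≤ b → (a = 0 ∨ b = 0) → |a - b| = a + b := by
    rintro a b ha hb (rfl | rfl)
    · simp [abs_of_nonneg hb]
    · simp [abs_of_nonneg ha]
  have hNg : ∀ f ∈ realization Γ, N (g f) = 1 := by
    intro f h
    obtain ⟨h0, hx, hy, hz, hs, -⟩ := hf f h
    simp only [N, g, Matrix.cons_val]
    rw [habs _ _ (h0 _) (h0 _) hx, habs _ _ (h0 _) (h0 _) hy, habs _ _ (h0 _) (h0 _) hz, hs]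
  have hN0 : ∀ v, N v = 0 → v = 0 := by
    intro v hv
    have a0 := abs_nonneg (v 0)
    have a1 := abs_nonneg (v 1)
    have a2 := abs_nonneg (v 2)
    have hv' : |v 0| + |v 1| + |v 2| = 0 := hv
    ext i
    fin_cases i
    · exact abs_eq_zero.1 (show |v 0| = 0 by linarith)
    · exact abs_eq_zero.1 (show |v 1| = 0 by linarith)
    · exact abs_eq_zero.1 (show |v 2| = 0 by linarith)
  have hNsmul : ∀ (t : ℝ) v, 0 ≤ t → N (t • v) = t * N v := by
    intro t v ht
    simp only [N, PiLp.smul_apply, smul_eq_mul, abs_mul, abs_of_nonneg ht]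
    ring
  have hNpos : ∀ v, v ≠ 0 → 0 < N v := fun v hv =>
    lt_of_le_of_ne (by positivity) fun h => hv (hN0 v h.symm)
  have hg0 : ∀ f ∈ realization Γ, g f ≠ 0 := by
    intro f h h0
    have := hNg f h
    rw [h0] at this
    simp [N] at this
  have hrv : ∀ v, v ≠ 0 → r v ∈ realization Γ := by
    intro v hv
    have hp := hNpos v hv
    have hsum : |v 0 / N v| + |v 1 / N v| + |v 2 / N v| = 1 := by
      rw [abs_div, abs_div, abs_div, abs_of_pos hp, ← add_div, ← add_div]
      exact div_self hp.ne'
    refine ⟨fun t => ?_, {if 0 ≤ v 0 / N v then x else x', if 0 ≤ v 1 / N v then y else y',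
      if 0 ≤ v 2 / N v then z else z'}, ⟨_, _, _, ?_, ?_, ?_, rfl⟩, fun t ht => ?_, ?_⟩
    · simp only [r]
      split_ifs <;> first | exact le_max_right _ _ | exact le_rfl
    · split_ifs <;> simp
    · split_ifs <;> simp
    · split_ifs <;> simp
    · simp only [Finset.mem_insert, Finset.mem_singleton, not_or] at ht
      obtain ⟨h1, h2, h3⟩ := ht
      by_cases t1 : t = x
      · subst t1
        rw [rx]
        split_ifs at h1
        · exact absurd rfl h1
        · exact max_eq_right (by linarith)
      by_cases t2 : t = x'
      · subst t2
        rw [rx']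
        split_ifs at h1
        · exact max_eq_right (by linarith)
        · exact absurd rfl h1
      by_cases t3 : t = y
      · subst t3
        rw [ry]
        split_ifs at h2
        · exact absurd rfl h2
        · exact max_eq_right (by linarith)
      by_cases t4 : t = y'
      · subst t4
        rw [ry']
        split_ifs at h2
        · exact max_eq_right (by linarith)
        · exact absurd rfl h2
      by_cases t5 : t = z
      · subst t5
        rw [rz]
        split_ifs at h3
        · exact absurd rfl h3
        · exact max_eq_right (by linarith)
      by_cases t6 : t = z'
      · subst t6
        rw [rz']
        split_ifs at h3
        · exact max_eq_right (by linarith)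
        · exact absurd rfl h3
      simp [r, t1, t2, t3, t4, t5, t6]
    · rw [← hsum]
      have e1 : r v (if 0 ≤ v 0 / N v then x else x') = |v 0 / N v| := by
        split_ifs with h
        · rw [rx, abs_of_nonneg h, max_eq_left h]
        · rw [rx', abs_of_neg (not_le.1 h), max_eq_left (by linarith)]
      have e2 : r v (if 0 ≤ v 1 / N v then y else y') = |v 1 / N v| := by
        split_ifs with h
        · rw [ry, abs_of_nonneg h, max_eq_left h]
        · rw [ry', abs_of_neg (not_le.1 h), max_eq_left (by linarith)]
      have e3 : r v (if 0 ≤ v 2 / N v then z else z') = |v 2 / N v| := by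
        split_ifs with h
        · rw [rz, abs_of_nonneg h, max_eq_left h]
        · rw [rz', abs_of_neg (not_le.1 h), max_eq_left (by linarith)]
      rw [Finset.sum_insert, Finset.sum_pair, e1, e2, e3, add_assoc]
      · split_ifs <;> assumption
      · simp only [Finset.mem_insert, Finset.mem_singleton, not_or]
        constructor <;> split_ifs <;> assumption
  have hmax : ∀ a : ℝ, max a 0 - max (-a) 0 = a := by
    intro a
    rcases le_total 0 a with h | h
    · rw [max_eq_left h, max_eq_right (by linarith)]; ring
    · rw [max_eq_right h, max_eq_left (by linarith)]; ring
  have hgr : ∀ v, v ≠ 0 → g (r v) = (N v)⁻¹ • v := by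
    intro v hv
    ext i
    fin_cases i
    · simp only [g, rx, rx', ry, ry', rz, rz', hmax]; simp [div_eq_inv_mul]
    · simp only [g, rx, rx', ry, ry', rz, rz', hmax]; simp [div_eq_inv_mul]
    · simp only [g, rx, rx', ry, ry', rz, rz', hmax]; simp [div_eq_inv_mul]
  have hrsmul : ∀ (t : ℝ) v, 0 < t → r (t • v) = r v := by
    intro t v ht
    funext u
    simp only [r, hNsmul t v ht.le, PiLp.smul_apply, smul_eq_mul, mul_div_mul_left _ _ ht.ne']
  have hmaxsub : ∀ a b : ℝ, 0 ≤ a → 0 ≤ b → (a = 0 ∨ b = 0) →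
      max (a - b) 0 = a ∧ max (-(a - b)) 0 = b := by
    rintro a b ha hb (rfl | rfl)
    · simp [hb]
    · simp [ha]
  have hrg : ∀ f ∈ realization Γ, r (g f) = f := by
    intro f h
    obtain ⟨h0, hx, hy, hz, hs, ho⟩ := hf f h
    have mx := hmaxsub _ _ (h0 _) (h0 _) hx
    have my := hmaxsub _ _ (h0 _) (h0 _) hy
    have mz := hmaxsub _ _ (h0 _) (h0 _) hz
    funext t
    simp only [r, hNg f h, div_one]
    simp only [g, Matrix.cons_val, mx, my, mz]
    split_ifs with t1 t2 t3 t4 t5 t6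
    · rw [t1]
    · rw [t2]
    · rw [t3]
    · rw [t4]
    · rw [t5]
    · rw [t6]
    · exact (ho t t1 t2 t3 t4 t5 t6).symm
  have cN : Continuous N := by simp only [N]; fun_prop
  have hs0 : ∀ v : Metric.sphere (0 : EuclideanSpace ℝ (Fin 3)) 1,
      (v : EuclideanSpace ℝ (Fin 3)) ≠ 0 := by
    rintro ⟨v, hv⟩ rfl
    simp at hv
  have cg : Continuous g := by
    simp only [g]
    refine (PiLp.continuous_toLp 2 _).comp (continuous_pi fun i => ?_)
    fin_cases i <;> simp <;> fun_prop
  refine ⟨⟨⟨fun f => ⟨‖g f‖⁻¹ • g f, ?_⟩, fun v => ⟨r v, hrv v (hs0 v)⟩, ?_, ?_⟩, ?_, ?_⟩⟩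
  · rw [mem_sphere_zero_iff_norm, norm_smul, norm_inv, norm_norm,
      inv_mul_cancel₀ (norm_ne_zero_iff.2 (hg0 f f.2))]
  · rintro ⟨f, h⟩
    apply Subtype.ext
    have : 0 < ‖g f‖⁻¹ := inv_pos.2 (norm_pos_iff.2 (hg0 f h))
    simp only [hrsmul _ _ this, hrg f h]
  · rintro ⟨v, hv⟩
    have hv0 : v ≠ 0 := hs0 ⟨v, hv⟩
    rw [mem_sphere_zero_iff_norm] at hv
    apply Subtype.ext
    simp only [hgr v hv0, norm_smul, norm_inv, Real.norm_eq_abs, abs_of_pos (hNpos v hv0), hv,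
      mul_one, inv_inv, smul_smul, mul_inv_cancel₀ (hNpos v hv0).ne', one_smul]
  · refine Continuous.subtype_mk ?_ _
    have c1 : Continuous fun f : realization Γ => g f := cg.comp continuous_subtype_val
    exact (c1.norm.inv₀ fun f => norm_ne_zero_iff.2 (hg0 f f.2)).smul c1
  · refine Continuous.subtype_mk (continuous_pi fun t => ?_) _
    have c2 : ∀ i : Fin 3, Continuous fun v : Metric.sphere (0 : EuclideanSpace ℝ (Fin 3)) 1 =>
        (v : EuclideanSpace ℝ (Fin 3)) i / N v := fun i =>
      (by fun_prop : Continuous fun v : Metric.sphere (0 : EuclideanSpace ℝ (Fin 3)) 1 =>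
        (v : EuclideanSpace ℝ (Fin 3)) i).div (cN.comp continuous_subtype_val)
        fun v => (hNpos v (hs0 v)).ne'
    have c3 := fun i => (c2 i).max continuous_const (g := fun _ => (0 : ℝ))
    have c4 := fun i => (c2 i).neg.max continuous_const (g := fun _ => (0 : ℝ))
    simp only [r]
    split_ifs
    · exact c3 0
    · exact c4 0
    · exact c3 1
    · exact c4 1
    · exact c3 2
    · exact c4 2
    · exact continuous_const

end Topology

/-! ### Bipyramids are spheres -/

section Topology

variable {W : Type*} [DecidableEq W]

/-- The bipyramid over a triangle is a sphere; a subdivision of one edge gives the octahedron. -/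
theorem nonempty_homeomorph_triangle {x y z c d : W} (hn : [x, y, z, c, d].Nodup) :
    Nonempty (realization ({{x, y, c}, {x, y, d}, {y, z, c}, {y, z, d}, {z, x, c}, {z, x, d}} :
      Set (Finset W)) ≃ₜ Metric.sphere (0 : EuclideanSpace ℝ (Fin 3)) 1) := by
  simp only [List.nodup_cons, List.mem_cons, not_or, List.not_mem_nil, not_false_eq_true,
    and_true, List.nodup_nil] at hn
  obtain ⟨⟨n1, n2, n3, n4⟩, ⟨n5, n6, n7⟩, ⟨n8, n9⟩, n10⟩ := hn
  -- A new vertex is needed for the subdivision.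
  obtain ⟨f⟩ := nonempty_homeomorph_image ({{x, y, c}, {x, y, d}, {y, z, c}, {y, z, d}, {z, x, c},
    {z, x, d}} : Set (Finset W)) (Option.some_injective W)
  obtain ⟨g⟩ := nonempty_homeomorph_subdivision (W := Option W)
    (R := {{some x, some y, some c}, {some x, some y, some d}, {some y, some z, some c},
      {some y, some z, some d}})
    (p := some z) (q := some x) (w := none) (c := some c) (d := some d)
    (by simpa using Ne.symm n2) (by simp) (by simp) (by simp) (by simp) (by simpa using n8)
    (by simpa using n9) (by simpa using n3) (by simpa using n4)
    (by
      rintro F (rfl | rfl | rfl | rfl) ⟨h1, h2⟩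
      · simp [Ne.symm n2, Ne.symm n5, n8] at h1
      · simp [Ne.symm n2, Ne.symm n5, n9] at h1
      · simp [n1, n2, n3] at h2
      · simp [n1, n2, n4] at h2)
    (by rintro F (rfl | rfl | rfl | rfl) <;> simp)
  obtain ⟨o⟩ := nonempty_homeomorph_octahedron (W := Option W) (x := some x) (x' := some z)
    (y := some y) (y' := none) (z := some c) (z' := some d)
    (by simp [n1, n2, n3, n4, Ne.symm n5, n6, n7, n8, n9, n10])
  have e1 : Finset.image some '' ({{x, y, c}, {x, y, d}, {y, z, c}, {y, z, d}, {z, x, c},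
      {z, x, d}} : Set (Finset W)) = {{some x, some y, some c}, {some x, some y, some d},
      {some y, some z, some c}, {some y, some z, some d}} ∪
      {{some z, some x, some c}, {some z, some x, some d}} := by
    simp only [Set.image_insert_eq, Set.image_singleton, Finset.image_insert,
      Finset.image_singleton]
    ext F
    simp only [Set.mem_union, Set.mem_insert_iff, Set.mem_singleton_iff]
    tauto
  have e2 : ({{some x, some y, some c}, {some x, some y, some d}, {some y, some z, some c},
      {some y, some z, some d}} ∪ {{some z, none, some c}, {none, some x, some c},
      {some z, none, some d}, {none, some x, some d}} : Set (Finset (Option W))) =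
      {F | ∃ a b e, (a = some x ∨ a = some z) ∧ (b = some y ∨ b = none) ∧
      (e = some c ∨ e = some d) ∧ F = {a, b, e}} := by
    have s1 : ∀ a b e : Option W, ({a, b, e} : Finset (Option W)) = {b, a, e} := fun a b e =>
      Finset.insert_comm _ _ _
    rw [s1 (some y) (some z), s1 (some y) (some z), s1 none (some x), s1 none (some x)]
    ext F
    simp only [Set.mem_union, Set.mem_insert_iff, Set.mem_singleton_iff, Set.mem_ofPred_eq,
      or_and_right, exists_or, exists_eq_left, and_or_left, exists_and_left]
    tauto
  exact ⟨((f.trans (Homeomorph.setCongr (by rw [e1]))).trans g).trans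
    ((Homeomorph.setCongr (by rw [e2])).trans o)⟩

theorem exists_eq_add_natCast {n : ℕ} (hn : 0 < n) (j i : ZMod n) :
    ∃ t < n, i = j + (t : ZMod n) := by
  have : NeZero n := ⟨by omega⟩
  exact ⟨(i - j).val, ZMod.val_lt _, by rw [ZMod.natCast_zmod_val]; ring⟩

theorem natCast_pred_add_one {n : ℕ} (hn : 0 < n) : ((n - 1 : ℕ) : ZMod n) + 1 = 0 := by
  rw [← Nat.cast_one (R := ZMod n), ← Nat.cast_add, show n - 1 + 1 = n by omega, ZMod.natCast_self]

/-- The bipyramid over an `n`-gon is a repeated subdivision of the bipyramid over a triangle. -/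
theorem nonempty_homeomorph_bipyramid {n : ℕ} (hn : 3 ≤ n) {B : ZMod n → W} {b : Bool → W}
    (hB : Function.Injective B) (hb : Function.Injective b) (hBb : ∀ i a, B i ≠ b a)
    {Γ : Set (Finset W)} (hΓ : ∀ F, F ∈ Γ ↔ ∃ i a, F = {B i, B (i + 1), b a}) :
    Nonempty (realization Γ ≃ₜ Metric.sphere (0 : EuclideanSpace ℝ (Fin 3)) 1) := by
  have hcast : ∀ s t : ℕ, s < n → t < n → B s = B t → s = t := fun s t hs ht h =>
    natCast_inj_of_lt hs ht (hB h)
  set w : ℕ → W := fun l => B ((l + 2 : ℕ) : ZMod n) with hw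
  have d01 : B (0 : ℕ) ≠ B (1 : ℕ) := fun h => by
    have := hcast 0 1 (by omega) (by omega) h; omega
  have d0 : ∀ l ≤ n - 3, B (0 : ℕ) ≠ w l := fun l hl h => by
    have := hcast 0 (l + 2) (by omega) (by omega) h; omega
  have d1 : ∀ l ≤ n - 3, B (1 : ℕ) ≠ w l := fun l hl h => by
    have := hcast 1 (l + 2) (by omega) (by omega) h; omega
  have dw : ∀ i ≤ n - 3, ∀ l ≤ n - 3, w i = w l → i = l := fun i hi l hl h => by
    have := hcast (i + 2) (l + 2) (by omega) (by omega) h; omega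
  have dbb : b true ≠ b false := fun h => by simpa using hb h
  obtain ⟨f⟩ := nonempty_homeomorph_fan (W := W)
    (R := {{B (0 : ℕ), B (1 : ℕ), b true}, {B (0 : ℕ), B (1 : ℕ), b false},
      {B (1 : ℕ), w 0, b true}, {B (1 : ℕ), w 0, b false}}) (w := w) (y := B (0 : ℕ))
    (c := b true) (d := b false) (N := n - 3) dw (fun l hl => (d0 l hl).symm)
    (fun _ _ => hBb _ _) (fun _ _ => hBb _ _) (hBb _ _) (hBb _ _)
    (by
      have kb : ∀ i a, w i ≠ b a := fun _ _ => hBb _ _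
      rintro F (rfl | rfl | rfl | rfl) ⟨h1, h2⟩
      · simp only [Finset.mem_insert, Finset.mem_singleton, kb, or_false] at h1
        exact h1.elim (d0 0 (by omega)).symm (d1 0 (by omega)).symm
      · simp only [Finset.mem_insert, Finset.mem_singleton, kb, or_false] at h1
        exact h1.elim (d0 0 (by omega)).symm (d1 0 (by omega)).symm
      · simp only [Finset.mem_insert, Finset.mem_singleton, hBb, or_false] at h2
        exact h2.elim d01 (d0 0 (by omega))
      · simp only [Finset.mem_insert, Finset.mem_singleton, hBb, or_false] at h2
        exact h2.elim d01 (d0 0 (by omega)))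
    (by
      have k0 : ∀ i, i < n - 3 → w (i + 1) ≠ w 0 := fun i hi h => by
        have := dw _ (by omega) _ (by omega) h; omega
      have kb : ∀ i a, w i ≠ b a := fun _ _ => hBb _ _
      rintro F (rfl | rfl | rfl | rfl) i hi <;>
        simp only [Finset.mem_insert, Finset.mem_singleton, (d0 (i + 1) (by omega)).symm,
          (d1 (i + 1) (by omega)).symm, kb, k0 i hi, or_self, not_false_eq_true])
    (n - 3) le_rfl
  obtain ⟨o⟩ := nonempty_homeomorph_triangle (W := W) (x := B (0 : ℕ)) (y := B (1 : ℕ)) (z := w 0)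
    (c := b true) (d := b false) (by
      have kb : ∀ i a, w i ≠ b a := fun _ _ => hBb _ _
      simp only [List.nodup_cons, List.mem_cons, d01, d0 0 (by omega), d1 0 (by omega), hBb, kb,
        dbb, List.not_mem_nil, or_self, not_false_eq_true, List.nodup_nil, and_self])
  have e1 : ({{B (0 : ℕ), B (1 : ℕ), b true}, {B (0 : ℕ), B (1 : ℕ), b false},
      {B (1 : ℕ), w 0, b true}, {B (1 : ℕ), w 0, b false}} ∪
      {{w 0, B (0 : ℕ), b true}, {w 0, B (0 : ℕ), b false}} : Set (Finset W)) =
      {{B (0 : ℕ), B (1 : ℕ), b true}, {B (0 : ℕ), B (1 : ℕ), b false},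
      {B (1 : ℕ), w 0, b true}, {B (1 : ℕ), w 0, b false},
      {w 0, B (0 : ℕ), b true}, {w 0, B (0 : ℕ), b false}} := by
    ext F
    simp only [Set.mem_union, Set.mem_insert_iff, Set.mem_singleton_iff]
    tauto
  have hlast : B (((n - 1 : ℕ) : ZMod n) + 1) = B (0 : ℕ) := by
    rw [natCast_pred_add_one (by omega), Nat.cast_zero]
  have hwl : w (n - 3) = B ((n - 1 : ℕ) : ZMod n) := by
    simp only [hw]; rw [show n - 3 + 2 = n - 1 by omega]
  have hsucc : ∀ t : ℕ, B ((t : ZMod n) + 1) = B ((t + 1 : ℕ) : ZMod n) := fun t => by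
    push_cast; rfl
  have e2 : ({{B (0 : ℕ), B (1 : ℕ), b true}, {B (0 : ℕ), B (1 : ℕ), b false},
      {B (1 : ℕ), w 0, b true}, {B (1 : ℕ), w 0, b false}} ∪ fanFaces w (b true) (b false) (n - 3) ∪
      {{w (n - 3), B (0 : ℕ), b true}, {w (n - 3), B (0 : ℕ), b false}} : Set (Finset W)) = Γ := by
    ext F
    rw [hΓ]
    constructor
    · rintro (((rfl | rfl | rfl | rfl) | ⟨i, hi, rfl | rfl⟩) | (rfl | rfl))
      · exact ⟨(0 : ℕ), true, by rw [hsucc]⟩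
      · exact ⟨(0 : ℕ), false, by rw [hsucc]⟩
      · exact ⟨(1 : ℕ), true, by rw [hsucc]⟩
      · exact ⟨(1 : ℕ), false, by rw [hsucc]⟩
      · exact ⟨((i + 2 : ℕ) : ZMod n), true, by rw [hsucc]⟩
      · exact ⟨((i + 2 : ℕ) : ZMod n), false, by rw [hsucc]⟩
      · exact ⟨((n - 1 : ℕ) : ZMod n), true, by rw [hlast, hwl]⟩
      · exact ⟨((n - 1 : ℕ) : ZMod n), false, by rw [hlast, hwl]⟩
    · rintro ⟨i, a, rfl⟩
      obtain ⟨t, ht, rfl⟩ := exists_eq_add_natCast (by omega) 0 i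
      rw [zero_add]
      by_cases t0 : t = 0
      · subst t0
        rw [hsucc]
        left; left; cases a <;> simp
      by_cases t1 : t = 1
      · subst t1
        rw [hsucc]
        left; left; cases a <;> simp [hw]
      by_cases t2 : t = n - 1
      · subst t2
        rw [hlast, ← hwl]
        right; cases a <;> simp
      · left; right
        obtain ⟨l, rfl⟩ : ∃ l, t = l + 2 := ⟨t - 2, by omega⟩
        refine ⟨l, by omega, ?_⟩
        rw [hsucc]
        cases a
        · right; simp only [hw, add_right_comm]
        · left; simp only [hw, add_right_comm]
  exact ⟨((Homeomorph.setCongr (by rw [e2])).trans f.symm).trans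
    ((Homeomorph.setCongr (by rw [e1])).trans o)⟩

end Topology

/-! ### Gluing a bipyramid as a sequence of subdivisions -/

section Topology

variable {W : Type*} [DecidableEq W]

set_option maxHeartbeats 400000 in
/-- The two edges of `v` which do not belong to the path `v₁, v, v₂` are subdivided so that the star
of `v` becomes the union of a half of the star, the other half of the star moved to `v'`, and a
bipyramid cut open along two edges of the base. The vertices `v'`, `c`, `d`, `w 0` are inserted one
after another on the path from `v` to `a'`, so that it becomes `v, c, w 0, d, v', a'`; then the edge
from `w 0` to `v₁` is subdivided. -/
theorem nonempty_homeomorph_insert_bipyramid {R : Set (Finset W)} {v v₁ v₂ a a' v' c d : W}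
    {w : ℕ → W} {N : ℕ} (hn : [v, v₁, v₂, a, a', v', c, d].Nodup)
    (hw : ∀ i ≤ N, ∀ j ≤ N, w i = w j → i = j)
    (hwn : ∀ i ≤ N, w i ∉ [v, v₁, v₂, a, a', v', c, d])
    (hv : ∀ F ∈ R, v ∉ F) (hv' : ∀ F ∈ R, v' ∉ F) (hc : ∀ F ∈ R, c ∉ F) (hd : ∀ F ∈ R, d ∉ F)
    (hwR : ∀ F ∈ R, ∀ i ≤ N, w i ∉ F) :
    Nonempty (realization (R ∪ {{v, a', v₁}, {v, a', v₂}, {v, a, v₁}, {v, a, v₂}}) ≃ₜ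
      realization (R ∪ {{v, a, v₁}, {v, a, v₂}, {v', a', v₁}, {v', a', v₂}, {v, c, v₁}, {v, c, v₂},
        {d, v', v₁}, {d, v', v₂}, {c, w 0, v₂}, {w 0, d, v₂}} ∪ fanFaces w c d N ∪
        {{w N, v₁, c}, {w N, v₁, d}})) := by
  simp only [List.nodup_cons, List.mem_cons, not_or, List.not_mem_nil, not_false_eq_true,
    and_true, List.nodup_nil] at hn hwn
  obtain ⟨⟨n1, n2, n3, n4, n5, n6, n7⟩, ⟨n8, n9, n10, n11, n12, n13⟩, ⟨n14, n15, n16, n17, n18⟩,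
    ⟨n19, n20, n21, n22⟩, ⟨n23, n24, n25⟩, ⟨n26, n27⟩, n28⟩ := hn
  obtain ⟨k1, k2, k3, k4, k5, k6, k7, k8⟩ := hwn 0 (Nat.zero_le _)
  have hw0 : ∀ F ∈ R, w 0 ∉ F := fun F hF => hwR F hF 0 (Nat.zero_le _)
  obtain ⟨f1⟩ := nonempty_homeomorph_subdivision (R := R ∪ {{v, a, v₁}, {v, a, v₂}})
    (p := v) (q := a') (w := v') (c := v₁) (d := v₂) n4 (Ne.symm n5) (Ne.symm n23)
    (Ne.symm n11) (Ne.symm n16) n1 n2 (Ne.symm n10) (Ne.symm n15)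
    (by rintro F (hF | rfl | rfl) <;> grind) (by rintro F (hF | rfl | rfl) <;> grind)
  obtain ⟨f2⟩ := nonempty_homeomorph_subdivision
    (R := R ∪ {{v, a, v₁}, {v, a, v₂}, {v', a', v₁}, {v', a', v₂}})
    (p := v) (q := v') (w := c) (c := v₁) (d := v₂) n5 (Ne.symm n6) (Ne.symm n26)
    (Ne.symm n12) (Ne.symm n17) n1 n2 (Ne.symm n11) (Ne.symm n16)
    (by rintro F (hF | rfl | rfl | rfl | rfl) <;> grind)
    (by rintro F (hF | rfl | rfl | rfl | rfl) <;> grind)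
  obtain ⟨f3⟩ := nonempty_homeomorph_subdivision
    (R := R ∪ {{v, a, v₁}, {v, a, v₂}, {v', a', v₁}, {v', a', v₂}, {v, c, v₁}, {v, c, v₂}})
    (p := c) (q := v') (w := d) (c := v₁) (d := v₂) (Ne.symm n26) (Ne.symm n28) (Ne.symm n27)
    (Ne.symm n13) (Ne.symm n18) (Ne.symm n12) (Ne.symm n17) (Ne.symm n11) (Ne.symm n16)
    (by rintro F (hF | rfl | rfl | rfl | rfl | rfl | rfl) <;> grind)
    (by rintro F (hF | rfl | rfl | rfl | rfl | rfl | rfl) <;> grind)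
  obtain ⟨f4⟩ := nonempty_homeomorph_subdivision
    (R := R ∪ {{v, a, v₁}, {v, a, v₂}, {v', a', v₁}, {v', a', v₂}, {v, c, v₁}, {v, c, v₂},
      {d, v', v₁}, {d, v', v₂}})
    (p := c) (q := d) (w := w 0) (c := v₁) (d := v₂) n28 k7 k8 k2 k3
    (Ne.symm n12) (Ne.symm n17) (Ne.symm n13) (Ne.symm n18)
    (by rintro F (hF | rfl | rfl | rfl | rfl | rfl | rfl | rfl | rfl) <;> grind)
    (by rintro F (hF | rfl | rfl | rfl | rfl | rfl | rfl | rfl | rfl) <;> grind)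
  obtain ⟨f5⟩ := nonempty_homeomorph_fan
    (R := R ∪ {{v, a, v₁}, {v, a, v₂}, {v', a', v₁}, {v', a', v₂}, {v, c, v₁}, {v, c, v₂},
      {d, v', v₁}, {d, v', v₂}, {c, w 0, v₂}, {w 0, d, v₂}})
    (w := w) (y := v₁) (c := c) (d := d) hw (fun i hi => (hwn i hi).2.1)
    (fun i hi => (hwn i hi).2.2.2.2.2.2.1) (fun i hi => (hwn i hi).2.2.2.2.2.2.2) n12 n13
    (by rintro F (hF | rfl | rfl | rfl | rfl | rfl | rfl | rfl | rfl | rfl | rfl) <;> grind)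
    (by
      rintro F hF i hi
      have k0 : w (i + 1) ≠ w 0 := fun h => by have := hw _ hi _ (Nat.zero_le _) h; omega
      have := hwn (i + 1) hi
      have := hwR F
      rcases hF with hF | rfl | rfl | rfl | rfl | rfl | rfl | rfl | rfl | rfl | rfl
      · exact this hF (i + 1) hi
      all_goals grind)
    N le_rfl
  have r1 : ({c, w 0, v₁} : Finset W) = {w 0, v₁, c} := by
    rw [Finset.insert_comm, Finset.pair_comm]
  have r2 : ({w 0, d, v₁} : Finset W) = {w 0, v₁, d} := by rw [Finset.pair_comm]
  rw [r1, r2] at f4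
  refine ⟨((Homeomorph.setCongr ?_).trans f1).trans <| ((Homeomorph.setCongr ?_).trans f2).trans <|
    ((Homeomorph.setCongr ?_).trans f3).trans <| ((Homeomorph.setCongr ?_).trans f4).trans <|
    (Homeomorph.setCongr ?_).trans f5⟩
  all_goals
    congr 1
    ext F
    simp only [Set.mem_union, Set.mem_insert_iff, Set.mem_singleton_iff]
    grind

end Topology

section Topology

variable {W : Type*} [DecidableEq W] {Γ Γ' : Set (Finset W)} {E : Type*}

/-- The star of a free vertex consists of four faces. -/
theorem MirrorComplex.IsFree.faces_eq {M : MirrorComplex Γ E} {m : E} (h : M.IsFree m) (δ : Bool) :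
    Γ = {F ∈ Γ | M.V m true ∉ F} ∪ {{M.V m true, M.A m (!δ), M.V (M.S.symm m) true},
      {M.V m true, M.A m (!δ), M.V (M.S m) true}, {M.V m true, M.A m δ, M.V (M.S.symm m) true},
      {M.V m true, M.A m δ, M.V (M.S m) true}} := by
  have h1 : ∀ a, ({M.V m true, M.A m a, M.V (M.S.symm m) true} : Finset W) =
      {M.V (M.S.symm m) a, M.V (M.S (M.S.symm m)) a, M.A (M.S.symm m) a} := fun a => by
    rw [← M.A_S (M.S.symm m), Equiv.apply_symm_apply, h.fst a, h.mid a]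
    ext; simp only [Finset.mem_insert, Finset.mem_singleton]; tauto
  have h2 : ∀ a, ({M.V m true, M.A m a, M.V (M.S m) true} : Finset W) =
      {M.V m a, M.V (M.S m) a, M.A m a} := fun a => by
    rw [h.mid a, h.snd a]
    ext; simp only [Finset.mem_insert, Finset.mem_singleton]; tauto
  rw [h1, h1, h2, h2]
  ext F
  constructor
  · intro hF
    by_cases hv : M.V m true ∈ F
    · right
      obtain ⟨e, a, rfl⟩ := (M.mem_faces F).1 hF
      rcases (h.mid_mem_iff e a).1 hv with rfl | rfl
      · rw [Equiv.symm_apply_apply]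
        cases a <;> cases δ <;> simp
      · cases a <;> cases δ <;> simp
    · exact Or.inl ⟨hF, hv⟩
  · rintro (⟨hF, -⟩ | rfl | rfl | rfl | rfl)
    · exact hF
    all_goals exact M.face_mem _ _

/-- Gluing a bipyramid with at least four base vertices does not change the topology. -/
theorem Gluable.nonempty_homeomorph {n : ℕ} (hn : 4 ≤ n) {M : MirrorComplex Γ E}
    {M' : MirrorComplex Γ' (ZMod n)} {m : E} {j : ZMod n} {s s' : Slit W} {δ : Bool}
    (h : Gluable M M' m j s s' δ) {B : ZMod n → W} {b : Bool → W} (hB : Function.Injective B)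
    (hS : ∀ i, M'.S i = i + 1) (hV : ∀ i a, M'.V i a = B i) (hA : ∀ i a, M'.A i a = b a) :
    Nonempty (realization Γ ≃ₜ realization (glue Γ Γ' s s')) := by
  have hcast : ∀ t l : ℕ, t < n → l < n → B (j + t) = B (j + l) → t = l := fun t l ht hl e =>
    natCast_inj_of_lt ht hl (add_left_cancel (hB e))
  have hSs : M'.S.symm j = j - 1 := by rw [Equiv.symm_apply_eq, hS, sub_add_cancel]
  have hj1 : B (j + (n - 1 : ℕ)) = s'.fst := by
    rw [h.fst', hSs, hV, eq_sub_of_add_eq (natCast_pred_add_one (n := n) (by omega)), zero_sub,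
      sub_eq_add_neg]
  have hj : B (j + (0 : ℕ)) = s'.mid := by rw [h.mid', hV, Nat.cast_zero, add_zero]
  have hj' : B (j + (1 : ℕ)) = s'.snd := by rw [h.snd', hV, hS, Nat.cast_one]
  -- The base of the bipyramid is `s'.mid, s'.snd, w 0, …, w (n - 4), s'.fst`.
  set w : ℕ → W := fun l => B (j + (l + 2 : ℕ)) with hw
  have hBmem : ∀ i a, B i ∈ ({M'.V i a, M'.V (M'.S i) a, M'.A i a} : Finset W) := by simp [hV]
  have hbmem : ∀ i a, b a ∈ ({M'.V i a, M'.V (M'.S i) a, M'.A i a} : Finset W) := by simp [hA]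
  have hBR : ∀ F ∈ Γ, ∀ i, B i ∉ F := fun F hF i hi =>
    Finset.disjoint_left.1 (h.disjoint F hF _ (M'.face_mem i true)) hi (hBmem i true)
  have hbR : ∀ F ∈ Γ, ∀ a, b a ∉ F := fun F hF a hi =>
    Finset.disjoint_left.1 (h.disjoint F hF _ (M'.face_mem j a)) hi (hbmem j a)
  have hBV : ∀ i e a, B i ≠ M.V e a := fun i e a hi => hBR _ (M.face_mem e a) i (by simp [hi])
  have hBA : ∀ i e a, B i ≠ M.A e a := fun i e a hi => hBR _ (M.face_mem e a) i (by simp [hi])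
  have hbV : ∀ i e a, b i ≠ M.V e a := fun i e a hi => hbR _ (M.face_mem e a) i (by simp [hi])
  have hbA : ∀ i e a, b i ≠ M.A e a := fun i e a hi => hbR _ (M.face_mem e a) i (by simp [hi])
  have hBb : ∀ i a, B i ≠ b a := fun i a hi => M'.V_ne_A i a i a (by rw [hV, hA, hi])
  have hbb : b (!δ) ≠ b δ := fun e => by
    have := M'.side_eq j j (!δ) δ (by rw [hA, hA, e])
    simp at this
  have hAA : M.A m δ ≠ M.A m (!δ) := fun e => by simpa using M.side_eq _ _ _ _ e
  have hother : ∀ l ≤ n - 4, ∀ a, rightMap s s' δ a (w l) = w l := fun l hl a => by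
    rw [rightMap_of_ne, identifyEnds_of_ne]
    · rw [← hj1]; exact fun e => by have := hcast _ _ (by omega) (by omega) e; omega
    · rw [← hj']; exact fun e => by have := hcast _ _ (by omega) (by omega) e; omega
    · rw [← hj]; exact fun e => by have := hcast _ _ (by omega) (by omega) e; omega
  obtain ⟨f⟩ := nonempty_homeomorph_insert_bipyramid (R := {F ∈ Γ | M.V m true ∉ F})
    (v := s.mid) (v₁ := s.fst) (v₂ := s.snd) (a := M.A m δ) (a' := M.A m (!δ)) (v' := s'.mid)
    (c := b (!δ)) (d := b δ) (w := w) (N := n - 4)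
    (by
      have e1 := h.fst_ne_mid
      have e2 := h.snd_ne_mid
      have e3 := h.fst_ne_snd
      simp only [h.fst, h.mid, h.snd, ← hj] at e1 e2 e3 ⊢
      simp only [List.nodup_cons, List.mem_cons, e1.symm, e2.symm, e3, M.V_ne_A, hAA, hbb,
        (hBV _ _ _).symm, (hBA _ _ _).symm, (hbV _ _ _).symm, (hbA _ _ _).symm, hBb,
        List.not_mem_nil, or_self, not_false_eq_true, List.nodup_nil, and_self])
    (fun i hi l hl e => by have := hcast _ _ (by omega) (by omega) e; omega)
    (fun i hi => by
      have e1 : w i ≠ s'.mid := by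
        rw [← hj]; exact fun e => by have := hcast _ _ (by omega) (by omega) e; omega
      rw [← hj] at e1
      simp only [h.fst, h.mid, h.snd, ← hj, List.mem_cons, e1, hBV, hBA, hBb, List.not_mem_nil,
        or_self, not_false_eq_true, w])
    (fun F hF => by rw [h.mid]; exact hF.2)
    (fun F hF => by rw [← hj]; exact hBR F hF.1 _)
    (fun F hF => hbR F hF.1 _) (fun F hF => hbR F hF.1 _) (fun F hF i hi => hBR F hF.1 _)
  have hΓ := h.free.faces_eq δ
  rw [← h.mid, ← h.fst, ← h.snd] at hΓ
  rw [← h.mid] at f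
  refine ⟨((Homeomorph.setCongr (congrArg realization hΓ)).trans f).trans
    (Homeomorph.setCongr (congrArg realization ?_))⟩
  clear f hΓ
  have hlast : ∀ l, l = n - 1 → B (j + (l : ℕ) + 1) = s'.mid := fun l hl => by
    rw [hl, add_assoc, natCast_pred_add_one (by omega), ← hj, Nat.cast_zero]
  have hsucc : ∀ t : ℕ, B (j + (t : ZMod n) + 1) = B (j + (t + 1 : ℕ)) := fun t => by
    push_cast; rw [add_assoc]
  have hw0 : B (j + (2 : ℕ)) = w 0 := rfl
  have hwl : w (n - 4) = B (j + (n - 2 : ℕ)) := by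
    simp only [hw]; rw [show n - 4 + 2 = n - 2 by omega]
  have rotL : ∀ x y z : W, ({x, y, z} : Finset W) = {y, z, x} := fun x y z => by
    ext; simp only [Finset.mem_insert, Finset.mem_singleton]; tauto
  have rev : ∀ x y z : W, ({x, y, z} : Finset W) = {z, y, x} := fun x y z => by
    ext; simp only [Finset.mem_insert, Finset.mem_singleton]; tauto
  have swap : ∀ x y z : W, ({x, y, z} : Finset W) = {x, z, y} := fun x y z => by
    rw [Finset.pair_comm]
  have hδ : (!δ) ≠ δ := by simp
  -- The faces of the bipyramid after the gluing.
  have hright : ∀ i a, ({rightMap s s' δ a (M'.V i a), rightMap s s' δ a (M'.V (M'.S i) a),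
      M'.A i a} : Finset W) = {rightMap s s' δ a (B i), rightMap s s' δ a (B (i + 1)), b a} := by
    intro i a; rw [hV, hV, hA, hS]
  have q1 : ∀ a, ({rightMap s s' δ a (B (j + (n - 1 : ℕ))),
      rightMap s s' δ a (B (j + (n - 1 : ℕ) + 1)), b a} : Finset W) =
      {s.fst, if a = δ then s'.mid else s.mid, b a} := fun a => by
    rw [hlast _ rfl, hj1, h.rightMap_fst, h.rightMap_mid]
  have q2 : ∀ a, ({rightMap s s' δ a (B (j + (0 : ℕ))), rightMap s s' δ a (B (j + (0 : ℕ) + 1)),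
      b a} : Finset W) = {if a = δ then s'.mid else s.mid, s.snd, b a} := fun a => by
    rw [hsucc, zero_add, hj', hj, h.rightMap_snd, h.rightMap_mid]
  have q3 : ∀ a, ({rightMap s s' δ a (B (j + (1 : ℕ))), rightMap s s' δ a (B (j + (1 : ℕ) + 1)),
      b a} : Finset W) = {s.snd, w 0, b a} := fun a => by
    rw [hsucc, hj', hw0, h.rightMap_snd, hother 0 (Nat.zero_le _)]
  have q4 : ∀ a, ({rightMap s s' δ a (B (j + (n - 2 : ℕ))),
      rightMap s s' δ a (B (j + (n - 2 : ℕ) + 1)), b a} : Finset W) =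
      {w (n - 4), s.fst, b a} := fun a => by
    rw [hsucc, show n - 2 + 1 = n - 1 by omega, hj1, ← hwl, h.rightMap_fst, hother _ le_rfl]
  have q5 : ∀ l < n - 4, ∀ a, ({rightMap s s' δ a (B (j + (l + 2 : ℕ))),
      rightMap s s' δ a (B (j + (l + 2 : ℕ) + 1)), b a} : Finset W) =
      {w l, w (l + 1), b a} := fun l hl a => by
    have e1 := hother l (by omega) a
    have e2 := hother (l + 1) (by omega) a
    simp only [hw] at e1 e2
    rw [hsucc, e1, add_right_comm, e2]
  -- The faces of `Γ` after the gluing.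
  have p1 : ∀ a, ({leftMap s s' δ a (M.V (M.S.symm m) a),
      leftMap s s' δ a (M.V (M.S (M.S.symm m)) a), M.A (M.S.symm m) a} : Finset W) =
      {s.fst, if a = δ then s.mid else s'.mid, M.A m a} := fun a => by
    rw [h.leftMap_fst, ← M.A_S (M.S.symm m), Equiv.apply_symm_apply, h.leftMap_V_mid]
  have p2 : ∀ a, ({leftMap s s' δ a (M.V m a), leftMap s s' δ a (M.V (M.S m) a), M.A m a} :
      Finset W) = {if a = δ then s.mid else s'.mid, s.snd, M.A m a} := fun a => by
    rw [h.leftMap_snd, h.leftMap_V_mid]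
  have p3 : ∀ e a, e ≠ m → M.S e ≠ m → ({leftMap s s' δ a (M.V e a),
      leftMap s s' δ a (M.V (M.S e) a), M.A e a} : Finset W) =
      {M.V e a, M.V (M.S e) a, M.A e a} := fun e a e1 e2 => by
    rw [leftMap_of_ne (by rwa [ne_eq, h.V_eq_mid_iff]),
      leftMap_of_ne (by rwa [ne_eq, h.V_eq_mid_iff])]
  ext F
  rw [h.mem_glue_iff]
  simp only [hright]
  constructor
  · rintro (((⟨hF, hm⟩ | rfl | rfl | rfl | rfl | rfl | rfl | rfl | rfl | rfl | rfl) |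
      ⟨i, hi, rfl | rfl⟩) | (rfl | rfl))
    · left
      obtain ⟨e, a, rfl⟩ := (M.mem_faces F).1 hF
      rw [h.mid, h.free.mid_mem_iff, not_or] at hm
      exact ⟨e, a, (p3 e a hm.2 hm.1).symm⟩
    · exact Or.inl ⟨_, δ, by rw [p1, if_pos rfl]; exact (rotL _ _ _).symm⟩
    · exact Or.inl ⟨m, δ, by rw [p2, if_pos rfl]; exact swap _ _ _⟩
    · exact Or.inl ⟨M.S.symm m, !δ, by rw [p1, if_neg hδ]; exact (rotL _ _ _).symm⟩
    · exact Or.inl ⟨m, !δ, by rw [p2, if_neg hδ]; exact swap _ _ _⟩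
    · exact Or.inr ⟨_, !δ, by rw [q1, if_neg hδ]; exact (rotL _ _ _).symm⟩
    · exact Or.inr ⟨_, !δ, by rw [q2, if_neg hδ]; exact swap _ _ _⟩
    · exact Or.inr ⟨_, δ, by rw [q1, if_pos rfl]; exact rev _ _ _⟩
    · exact Or.inr ⟨_, δ, by rw [q2, if_pos rfl]; exact rotL _ _ _⟩
    · exact Or.inr ⟨_, !δ, by rw [q3]; exact rev _ _ _⟩
    · exact Or.inr ⟨_, δ, by rw [q3]; exact (rotL _ _ _).symm⟩
    · exact Or.inr ⟨_, !δ, (q5 i hi _).symm⟩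
    · exact Or.inr ⟨_, δ, (q5 i hi _).symm⟩
    · exact Or.inr ⟨_, !δ, (q4 _).symm⟩
    · exact Or.inr ⟨_, δ, (q4 _).symm⟩
  · rintro (⟨e, a, rfl⟩ | ⟨i, a, rfl⟩)
    · by_cases e1 : e = m
      · subst e1
        rw [(p2 a).trans (swap _ _ _)]
        by_cases ha : a = δ
        · subst ha; simp
        · obtain rfl := Bool.eq_not_of_ne ha; simp
      by_cases e2 : M.S e = m
      · obtain rfl := (Equiv.symm_apply_eq _).2 e2.symm
        rw [(p1 a).trans (rotL _ _ _)]
        by_cases ha : a = δ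
        · subst ha; simp
        · obtain rfl := Bool.eq_not_of_ne ha; simp
      · rw [p3 e a e1 e2]
        refine Or.inl (Or.inl (Or.inl ⟨M.face_mem e a, ?_⟩))
        rw [h.mid, h.free.mid_mem_iff]
        tauto
    · obtain ⟨t, ht, rfl⟩ := exists_eq_add_natCast (by omega) j i
      by_cases t0 : t = 0
      · subst t0
        by_cases ha : a = δ
        · subst ha; rw [(q2 a).trans (rotL _ _ _).symm]; simp
        · obtain rfl := Bool.eq_not_of_ne ha; rw [(q2 _).trans (swap _ _ _)]; simp
      by_cases t1 : t = 1
      · subst t1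
        by_cases ha : a = δ
        · subst ha; rw [(q3 a).trans (rotL _ _ _)]; simp
        · obtain rfl := Bool.eq_not_of_ne ha; rw [(q3 _).trans (rev _ _ _)]; simp
      by_cases t2 : t = n - 1
      · subst t2
        by_cases ha : a = δ
        · subst ha; rw [(q1 a).trans (rev _ _ _)]; simp
        · obtain rfl := Bool.eq_not_of_ne ha; rw [(q1 _).trans (rotL _ _ _)]; simp
      by_cases t3 : t = n - 2
      · subst t3
        rw [q4]
        by_cases ha : a = δ
        · subst ha; simp
        · obtain rfl := Bool.eq_not_of_ne ha; simp
      obtain ⟨l, rfl⟩ : ∃ l, t = l + 2 := ⟨t - 2, by omega⟩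
      have hl : l < n - 4 := by omega
      rw [q5 l hl]
      refine Or.inl (Or.inr ⟨l, hl, ?_⟩)
      by_cases ha : a = δ
      · subst ha; simp
      · obtain rfl := Bool.eq_not_of_ne ha; simp

end Topology

/-! ### The sides of a path -/

section Sides

variable {W : Type*}

/-- The same path, passed through in the opposite direction. -/
def Slit.swap (s : Slit W) : Slit W := { s with fst := s.snd, snd := s.fst }

variable [DecidableEq W] {Γ Γ' : Set (Finset W)} {E : Type*}

theorem Slit.IsIn.swap {s : Slit W} (h : s.IsIn Γ) : s.swap.IsIn Γ where
  fst_ne_snd := h.fst_ne_snd.symm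
  fst_edge := h.snd_edge
  snd_edge := h.fst_edge
  plus_subset := h.plus_subset
  sides F hF F' hF' hne h1 h2 x hx hxF hxF' := by
    rw [Slit.swap, and_comm]
    exact h.sides F hF F' hF' hne h1 h2 x hx hxF hxF'

theorem identifyEnds_swap {s s' : Slit W} (h : s'.fst ≠ s'.snd) :
    identifyEnds s.swap s'.swap = identifyEnds s s' := by
  rw [identifyEnds, identifyEnds]
  exact Function.update_comm h.symm _ _ _

/-- If both paths are reversed, then the result of the gluing is the same. -/
theorem glue_swap {s s' : Slit W} (h : s'.fst ≠ s'.snd) :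
    glue Γ Γ' s.swap s'.swap = glue Γ Γ' s s' := by
  rw [glue, glue, identifyEnds_swap h]
  rfl

namespace MirrorComplex

variable {M : MirrorComplex Γ E} {m : E}

theorem V_symm_ne (M : MirrorComplex Γ E) (m : E) (a : Bool) :
    M.V (M.S.symm m) a ≠ M.V m a := fun h =>
  S_symm_ne m (M.inj _ _ a h (by rw [← M.A_S (M.S.symm m), Equiv.apply_symm_apply]))

theorem V_S_ne (M : MirrorComplex Γ E) (m : E) (a : Bool) : M.V (M.S m) a ≠ M.V m a := fun h =>
  M.S_ne m (M.inj _ _ a h (M.A_S _ _))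

theorem V_symm_ne_V_S (M : MirrorComplex Γ E) (m : E) (a : Bool) :
    M.V (M.S.symm m) a ≠ M.V (M.S m) a := fun h => by
  have h1 := M.inj _ _ a h (by rw [M.A_S, ← M.A_S (M.S.symm m), Equiv.apply_symm_apply])
  apply M.SS_ne m
  rw [← h1, Equiv.apply_symm_apply]

theorem A_ne_A (M : MirrorComplex Γ E) {e e' : E} {a a' : Bool} (h : a ≠ a') :
    M.A e a ≠ M.A e' a' := fun h1 => h (M.side_eq _ _ _ _ h1)

theorem face_symm (hm : M.IsFree m) (a : Bool) :
    ({M.V (M.S.symm m) a, M.V (M.S (M.S.symm m)) a, M.A (M.S.symm m) a} : Finset W) =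
      {M.V (M.S.symm m) true, M.V m true, M.A m a} := by
  rw [Equiv.apply_symm_apply, hm.fst, hm.mid, ← M.A_S (M.S.symm m), Equiv.apply_symm_apply]

theorem face_self (hm : M.IsFree m) (a : Bool) :
    ({M.V m a, M.V (M.S m) a, M.A m a} : Finset W) =
      {M.V m true, M.V (M.S m) true, M.A m a} := by
  rw [hm.snd, hm.mid]

/-- The `+` side of a path at a free vertex consists of the two faces with a common apex. -/
theorem IsFree.exists_side (hm : M.IsFree m) {s : Slit W} (hs : s.IsIn Γ)
    (h1 : s.fst = M.V (M.S.symm m) true) (h2 : s.mid = M.V m true)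
    (h3 : s.snd = M.V (M.S m) true) :
    ∃ δ, ∀ e a, ({M.V e a, M.V (M.S e) a, M.A e a} : Finset W) ∈ s.plus ↔
      (M.S e = m ∨ e = m) ∧ a = δ := by
  have k1 := M.V_symm_ne m true
  have k2 := M.V_S_ne m true
  have k3 := M.V_symm_ne_V_S m true
  have f1 := M.face_mem (M.S.symm m)
  have f2 := M.face_mem m
  simp only [face_symm hm] at f1
  simp only [face_self hm] at f2
  -- The two faces with the same apex are on the same side, …
  have same : ∀ a, ({M.V (M.S.symm m) true, M.V m true, M.A m a} : Finset W) ∈ s.plus ↔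
      {M.V m true, M.V (M.S m) true, M.A m a} ∈ s.plus := fun a => by
    refine (hs.sides _ (f1 a) _ (f2 a) (fun h => ?_) (by simp [h2]) (by simp [h2]) (M.A m a)
      ?_ (by simp) (by simp)).2 ⟨?_, ?_⟩
    · have : M.V (M.S.symm m) true ∈ ({M.V m true, M.V (M.S m) true, M.A m a} : Finset W) := by
        rw [← h]; simp
      simp [k1, k3, M.V_ne_A] at this
    · rw [h2]; exact (M.V_ne_A _ _ _ _).symm
    · rw [h1]; exact (M.V_ne_A _ _ _ _).symm
    · rw [h3]; exact (M.V_ne_A _ _ _ _).symm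
  -- … and the two faces with the same edge of the path are on different sides.
  have diff : ¬ (({M.V m true, M.V (M.S m) true, M.A m true} : Finset W) ∈ s.plus ↔
      {M.V m true, M.V (M.S m) true, M.A m false} ∈ s.plus) := by
    rw [hs.sides _ (f2 true) _ (f2 false) (fun h => ?_) (by simp [h2]) (by simp [h2])
      (M.V (M.S m) true) (by rwa [h2]) (by simp) (by simp)]
    · exact fun h => h.2 h3.symm
    · have : M.A m true ∈ ({M.V m true, M.V (M.S m) true, M.A m false} : Finset W) := by
        rw [← h]; simp
      simp [(M.V_ne_A _ _ _ _).symm, M.A_ne_A] at this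
  obtain ⟨δ, hδ⟩ : ∃ δ, ∀ a,
      ({M.V m true, M.V (M.S m) true, M.A m a} : Finset W) ∈ s.plus ↔ a = δ := by
    by_cases h : ({M.V m true, M.V (M.S m) true, M.A m true} : Finset W) ∈ s.plus
    · refine ⟨true, fun a => ?_⟩
      cases a
      · simp only [Bool.false_eq_true, iff_false]; tauto
      · simpa using h
    · refine ⟨false, fun a => ?_⟩
      cases a
      · simp only [iff_true]; tauto
      · simpa using h
  refine ⟨δ, fun e a => ⟨fun h => ?_, ?_⟩⟩
  · have h4 := (hm.mid_mem_iff e a).1 (h2 ▸ (hs.plus_subset _ h).2)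
    refine ⟨h4, ?_⟩
    rcases h4 with h4 | rfl
    · obtain rfl := (Equiv.symm_apply_eq _).2 h4.symm
      rw [face_symm hm, same] at h
      exact (hδ a).1 h
    · rw [face_self hm] at h
      exact (hδ a).1 h
  · rintro ⟨h4 | rfl, rfl⟩
    · obtain rfl := (Equiv.symm_apply_eq _).2 h4.symm
      rw [face_symm hm, same]
      exact (hδ a).2 rfl
    · rw [face_self hm]
      exact (hδ a).2 rfl

/-- The path through a free vertex, with one of its two sides as the `+` side. -/
theorem IsFree.exists_isIn (hm : M.IsFree m) : ∃ s : Slit W, s.fst = M.V (M.S.symm m) true ∧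
    s.mid = M.V m true ∧ s.snd = M.V (M.S m) true ∧ s.IsIn Γ := by
  have k1 := M.V_symm_ne m true
  have k2 := M.V_S_ne m true
  have k3 := M.V_symm_ne_V_S m true
  have f1 := M.face_mem (M.S.symm m)
  have f2 := M.face_mem m
  simp only [face_symm hm] at f1
  simp only [face_self hm] at f2
  have hface : ∀ F ∈ Γ, M.V m true ∈ F → ∃ a, F = {M.V (M.S.symm m) true, M.V m true, M.A m a} ∨
      F = {M.V m true, M.V (M.S m) true, M.A m a} := by
    intro F hF hv
    obtain ⟨e, a, rfl⟩ := (M.mem_faces F).1 hF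
    refine ⟨a, ?_⟩
    rcases (hm.mid_mem_iff e a).1 hv with h4 | rfl
    · obtain rfl := (Equiv.symm_apply_eq _).2 h4.symm
      exact Or.inl (face_symm hm a)
    · exact Or.inr (face_self hm a)
  have kA : ∀ e a a', M.A m a ≠ M.V e a' := fun e a a' => (M.V_ne_A _ _ _ _).symm
  have kAA : ∀ a a', M.A m a = M.A m a' ↔ a = a' := fun a a' =>
    ⟨M.side_eq _ _ _ _, fun h => h ▸ rfl⟩
  refine ⟨⟨M.V m true, M.V (M.S.symm m) true, M.V (M.S m) true,
    {F | F ∈ Γ ∧ M.V m true ∈ F ∧ M.A m true ∈ F}⟩, rfl, rfl, rfl,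
    ⟨k3, ⟨Finset.card_pair k1.symm, _, f1 true, ?_⟩, ⟨Finset.card_pair k2.symm, _, f2 true, ?_⟩,
      fun F hF => ⟨hF.1, hF.2.1⟩, ?_⟩⟩
  · intro x; simp; tauto
  · intro x; simp; tauto
  · intro F hF F' hF' hne hv hv' x hx hxF hxF'
    obtain ⟨a, ha⟩ := hface F hF hv
    obtain ⟨a', ha'⟩ := hface F' hF' hv'
    simp only [Set.mem_ofPred_eq, hF, hF', hv, hv', true_and]
    rcases ha with rfl | rfl <;> rcases ha' with rfl | rfl <;>
      simp only [Finset.mem_insert, Finset.mem_singleton, kA, kAA, false_or, hx] at hxF hxF' ⊢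
    · have : a ≠ a' := by rintro rfl; exact hne rfl
      have : x = M.V (M.S.symm m) true := by
        rcases hxF with h | h
        · exact h
        rcases hxF' with h' | h'
        · exact h'
        · exact absurd (M.side_eq _ _ _ _ (h.symm.trans h')) this
      cases a <;> cases a' <;> simp_all
    · have : x = M.A m a ∧ x = M.A m a' := by
        rcases hxF with h | h <;> rcases hxF' with h' | h'
        · exact absurd (h.symm.trans h') k3
        · exact absurd (h.symm.trans h') (M.V_ne_A _ _ _ _)
        · exact absurd (h'.symm.trans h) (M.V_ne_A _ _ _ _)
        · exact ⟨h, h'⟩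
      have h4 := M.side_eq _ _ _ _ (this.1.symm.trans this.2)
      rw [this.1, h4]
      simp [kA]
    · have : x = M.A m a ∧ x = M.A m a' := by
        rcases hxF with h | h <;> rcases hxF' with h' | h'
        · exact absurd (h'.symm.trans h) k3
        · exact absurd (h.symm.trans h') (M.V_ne_A _ _ _ _)
        · exact absurd (h'.symm.trans h) (M.V_ne_A _ _ _ _)
        · exact ⟨h, h'⟩
      have h4 := M.side_eq _ _ _ _ (this.1.symm.trans this.2)
      rw [this.1, h4]
      simp [kA]
    · have : a ≠ a' := by rintro rfl; exact hne rfl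
      have : x = M.V (M.S m) true := by
        rcases hxF with h | h
        · exact h
        rcases hxF' with h' | h'
        · exact h'
        · exact absurd (M.side_eq _ _ _ _ (h.symm.trans h')) this
      cases a <;> cases a' <;> simp_all

/-- The pairs of base edges at the starting vertices of `e` and `f` have no common edge. -/
def Apart (M : MirrorComplex Γ E) (e f : E) : Prop := e ≠ f ∧ M.S e ≠ f ∧ M.S f ≠ e

theorem Apart.symm {e f : E} (h : M.Apart e f) : M.Apart f e := ⟨h.1.symm, h.2.2, h.2.1⟩

/-- Pairs without a common edge start at distinct, non-consecutive base edges. -/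
theorem IsPairAt.apart {k : E} {c t : Finset W × Finset W} (hc : M.IsPairAt m c)
    (ht : M.IsPairAt k t) (hct : NoCommonEdge c t) : M.Apart m k := by
  obtain ⟨h1, h2, h3, h4⟩ := hct
  refine ⟨?_, ?_, ?_⟩
  · rintro rfl
    rcases hc with rfl | rfl <;> rcases ht with rfl | rfl <;> simp_all
  · rintro rfl
    rcases hc with rfl | rfl <;> rcases ht with rfl | rfl <;> simp_all
  · rintro rfl
    rcases hc with rfl | rfl <;> rcases ht with rfl | rfl <;> simp_all

end MirrorComplex

end Sides

/-! ### Gluing a bipyramid with an even base -/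

section GlueBipyramid

variable {W : Type*} [DecidableEq W] {Γ Γ' : Set (Finset W)} {E : Type*}

/-- The cycle of base edges of an odd bipyramid, in which any two pairs of consecutive edges without
a common edge cross each other. -/
theorem exists_cycleList_of_odd {n : ℕ} (hn : Odd n) : ∃ L : List (ZMod n),
    IsCycleList (fun i => i + 1 + 1) L ∧ Odd L.length ∧
    ∀ i i', i ≠ i' → i + 1 ≠ i' → i' + 1 ≠ i → Crosses L (i - 1) i (i' - 1) i' := by
  obtain ⟨k, rfl⟩ := hn
  have hf : ∀ j, IsCycleList (Equiv.addRight (2 : ZMod (2 * k + 1)))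
      (evenSteps j (2 * k + 1)) := fun j => by
    convert isCycleList_evenSteps j using 1
    funext i
    simp only [Equiv.coe_addRight]
    ring
  refine ⟨evenSteps 0 (2 * k + 1), isCycleList_evenSteps 0, by simp [evenSteps],
    fun i i' h1 h2 h3 => ?_⟩
  refine (crosses_evenSteps i i' h1 (fun h => h2 (by rw [h, sub_add_cancel]))
    (fun h => h3 (by rw [← h, sub_add_cancel]))).isRotated ?_
  exact (hf 0).isRotated_of (hf (i - 1)) (by simp [evenSteps])

/-- A bipyramid with an even base glued to `Γ`, where `Γ` has a cycle of base edges of odd length: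
this property is preserved, and so are the crossings of the pairs which are not used; the unused
pairs of the new bipyramid cross each other and every old pair which crosses the used one. -/
theorem exists_glued_bipyramid [DecidableEq E] {M : MirrorComplex Γ E} {L : List E}
    (hL : IsCycleList M.next L) (hodd : Odd L.length) {m : E} (hm : M.IsFree m) {s : Slit W}
    (hs : s.IsIn Γ) (h1 : s.fst = M.V (M.S.symm m) true) (h2 : s.mid = M.V m true)
    (h3 : s.snd = M.V (M.S m) true) {n : ℕ} (heven : Even n) (hn : 4 ≤ n) {B : ZMod n → W}
    {c : Bool → W} (hB : Function.Injective B) (hc : Function.Injective c)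
    (hBc : ∀ i a, B i ≠ c a) (hΓ' : ∀ F, F ∈ Γ' ↔ ∃ i a, F = {B i, B (i + 1), c a})
    {j : ZMod n} {s' : Slit W} (hs' : s'.IsIn Γ') (h1' : s'.fst = B (j - 1)) (h2' : s'.mid = B j)
    (h3' : s'.snd = B (j + 1)) (hdisj : ∀ F ∈ Γ, ∀ F' ∈ Γ', Disjoint F F') :
    ∃ (M' : MirrorComplex (glue Γ Γ' s s') (E ⊕ ZMod n)) (N : List (E ⊕ ZMod n)),
      IsCycleList M'.next N ∧ Odd N.length ∧ (∀ e, M'.S (Sum.inl e) = Sum.inl (M.S e)) ∧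
      (∀ i, M'.S (Sum.inr i) = Sum.inr (i + 1)) ∧
      (∀ e a, e ≠ m → M'.V (Sum.inl e) a = M.V e a) ∧
      (∀ i a, i ≠ j → M'.V (Sum.inr i) a = identifyEnds s s' (B i)) ∧
      (∀ k, M.IsFree k → M.Apart k m → M'.IsFree (Sum.inl k)) ∧
      (∀ i, i ≠ j → i + 1 ≠ j → j + 1 ≠ i → M'.IsFree (Sum.inr i)) ∧
      (∀ x y z t, Crosses L x y z t →
        Crosses N (Sum.inl x) (Sum.inl y) (Sum.inl z) (Sum.inl t)) ∧
      (∀ x y, Crosses L (M.S.symm m) m x y → ∀ i, i ≠ j → i + 1 ≠ j → j + 1 ≠ i →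
        Crosses N (Sum.inl x) (Sum.inl y) (Sum.inr (i - 1)) (Sum.inr i)) ∧
      (∀ i i', i ≠ j → i + 1 ≠ j → j + 1 ≠ i → i' ≠ j → i' + 1 ≠ j → j + 1 ≠ i' →
        i ≠ i' → i + 1 ≠ i' → i' + 1 ≠ i →
        Crosses N (Sum.inr (i - 1)) (Sum.inr i) (Sum.inr (i' - 1)) (Sum.inr i')) ∧
      (∀ e a, M'.A (Sum.inl e) a = M.A e a) ∧
      (∀ i a, ∃ a', M'.A (Sum.inr i) a = c a') ∧
      (∀ x a, (∃ e b, M'.V x a = M.V e b) ∨ ∃ i, M'.V x a = B i) ∧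
      Nonempty (realization Γ ≃ₜ realization (glue Γ Γ' s s')) := by
  obtain ⟨k, rfl⟩ := even_iff_exists_two_mul.1 heven
  obtain ⟨δ, hδ⟩ := hm.exists_side hs h1 h2 h3
  have hsymm : ∀ {b : Bool → W} (hb : Function.Injective b) (hBb : ∀ i a, B i ≠ b a)
      (hΓ' : ∀ F, F ∈ Γ' ↔ ∃ i a, F = {B i, B (i + 1), b a}),
      (bipyramidComplex (by omega) hB hb hBb hΓ').S.symm j = j - 1 :=
    fun _ _ _ => (Equiv.symm_apply_eq _).2 (sub_add_cancel _ _).symm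
  obtain ⟨δ', hδ'⟩ := (bipyramidComplex_isFree (by omega) hB hc hBc hΓ' j).exists_side hs'
    (by rw [h1', hsymm]; rfl) h2' h3'
  -- The apexes are named so that the `+` side of the path is the side `!δ`.
  have hb : Function.Injective fun a => c (a ^^ δ' ^^ !δ) := fun a a' h => by
    have := hc h
    simpa using this
  have hBb : ∀ i a, B i ≠ (fun a => c (a ^^ δ' ^^ !δ)) a := fun i a => hBc i _
  have hΓb : ∀ F, F ∈ Γ' ↔ ∃ i a, F = {B i, B (i + 1), (fun a => c (a ^^ δ' ^^ !δ)) a} := by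
    intro F
    rw [hΓ']
    refine exists_congr fun i => ⟨?_, ?_⟩
    · rintro ⟨a, rfl⟩
      refine ⟨a ^^ δ' ^^ !δ, ?_⟩
      cases a <;> cases δ <;> cases δ' <;> rfl
    · rintro ⟨a, rfl⟩
      exact ⟨_, rfl⟩
  have h1n : (1 : ZMod (2 * k)) ≠ 0 := fun h => by
    have := natCast_inj_of_lt (n := 2 * k) (a := 1) (b := 0) (by omega) (by omega)
      (by simpa using h)
    omega
  have h2n : (2 : ZMod (2 * k)) ≠ 0 := fun h => by
    have := natCast_inj_of_lt (n := 2 * k) (a := 2) (b := 0) (by omega) (by omega)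
      (by simpa using h)
    omega
  have h3n : (3 : ZMod (2 * k)) ≠ 0 := fun h => by
    have := natCast_inj_of_lt (n := 2 * k) (a := 3) (b := 0) (by omega) (by omega)
      (by simpa using h)
    omega
  have hG : Gluable M (bipyramidComplex (by omega) hB hb hBb hΓb) m j s s' δ :=
    { free := hm
      free' := bipyramidComplex_isFree _ hB hb hBb hΓb j
      fst := h1
      mid := h2
      snd := h3
      fst' := by rw [h1', hsymm]; rfl
      mid' := h2'
      snd' := h3'
      plus := hδ
      plus' := fun i a => by
        refine (hδ' i (a ^^ δ' ^^ !δ)).trans (and_congr Iff.rfl ?_)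
        cases a <;> cases δ <;> cases δ' <;> simp
      disjoint := hdisj
      not_adj := fun i a h => by
        change ({B i, B (i + 1)} : Finset W) = _ at h
        rw [h1', h3', Finset.ext_iff] at h
        have e1 := (h (B (j - 1))).2 (by simp)
        have e2 := (h (B (j + 1))).2 (by simp)
        simp only [Finset.mem_insert, Finset.mem_singleton, hB.eq_iff] at e1 e2
        rcases e1 with rfl | e1 <;> rcases e2 with e2 | e2
        · exact h2n (by linear_combination e2)
        · exact h1n (by linear_combination e2)
        · exact h3n (by linear_combination e2 - e1)
        · exact h2n (by linear_combination e2 - e1) }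
  have hsub : ∀ i i' : ZMod (2 * k), i + 1 ≠ i' → i ≠ i' - 1 := fun i i' h1 h2 =>
    h1 (by rw [h2, sub_add_cancel])
  have hsub' : ∀ i i' : ZMod (2 * k), i' + 1 ≠ i → i - 1 ≠ i' := fun i i' h1 h2 =>
    h1 (by rw [← h2, sub_add_cancel])
  obtain ⟨N, hN, hNodd, hc1, hc2, hc3⟩ := hG.exists_cycleList (by omega) (fun _ => rfl)
    (fun _ => rfl) hL hodd
  refine ⟨hG.glued, N, hN, hNodd, fun _ => rfl, fun _ => rfl, hG.glued_V_inl,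
    fun i a hi => hG.glued_V_inr i a hi, fun k hk h => hG.glued_isFree_inl hk h.1 h.2.1 h.2.2,
    fun i i1 i2 i3 => hG.glued_isFree_inr (bipyramidComplex_isFree _ hB hb hBb hΓb i) i1 i2 i3,
    hc1, fun x y h i i1 i2 i3 => hc2 x y h i i1 (hsub _ _ i2) (hsub' _ _ i3),
    fun i i' i1 i2 i3 j1 j2 j3 k1 k2 k3 => hc3 i i' i1 (hsub _ _ i2) (hsub' _ _ i3) j1
      (hsub _ _ j2) (hsub' _ _ j3) k1 (hsub _ _ k2) (hsub' _ _ k3),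
    fun _ _ => rfl, fun _ a => ⟨_, rfl⟩, ?_,
    hG.nonempty_homeomorph hn hB (fun _ => rfl) (fun _ _ => rfl) (fun _ _ => rfl)⟩
  rintro (e | i) a
  · rcases hG.left_V_cases e a with h | h
    · exact Or.inl h
    · exact Or.inr ⟨j, h.trans h2'⟩
  · rcases hG.right_V_cases i a with ⟨f, b, h⟩ | h
    · exact Or.inr ⟨f, h⟩
    · exact Or.inl h

end GlueBipyramid

/-! ### The construction along a tree -/

section Tree

variable {ι : Type*} {T : SimpleGraph ι} {label : ι → ℕ} {r : ι}
  {pair : (u : ι) → ι → ZMod (label u)}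

/-- The pair of base edges at the base vertex `i` of the bipyramid of `q` has no edge in common with
the pairs used for the gluings with the bipyramids of vertices in `D`. -/
def IsUnused (T : SimpleGraph ι) (pair : (u : ι) → ι → ZMod (label u)) (D : Set ι) (q : ι)
    (i : ZMod (label q)) : Prop :=
  ∀ w ∈ D, T.Adj q w → BaseDisjoint i (pair q w)

theorem baseVertex_injective (u : ι) : Function.Injective (baseVertex label u) := fun i j h => by
  have h1 := eq_of_heq (Sigma.mk.inj h).2
  exact Sum.inl_injective h1

theorem apex_injective (u : ι) :
    Function.Injective fun a : Bool => (⟨u, Sum.inr a⟩ : TreeVertex label) := fun i j h => by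
  have h1 := eq_of_heq (Sigma.mk.inj h).2
  exact Sum.inr_injective h1

theorem baseVertex_ne_apex (u : ι) (i : ZMod (label u)) (a : Bool) :
    baseVertex label u i ≠ ⟨u, Sum.inr a⟩ := fun h => by
  have h1 := eq_of_heq (Sigma.mk.inj h).2
  simp at h1

variable [DecidableEq ι]

/-- The invariant of the construction: a symmetric description of the triangulation `Γ` obtained
from the bipyramids of the vertices in `D`, with one cycle `L` of base edges of odd length; `ix q i`
is the base edge which starts at the base vertex `i` of the bipyramid of `q` in one of the two
directions of the base (`ix q` has no meaning for `q ∉ D`, `V (ix q i)` is the position of this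
vertex unless it has been split). -/
structure Presentation (T : SimpleGraph ι) (pair : (u : ι) → ι → ZMod (label u)) (D : Set ι)
    (Γ : Set (Finset (TreeVertex label))) (pos : (u : ι) → ZMod (label u) → TreeVertex label)
    (E : Type) where
  M : MirrorComplex Γ E
  L : List E
  isCycleList : IsCycleList M.next L
  odd_length : Odd L.length
  ix : (q : ι) → ZMod (label q) → E
  ix_injective : ∀ q ∈ D, Function.Injective (ix q)
  A_ix : ∀ q ∈ D, ∀ i a, (M.A (ix q i) a).1 = q
  S_ix : ∀ q ∈ D, (∀ i, M.S (ix q i) = ix q (i + 1)) ∨ ∀ i, M.S (ix q i) = ix q (i - 1)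
  isFree : ∀ q ∈ D, ∀ i, IsUnused T pair D q i → M.IsFree (ix q i)
  V_ix : ∀ q ∈ D, ∀ i, IsUnused T pair D q i → ∀ j, j = i - 1 ∨ j = i ∨ j = i + 1 →
    M.V (ix q j) true = pos q j
  crosses : ∀ q ∈ D, ∀ i, IsUnused T pair D q i → ∀ q' ∈ D, ∀ i', IsUnused T pair D q' i' →
    M.Apart (ix q i) (ix q' i') →
      Crosses L (M.S.symm (ix q i)) (ix q i) (M.S.symm (ix q' i')) (ix q' i')
  fst_mem : ∀ e a, (M.V e a).1 ∈ D ∧ (M.A e a).1 ∈ D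
  pos_eq : ∀ q ∉ D, pos q = baseVertex label q
  homeomorph : Nonempty (realization Γ ≃ₜ Metric.sphere (0 : EuclideanSpace ℝ (Fin 3)) 1)

theorem mem_bipyramidAt_iff (u : ι) (F : Finset (TreeVertex label)) :
    F ∈ bipyramidAt label u ↔ ∃ i a, F = {baseVertex label u i, baseVertex label u (i + 1),
      ⟨u, Sum.inr a⟩} := by
  simp only [bipyramidAt, bipyramid, Set.mem_image, Set.mem_ofPred_eq]
  constructor
  · rintro ⟨_, ⟨i, a, rfl⟩, rfl⟩
    exact ⟨i, a, by simp [Finset.image_insert, baseVertex]⟩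
  · rintro ⟨i, a, rfl⟩
    exact ⟨_, ⟨i, a, rfl⟩, by simp [Finset.image_insert, baseVertex]⟩

/-- The bipyramid with the base in the opposite direction. -/
theorem mem_bipyramidAt_iff_neg (u : ι) (F : Finset (TreeVertex label)) :
    F ∈ bipyramidAt label u ↔ ∃ i a, F = {baseVertex label u (-i), baseVertex label u (-(i + 1)),
      ⟨u, Sum.inr a⟩} := by
  rw [mem_bipyramidAt_iff]
  constructor
  · rintro ⟨i, a, rfl⟩
    refine ⟨-(i + 1), a, ?_⟩
    rw [Finset.insert_comm]
    rw [neg_neg, show -(-(i + 1) + 1) = i by ring]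
  · rintro ⟨i, a, rfl⟩
    refine ⟨-(i + 1), a, ?_⟩
    rw [Finset.insert_comm]
    rw [show -(i + 1) + 1 = -i by ring]

theorem fst_eq_of_mem_bipyramidAt {u : ι} {F : Finset (TreeVertex label)}
    (hF : F ∈ bipyramidAt label u) : ∀ x ∈ F, x.1 = u := by
  obtain ⟨i, a, rfl⟩ := (mem_bipyramidAt_iff u F).1 hF
  intro x hx
  simp only [Finset.mem_insert, Finset.mem_singleton] at hx
  rcases hx with rfl | rfl | rfl <;> rfl

namespace Presentation

variable {D : Set ι} {Γ : Set (Finset (TreeVertex label))}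
  {pos : (u : ι) → ZMod (label u) → TreeVertex label} {E : Type}
  (P : Presentation T pair D Γ pos E)

include P

theorem apart_of_ne {q q' : ι} (hq : q ∈ D) (hq' : q' ∈ D) (h : q ≠ q') (i : ZMod (label q))
    (i' : ZMod (label q')) : P.M.Apart (P.ix q i) (P.ix q' i') := by
  have key : ∀ e e', (P.M.A e true).1 = q → (P.M.A e' true).1 = q' → e ≠ e' := by
    rintro e _ h1 h2 rfl
    exact h (h1.symm.trans h2)
  have a1 := P.A_ix q hq i true
  have a2 := P.A_ix q' hq' i' true
  exact ⟨key _ _ a1 a2, key _ _ (by rw [P.M.A_S, a1]) a2, (key _ _ a1 (by rw [P.M.A_S, a2])).symm⟩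

theorem apart_of_baseDisjoint {q : ι} (hq : q ∈ D) {i i' : ZMod (label q)}
    (h : BaseDisjoint i i') : P.M.Apart (P.ix q i) (P.ix q i') := by
  obtain ⟨h1, h2, h3⟩ := h
  rcases P.S_ix q hq with hS | hS
  · simp only [MirrorComplex.Apart, hS, ne_eq, (P.ix_injective q hq).eq_iff]
    exact ⟨h1, Ne.symm h3, Ne.symm h2⟩
  · simp only [MirrorComplex.Apart, hS, ne_eq, (P.ix_injective q hq).eq_iff, sub_eq_iff_eq_add]
    exact ⟨h1, h2, h3⟩

/-- The edges at an unused base vertex form a pair in the complex of the presentation. -/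
theorem isPairAt {q : ι} (hq : q ∈ D) {i : ZMod (label q)} (hi : IsUnused T pair D q i) :
    P.M.IsPairAt (P.ix q i) ({pos q (i - 1), pos q i}, {pos q i, pos q (i + 1)}) := by
  have v0 := P.V_ix q hq i hi i (Or.inr (Or.inl rfl))
  have v1 := P.V_ix q hq i hi (i - 1) (Or.inl rfl)
  have v2 := P.V_ix q hq i hi (i + 1) (Or.inr (Or.inr rfl))
  simp only [MirrorComplex.IsPairAt, MirrorComplex.base, Equiv.apply_symm_apply, v0]
  rcases P.S_ix q hq with hS | hS
  · left
    have : P.M.S.symm (P.ix q i) = P.ix q (i - 1) := by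
      rw [Equiv.symm_apply_eq, hS, sub_add_cancel]
    rw [this, hS, v1, v2]
  · right
    have : P.M.S.symm (P.ix q i) = P.ix q (i + 1) := by
      rw [Equiv.symm_apply_eq, hS, add_sub_cancel_right]
    rw [this, hS, v1, v2, Finset.pair_comm, Finset.pair_comm (pos q (i + 1))]

/-- The step of the construction, for paths directed as the base edges of the presentation. -/
theorem exists_glue {p u : ι} (hp : p ∈ D) (hu : u ∉ D) (hpu : T.Adj p u)
    (hpair : IsUnused T pair D p (pair p u)) (heven : Even (label u)) (hlabel : 4 ≤ label u)
    {s s' : Slit (TreeVertex label)} (hs : s.IsIn Γ) (hs' : s'.IsIn (bipyramidAt label u))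
    (h1 : s.fst = P.M.V (P.M.S.symm (P.ix p (pair p u))) true)
    (h2 : s.mid = P.M.V (P.ix p (pair p u)) true)
    (h3 : s.snd = P.M.V (P.M.S (P.ix p (pair p u))) true)
    (h2' : s'.mid = baseVertex label u (pair u p))
    (h13' : (s'.fst = baseVertex label u (pair u p - 1) ∧
      s'.snd = baseVertex label u (pair u p + 1)) ∨
      (s'.fst = baseVertex label u (pair u p + 1) ∧
        s'.snd = baseVertex label u (pair u p - 1))) :
    Nonempty (Presentation T pair (insert u D) (glue Γ (bipyramidAt label u) s s')
      (fun q i => identifyEnds s s' (pos q i)) (E ⊕ ZMod (label u))) := by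
  classical
  -- The base of the new bipyramid is passed through in the direction of the path `s'`.
  obtain ⟨f, hf, hf1, hf2, hΓ'⟩ : ∃ f : ZMod (label u) → ZMod (label u),
      ((∀ i, f i = i) ∨ (∀ i, f i = -i)) ∧
      s'.fst = baseVertex label u (f (f (pair u p) - 1)) ∧
      s'.snd = baseVertex label u (f (f (pair u p) + 1)) ∧
      ∀ F, F ∈ bipyramidAt label u ↔ ∃ i a, F = {baseVertex label u (f i),
        baseVertex label u (f (i + 1)), ⟨u, Sum.inr a⟩} := by
    rcases h13' with ⟨e1, e2⟩ | ⟨e1, e2⟩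
    · exact ⟨fun i => i, Or.inl fun _ => rfl, e1, e2, mem_bipyramidAt_iff u⟩
    · refine ⟨fun i => -i, Or.inr fun _ => rfl, ?_, ?_, mem_bipyramidAt_iff_neg u⟩
      · rw [e1]; congr 1; ring
      · rw [e2]; congr 1; ring
  have hff : ∀ i, f (f i) = i := by
    rcases hf with hf | hf <;> simp [hf]
  have hfinj : Function.Injective f := Function.LeftInverse.injective hff
  have hfd : ∀ {i i'}, BaseDisjoint i i' → f i ≠ f i' ∧ f i + 1 ≠ f i' ∧ f i' + 1 ≠ f i := by
    rintro i i' ⟨d1, d2, d3⟩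
    refine ⟨fun h => d1 (hfinj h), ?_⟩
    rcases hf with hf | hf <;> simp only [hf]
    · exact ⟨d3.symm, d2.symm⟩
    · exact ⟨fun h => d2 (by linear_combination -h), fun h => d3 (by linear_combination -h)⟩
  have hdisj : ∀ F ∈ Γ, ∀ F' ∈ bipyramidAt label u, Disjoint F F' := by
    intro F hF F' hF'
    rw [Finset.disjoint_left]
    intro x hx hx'
    have e1 := fst_eq_of_mem_bipyramidAt hF' x hx'
    obtain ⟨e, a, rfl⟩ := (P.M.mem_faces F).1 hF
    simp only [Finset.mem_insert, Finset.mem_singleton] at hx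
    rcases hx with rfl | rfl | rfl
    · exact hu (e1 ▸ (P.fst_mem _ _).1)
    · exact hu (e1 ▸ (P.fst_mem _ _).1)
    · exact hu (e1 ▸ (P.fst_mem e a).2)
  obtain ⟨M', N, hN, hNodd, hSl, hSr, hVl, hVr, hFl, hFr, hc1, hc2, hc3, hAl, hAr, hVc, ⟨hh⟩⟩ :=
    exists_glued_bipyramid P.isCycleList P.odd_length (P.isFree p hp _ hpair) hs h1 h2 h3 heven
      hlabel (B := fun i => baseVertex label u (f i))
      (c := fun a => (⟨u, Sum.inr a⟩ : TreeVertex label))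
      ((baseVertex_injective u).comp hfinj) (apex_injective u)
      (fun i a => baseVertex_ne_apex u _ a) hΓ' (j := f (pair u p)) hs' hf1 (by rw [hff, h2']) hf2
      hdisj
  have hsl : ∀ e, M'.S.symm (Sum.inl e) = Sum.inl (P.M.S.symm e) := fun e => by
    rw [Equiv.symm_apply_eq, hSl, Equiv.apply_symm_apply]
  have hsr : ∀ i, M'.S.symm (Sum.inr i) = Sum.inr (i - 1) := fun i => by
    rw [Equiv.symm_apply_eq, hSr, sub_add_cancel]
  have hal : ∀ {e e'}, M'.Apart (Sum.inl e) (Sum.inl e') → P.M.Apart e e' := by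
    intro e e' h
    simpa [MirrorComplex.Apart, hSl] using h
  have har : ∀ {i i'}, M'.Apart (Sum.inr i) (Sum.inr i') → i ≠ i' ∧ i + 1 ≠ i' ∧ i' + 1 ≠ i := by
    intro i i' h
    simpa [MirrorComplex.Apart, hSr] using h
  have hDu : ∀ q ∈ D, q ≠ u := by rintro q hq rfl; exact hu hq
  have hmono : ∀ {q i}, IsUnused T pair (insert u D) q i → IsUnused T pair D q i :=
    fun h w hw => h w (Set.mem_insert_of_mem u hw)
  have hm : ∀ q ∈ D, ∀ i, IsUnused T pair (insert u D) q i →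
      P.M.Apart (P.ix q i) (P.ix p (pair p u)) := by
    intro q hq i hi
    by_cases hqp : q = p
    · subst hqp
      exact P.apart_of_baseDisjoint hq (hi u (Set.mem_insert u D) hpu)
    · exact P.apart_of_ne hq hp hqp _ _
  have hne : ∀ q ∈ D, ∀ i, IsUnused T pair (insert u D) q i → ∀ j, j = i - 1 ∨ j = i ∨ j = i + 1 →
      P.ix q j ≠ P.ix p (pair p u) := by
    intro q hq i hi j hj
    by_cases hqp : q = p
    · subst hqp
      obtain ⟨d1, d2, d3⟩ := hi u (Set.mem_insert u D) hpu
      intro h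
      obtain rfl := P.ix_injective q hq h
      rcases hj with hj | hj | hj
      · exact d2 (by rw [hj, sub_add_cancel])
      · exact d1 hj.symm
      · exact d3 hj
    · exact (P.apart_of_ne hq hp hqp _ _).1
  have hud : ∀ i, IsUnused T pair (insert u D) u i →
      f i ≠ f (pair u p) ∧ f i + 1 ≠ f (pair u p) ∧ f (pair u p) + 1 ≠ f i := fun i hi =>
    hfd (hi p (Set.mem_insert_of_mem u hp) hpu.symm)
  have hid : ∀ x : TreeVertex label, x.1 ≠ u → identifyEnds s s' x = x := by
    intro x hx
    apply identifyEnds_of_ne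
    · rintro rfl; exact hx (by rw [hf1]; rfl)
    · rintro rfl; exact hx (by rw [hf2]; rfl)
  set ix' : (q : ι) → ZMod (label q) → E ⊕ ZMod (label u) :=
    Function.update (fun q i => Sum.inl (P.ix q i)) u (fun i => Sum.inr (f i)) with hix'
  have ixu : ∀ i, ix' u i = Sum.inr (f i) := fun i => by rw [hix', Function.update_self]
  have ixq : ∀ q ∈ D, ∀ i, ix' q i = Sum.inl (P.ix q i) := fun q hq i => by
    rw [hix', Function.update_of_ne (hDu q hq)]
  -- The crossing of an old pair and a new pair.
  have hmix : ∀ q ∈ D, ∀ i, IsUnused T pair (insert u D) q i → ∀ i',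
      IsUnused T pair (insert u D) u i' → Crosses N (Sum.inl (P.M.S.symm (P.ix q i)))
        (Sum.inl (P.ix q i)) (Sum.inr (f i' - 1)) (Sum.inr (f i')) := by
    intro q hq i hi i' hi'
    obtain ⟨d1, d2, d3⟩ := hud i' hi'
    exact hc2 _ _ (P.crosses p hp _ hpair q hq i (hmono hi) (hm q hq i hi).symm) _ d1 d2 d3
  refine ⟨⟨M', N, hN, hNodd, ix', ?_, ?_, ?_, ?_, ?_, ?_, ?_, ?_,
    ⟨hh.symm.trans P.homeomorph.some⟩⟩⟩
  · rintro q (rfl | hq) i i' h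
    · rw [ixu, ixu] at h
      exact hfinj (Sum.inr_injective h)
    · rw [ixq q hq, ixq q hq] at h
      exact P.ix_injective q hq (Sum.inl_injective h)
  · rintro q (rfl | hq) i a
    · rw [ixu]
      obtain ⟨a', ha'⟩ := hAr (f i) a
      rw [ha']
    · rw [ixq q hq, hAl, P.A_ix q hq]
  · rintro q (rfl | hq)
    · simp only [ixu, hSr]
      rcases hf with hf | hf
      · left; intro i; simp only [hf]
      · right; intro i; simp only [hf]; congr 1; ring
    · simp only [ixq q hq, hSl]
      exact (P.S_ix q hq).imp (fun h i => by rw [h]) (fun h i => by rw [h])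
  · rintro q (rfl | hq) i hi
    · rw [ixu]
      obtain ⟨d1, d2, d3⟩ := hud i hi
      exact hFr _ d1 d2 d3
    · rw [ixq q hq]
      exact hFl _ (P.isFree q hq i (hmono hi)) (hm q hq i hi)
  · rintro q (rfl | hq) i hi j hj
    · rw [ixu, hVr, hff, P.pos_eq _ hu]
      obtain ⟨d1, d2, d3⟩ := hi p (Set.mem_insert_of_mem q hp) hpu.symm
      intro h
      obtain rfl := hfinj h
      rcases hj with hj | hj | hj
      · exact d2 (by rw [hj, sub_add_cancel])
      · exact d1 hj.symm
      · exact d3 hj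
    · have hv := P.V_ix q hq i (hmono hi) j hj
      rw [ixq q hq, hVl _ _ (hne q hq i hi j hj), hv, hid]
      rw [← hv]
      exact hDu _ (P.fst_mem _ _).1
  · rintro q (rfl | hq) i hi q' (rfl | hq') i' hi' hap
    · simp only [ixu, hsr] at hap ⊢
      obtain ⟨d1, d2, d3⟩ := hud i hi
      obtain ⟨d1', d2', d3'⟩ := hud i' hi'
      obtain ⟨k1, k2, k3⟩ := har hap
      exact hc3 _ _ d1 d2 d3 d1' d2' d3' k1 k2 k3
    · simp only [ixu, ixq q' hq', hsl, hsr]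
      exact (hmix q' hq' i' hi' i hi).symm
    · simp only [ixu, ixq q hq, hsl, hsr]
      exact hmix q hq i hi i' hi'
    · simp only [ixq q hq, ixq q' hq', hsl] at hap ⊢
      exact hc1 _ _ _ _ (P.crosses q hq i (hmono hi) q' hq' i' (hmono hi') (hal hap))
  · intro x a
    constructor
    · rcases hVc x a with ⟨e, b, h⟩ | ⟨i, h⟩ <;> rw [h]
      · exact Set.mem_insert_of_mem u (P.fst_mem e b).1
      · exact Set.mem_insert u D
    · rcases x with e | i
      · rw [hAl]
        exact Set.mem_insert_of_mem u (P.fst_mem e a).2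
      · obtain ⟨a', ha'⟩ := hAr i a
        rw [ha']
        exact Set.mem_insert u D
  · intro q hq
    rw [Set.mem_insert_iff, not_or] at hq
    funext i
    rw [P.pos_eq q hq.2]
    exact hid _ hq.1

/-- The step of the construction.  If the base of the bipyramid of `p` has the opposite direction in
the presentation, then both paths are reversed. -/
theorem exists_step {p u : ι} (hp : p ∈ D) (hu : u ∉ D) (hpu : T.Adj p u)
    (hpair : IsUnused T pair D p (pair p u)) (heven : Even (label u)) (hlabel : 4 ≤ label u)
    {s s' : Slit (TreeVertex label)} (hs : s.IsIn Γ) (hs' : s'.IsIn (bipyramidAt label u))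
    (h1 : s.mid = pos p (pair p u)) (h2 : s.fst = pos p (pair p u - 1))
    (h3 : s.snd = pos p (pair p u + 1))
    (h2' : s'.mid = baseVertex label u (pair u p))
    (h13' : (s'.fst = baseVertex label u (pair u p - 1) ∧
      s'.snd = baseVertex label u (pair u p + 1)) ∨
      (s'.fst = baseVertex label u (pair u p + 1) ∧
        s'.snd = baseVertex label u (pair u p - 1))) :
    Nonempty (Presentation T pair (insert u D) (glue Γ (bipyramidAt label u) s s')
      (fun q i => identifyEnds s s' (pos q i)) (E ⊕ ZMod (label u))) := by
  have v0 := P.V_ix p hp _ hpair _ (Or.inr (Or.inl rfl))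
  have v1 := P.V_ix p hp _ hpair _ (Or.inl rfl)
  have v2 := P.V_ix p hp _ hpair _ (Or.inr (Or.inr rfl))
  rcases P.S_ix p hp with hS | hS
  · have : P.M.S.symm (P.ix p (pair p u)) = P.ix p (pair p u - 1) := by
      rw [Equiv.symm_apply_eq, hS, sub_add_cancel]
    exact P.exists_glue hp hu hpu hpair heven hlabel hs hs' (by rw [this, v1, h2]) (by rw [v0, h1])
      (by rw [hS, v2, h3]) h2' h13'
  · have : P.M.S.symm (P.ix p (pair p u)) = P.ix p (pair p u + 1) := by
      rw [Equiv.symm_apply_eq, hS, add_sub_cancel_right]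
    rw [← glue_swap hs'.fst_ne_snd, ← identifyEnds_swap hs'.fst_ne_snd]
    exact P.exists_glue hp hu hpu hpair heven hlabel hs.swap hs'.swap
      (by rw [this, v2]; exact h3) (by rw [v0]; exact h1) (by rw [hS, v1]; exact h2) h2'
      (h13'.symm.imp And.symm And.symm)

end Presentation

/-- The bipyramid of the root. -/
theorem nonempty_presentation_root (hodd : Odd (label r)) (h3 : 3 ≤ label r) :
    Nonempty (Presentation T pair {r} (bipyramidAt label r) (baseVertex label)
      (ZMod (label r))) := by
  obtain ⟨L, hL, hLodd, hc⟩ := exists_cycleList_of_odd hodd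
  have hB := baseVertex_injective (label := label) r
  have hb := apex_injective (label := label) r
  have hBb := baseVertex_ne_apex (label := label) r
  have hΓ := mem_bipyramidAt_iff (label := label) r
  set M := bipyramidComplex h3 hB hb hBb hΓ with hM
  have hS : ∀ i, M.S i = i + 1 := fun _ => rfl
  have hs : ∀ i, M.S.symm i = i - 1 := fun i => by
    rw [Equiv.symm_apply_eq, hS, sub_add_cancel]
  set ix : (q : ι) → ZMod (label q) → ZMod (label r) :=
    Function.update (fun _ _ => 0) r id with hix
  have ixr : ∀ i, ix r i = i := fun i => by rw [hix, Function.update_self, id]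
  refine ⟨⟨M, L, hL, hLodd, ix, ?_, ?_, ?_, ?_, ?_, ?_, ?_, ?_,
    nonempty_homeomorph_bipyramid h3 hB hb hBb hΓ⟩⟩
  · rintro q rfl i i' h
    rwa [ixr, ixr] at h
  · rintro q rfl i a
    rfl
  · rintro q rfl
    left
    intro i
    rw [ixr, ixr, hS]
  · rintro q rfl i -
    exact bipyramidComplex_isFree h3 hB hb hBb hΓ _
  · rintro q rfl i - j -
    rw [ixr]
    rfl
  · rintro q rfl i - q' rfl i' - hap
    rw [ixr, ixr, MirrorComplex.Apart, hS, hS] at *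
    rw [hs, hs]
    exact hc i i' hap.1 hap.2.1 hap.2.2
  · exact fun e a => ⟨rfl, rfl⟩
  · exact fun q _ => rfl

end Tree

/-! ### Carrying out the construction -/

section Tree

variable {ι : Type*} [Fintype ι] {T : SimpleGraph ι} [DecidableRel T.Adj] {label : ι → ℕ} {r : ι}

namespace IsAdmissibleLabelling

variable (h : IsAdmissibleLabelling T r label)

include h

theorem odd_root : Odd (label r) := by
  obtain ⟨k, -, -, hk⟩ := h.root
  exact ⟨k, hk⟩

theorem three_le_root : 3 ≤ label r := by
  obtain ⟨k, h1, -, hk⟩ := h.root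
  omega

theorem even_of_ne {u : ι} (hu : u ≠ r) : Even (label u) := by
  by_cases hd : T.degree u = 1
  · exact (h.leaf u hu hd).1
  · obtain ⟨k, -, hk⟩ := h.internal u hu hd
    exact hk ▸ even_two_mul k

theorem four_le_of_adj {u p : ι} (hu : u ≠ r) (hpu : T.Adj p u) : 4 ≤ label u := by
  by_cases hd : T.degree u = 1
  · exact (h.leaf u hu hd).2
  · obtain ⟨k, h1, hk⟩ := h.internal u hu hd
    have : 0 < T.degree u := (T.degree_pos_iff_exists_adj u).2 ⟨p, hpu.symm⟩
    omega

theorem two_mul_degree_le {u : ι} (hd : T.degree u ≠ 1) : 2 * T.degree u ≤ label u := by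
  by_cases hu : u = r
  · subst hu
    obtain ⟨k, -, h1, hk⟩ := h.root
    omega
  · obtain ⟨k, h1, hk⟩ := h.internal u hu hd
    omega

/-- The pairs can be chosen at the base vertices `0, 2, 4, …`, because the degree is at most half of
the number of base vertices. -/
theorem exists_isPairChoice : ∃ pair, IsPairChoice T label pair := by
  classical
  refine ⟨fun u w => if hw : w ∈ T.neighborFinset u then
    ((2 * ((T.neighborFinset u).equivFin ⟨w, hw⟩ : ℕ) : ℕ) : ZMod (label u)) else 0, ?_⟩
  intro u w w' hw hw' hne
  have m1 : w ∈ T.neighborFinset u := (T.mem_neighborFinset u w).2 hw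
  have m2 : w' ∈ T.neighborFinset u := (T.mem_neighborFinset u w').2 hw'
  have hcard : T.degree u ≠ 1 := by
    intro h1
    obtain ⟨x, hx⟩ := Finset.card_eq_one.1 h1
    rw [hx, Finset.mem_singleton] at m1 m2
    exact hne (m1.trans m2.symm)
  have hle := h.two_mul_degree_le hcard
  rw [← T.card_neighborFinset_eq_degree] at hle
  simp only [m1, m2, dif_pos]
  have l1 := ((T.neighborFinset u).equivFin ⟨w, m1⟩).2
  have l2 := ((T.neighborFinset u).equivFin ⟨w', m2⟩).2
  have l3 : ((T.neighborFinset u).equivFin ⟨w, m1⟩ : ℕ) ≠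
      (T.neighborFinset u).equivFin ⟨w', m2⟩ := fun e => by
    have := (T.neighborFinset u).equivFin.injective (Fin.ext e)
    exact hne (congrArg Subtype.val this)
  generalize ((T.neighborFinset u).equivFin ⟨w, m1⟩ : ℕ) = a at *
  generalize ((T.neighborFinset u).equivFin ⟨w', m2⟩ : ℕ) = b at *
  refine ⟨fun e => ?_, fun e => ?_, fun e => ?_⟩
  · have := natCast_inj_of_lt (by omega) (by omega) e
    omega
  · rw [← Nat.cast_one (R := ZMod (label u)), ← Nat.cast_add] at e
    have := natCast_inj_of_lt (by omega) (by omega) e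
    omega
  · rw [← Nat.cast_one (R := ZMod (label u)), ← Nat.cast_add] at e
    have := natCast_inj_of_lt (by omega) (by omega) e
    omega

end IsAdmissibleLabelling

variable [DecidableEq ι] {pair : (u : ι) → ι → ZMod (label u)}

omit [Fintype ι] [DecidableRel T.Adj] in
theorem Built.root_mem {D : Set ι} {Γ : Set (Finset (TreeVertex label))}
    {pos : (u : ι) → ZMod (label u) → TreeVertex label} (h : Built T label r pair D Γ pos) :
    r ∈ D := by
  induction h with
  | root => exact Set.mem_singleton r
  | step D Γ pos p u s s' _ _ _ _ _ _ _ _ _ _ _ ih => exact Set.mem_insert_of_mem u ih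

omit [Fintype ι] [DecidableRel T.Adj] [DecidableEq ι] in
theorem IsPairChoice.isUnused (h : IsPairChoice T label pair) {D : Set ι} {p u : ι} (hu : u ∉ D)
    (hpu : T.Adj p u) : IsUnused T pair D p (pair p u) := fun w hw hpw =>
  h p u w hpu hpw (by rintro rfl; exact hu hw)

/-- Every triangulation obtained in the construction has a presentation. -/
theorem Built.nonempty_presentation (hlabel : IsAdmissibleLabelling T r label)
    (hpair : IsPairChoice T label pair) {D : Set ι} {Γ : Set (Finset (TreeVertex label))}
    {pos : (u : ι) → ZMod (label u) → TreeVertex label} (h : Built T label r pair D Γ pos) :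
    ∃ E, Nonempty (Presentation T pair D Γ pos E) := by
  induction h with
  | root => exact ⟨_, nonempty_presentation_root hlabel.odd_root hlabel.three_le_root⟩
  | step D Γ pos p u s s' hB hp hu hpu h1 h2 h3 h2' h13' hs hs' ih =>
    obtain ⟨E, ⟨P⟩⟩ := ih
    have hur : u ≠ r := by rintro rfl; exact hu hB.root_mem
    exact ⟨_, P.exists_step hp hu hpu (hpair.isUnused hu hpu) (hlabel.even_of_ne hur)
      (hlabel.four_le_of_adj hur hpu) hs hs' h1 h2 h3 h2' h13'⟩

/-- A further bipyramid can be glued as long as a vertex of the tree is left. -/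
theorem Built.exists_step (hlabel : IsAdmissibleLabelling T r label)
    (hpair : IsPairChoice T label pair) {D : Set ι} {Γ : Set (Finset (TreeVertex label))}
    {pos : (u : ι) → ZMod (label u) → TreeVertex label} (h : Built T label r pair D Γ pos)
    {p u : ι} (hp : p ∈ D) (hu : u ∉ D) (hpu : T.Adj p u) :
    ∃ Γ pos, Built T label r pair (insert u D) Γ pos := by
  obtain ⟨E, ⟨P⟩⟩ := h.nonempty_presentation hlabel hpair
  have hur : u ≠ r := by rintro rfl; exact hu h.root_mem
  have hun := hpair.isUnused hu hpu
  have v0 := P.V_ix p hp _ hun _ (Or.inr (Or.inl rfl))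
  have v1 := P.V_ix p hp _ hun _ (Or.inl rfl)
  have v2 := P.V_ix p hp _ hun _ (Or.inr (Or.inr rfl))
  obtain ⟨s, e1, e2, e3, hs⟩ := (P.isFree p hp _ hun).exists_isIn
  obtain ⟨t, f1, f2, f3, ht⟩ : ∃ t : Slit (TreeVertex label), t.mid = pos p (pair p u) ∧
      t.fst = pos p (pair p u - 1) ∧ t.snd = pos p (pair p u + 1) ∧ t.IsIn Γ := by
    rcases P.S_ix p hp with hS | hS
    · have : P.M.S.symm (P.ix p (pair p u)) = P.ix p (pair p u - 1) := by
        rw [Equiv.symm_apply_eq, hS, sub_add_cancel]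
      exact ⟨s, e2.trans v0, by rw [e1, this, v1], by rw [e3, hS, v2], hs⟩
    · have : P.M.S.symm (P.ix p (pair p u)) = P.ix p (pair p u + 1) := by
        rw [Equiv.symm_apply_eq, hS, add_sub_cancel_right]
      exact ⟨s.swap, e2.trans v0, by rw [Slit.swap, e3, hS, v1],
        by rw [Slit.swap, e1, this, v2], hs.swap⟩
  have h4 := hlabel.four_le_of_adj hur hpu
  obtain ⟨s', e1', e2', e3', hs'⟩ := (bipyramidComplex_isFree (by omega)
    (baseVertex_injective (label := label) u) (apex_injective u) (baseVertex_ne_apex u)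
    (mem_bipyramidAt_iff u) (pair u p)).exists_isIn
  exact ⟨_, _, Built.step D Γ pos p u t s' h hp hu hpu f1 f2 f3 e2'
    (Or.inl ⟨e1'.trans (congrArg (baseVertex label u) (sub_eq_add_neg _ _).symm), e3'⟩) ht hs'⟩

theorem exists_built_univ (hT : T.IsTree) (hlabel : IsAdmissibleLabelling T r label)
    (hpair : IsPairChoice T label pair) : ∃ Γ pos, Built T label r pair Set.univ Γ pos := by
  have key : ∀ n D Γ pos, Built T label r pair D Γ pos → Dᶜ.ncard = n →
      ∃ Γ pos, Built T label r pair Set.univ Γ pos := by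
    intro n
    induction n with
    | zero =>
      intro D Γ pos h hn
      rw [Set.ncard_eq_zero, Set.compl_empty_iff] at hn
      exact hn ▸ ⟨Γ, pos, h⟩
    | succ n ih =>
      intro D Γ pos h hn
      obtain ⟨x, hx⟩ : Dᶜ.Nonempty := Set.nonempty_of_ncard_ne_zero (by omega)
      obtain ⟨w⟩ := hT.1.preconnected r x
      obtain ⟨d, -, hp, hu⟩ := w.exists_boundary_dart D h.root_mem hx
      obtain ⟨Γ', pos', h'⟩ := h.exists_step hlabel hpair hp hu d.adj
      refine ih _ _ _ h' ?_
      have : (insert d.snd D)ᶜ = Dᶜ \ {d.snd} := by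
        ext y; simp [and_comm]
      rw [this, Set.ncard_sdiff_singleton_of_mem hu, hn]
      rfl
  exact key _ _ _ _ Built.root rfl

end Tree

theorem mainTheorem3 {ι : Type*} [Fintype ι] [DecidableEq ι] (T : SimpleGraph ι)
    [DecidableRel T.Adj] (hT : T.IsTree) (r : ι) (label : ι → ℕ)
    (hlabel : IsAdmissibleLabelling T r label) :
    (∃ pair, IsPairChoice T label pair) ∧
    ∀ pair, IsPairChoice T label pair →
      (∃ Γ pos, Built T label r pair Set.univ Γ pos) ∧
      ∀ D Γ pos, Built T label r pair D Γ pos →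
        IsSphereTriangulation Γ ∧ IsZKnotted Γ ∧
        ∀ τ, IsZOrientation Γ τ →
          (∀ F ∈ Γ, IsTypeIFace Γ τ F) ∧
          (∀ Z ∈ τ, IsHomogeneous Γ τ Z) ∧
          (∀ c ∈ freePairs T label pair D pos, IsSpecialPair Γ τ c) ∧
          (∀ c ∈ freePairs T label pair D pos, ∀ t ∈ freePairs T label pair D pos,
            NoCommonEdge c t → AreConcordant Γ τ c t) := by
  refine ⟨hlabel.exists_isPairChoice, fun pair hpair =>
    ⟨exists_built_univ hT hlabel hpair, fun D Γ pos h => ?_⟩⟩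
  obtain ⟨E, ⟨P⟩⟩ := h.nonempty_presentation hlabel hpair
  have htr := P.M.transitive P.isCycleList P.odd_length
  refine ⟨⟨?_, P.M.toDartComplex.card_face, P.homeomorph⟩,
    P.M.toDartComplex.isZKnotted _ htr, fun τ hτ =>
    ⟨P.M.toDartComplex.isTypeIFace _ htr hτ, P.M.toDartComplex.isHomogeneous _ htr hτ, ?_, ?_⟩⟩
  · have : Finite E := by
      refine Set.finite_univ_iff.1 (P.L.finite_toSet.subset fun e _ => P.isCycleList.mem e)
    refine (Set.finite_range fun x : E × Bool =>
      ({P.M.V x.1 x.2, P.M.V (P.M.S x.1) x.2, P.M.A x.1 x.2} : Finset _)).subset fun F hF => ?_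
    obtain ⟨e, a, rfl⟩ := (P.M.mem_faces F).1 hF
    exact ⟨(e, a), rfl⟩
  · rintro c ⟨q, hq, i, hi, rfl⟩
    exact MirrorComplex.isSpecialPair P.isCycleList P.odd_length hτ (P.isFree q hq i hi)
      (P.isPairAt hq hi)
  · rintro c ⟨q, hq, i, hi, rfl⟩ t ⟨q', hq', i', hi', rfl⟩ hct
    have k1 := P.isPairAt hq hi
    have k2 := P.isPairAt hq' hi'
    exact MirrorComplex.areConcordant P.isCycleList P.odd_length hτ (P.isFree q hq i hi)
      (P.isFree q' hq' i' hi') k1 k2 hct (P.crosses q hq i hi q' hq' i' hi' (k1.apart k2 hct))
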